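/- **Setting.** Let $\mathcal V$ be a countable set with a metric $d$ in which all closed balls are finite. To every $x\in\mathcal V$ attach $\mathcal H_x=\mathbb C^{n_x}$ with $n_x\ge 1$. For finite $X\subset\mathcal V$ let $\mathcal H_X=\bigotimes_{x\in X}\mathcal H_x$ and let $\mathcal A_X=\bigotimes_{x\in X}M_{n_x}$ carry the operator norm. For $X\subset Y$ identify $A\in\mathcal A_X$ with $A\otimes 1\in\mathcal A_Y$. For $\mu>0$ put $\kappa_\mu=\sup_x\sum_y e^{-\mu d(x,y)}$, and assume that $\kappa_{\mu_0}<\infty$ for some $\mu_0>0$. Let $\Phi$ assign to each finite $X\subset\mathcal V$ a self-adjoint $\Phi(X)\in\mathcal A_X$. Assume that, for some $R,J>0$, $\Phi(X)=0$ whenever $\operatorname{diam}X>R$, that $\|\Phi(X)\|\le J$ for all $X$, and that $$N_\Phi=\sup_x\sum_{X\ni x,\ \Phi(X)\ne0}|X|<\infty .$$ Put $C_\Phi=\sup_x\sum_{X\ni x,\ \Phi(X)\neq 0}1\le N_\Phi$. For finite $V\subset\mathcal V$ let $H_V=\sum_{X\subset V}\Phi(X)$ and $\tau^V_t(A)=e^{itH_V}Ae^{-itH_V}$.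 Let $\partial_\Phi X$ be the set of those $x\in X$ for which there is a finite $Y\ni x$ with $Y\not\subset X$ and $\Phi(Y)\ne0$, and let $d(X,Y)=\min\{d(x,y):x\in X,\ y\in Y\}$. Call $c,v>0$ *Lieb–Robinson constants at rate $\mu$* if $$\|[\tau^V_t(A),B]\|\le c\,\|A\|\,\|B\|\min(|\partial_\Phi X|,|\partial_\Phi Y|)\,e^{-\mu(d(X,Y)-v|t|)}$$ for all finite $V\subset\mathcal V$, all disjoint $X,Y\subset V$, all $A\in\mathcal A_X$, $B\in\mathcal A_Y$ and all $t\in\mathbb R$. For finite $X\subset V$ let $\partial X=\{x\in X:\exists y\in V\setminus X,\ d(x,y)\le R\}$. For a set $\mathcal X\subset V$ and $\ell>R$ let $$\mathcal X_{\rm int}(\ell)=\{x\in\mathcal X: d(x,y)\ge\ell\ \ \forall y\in\partial\mathcal X\},\qquad \mathcal X_{\rm bd}(\ell)=\{x\in V:\exists y\in\partial\mathcal X,\ d(x,y)<\ell\},$$ $$\mathcal X_{\rm ext}(\ell)=\{x\in V\setminus\mathcal X: d(x,y)\ge\ell\ \ \forall y\in\partial\mathcal X\}.$$ The set $\mathcal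 X$ satisfies the *boundary–volume condition with constant $C>0$* if for all $\ell>R$ $$\max\{|\partial\mathcal X_{\rm int}(\ell)|,\ |\mathcal X_{\rm bd}(\ell)|,\ |\partial\mathcal X_{\rm ext}(\ell)|\}\le C\,\ell\,|\partial\mathcal X| .$$ **Theorem.** Let $\mu\ge2\mu_0$. Lieb–Robinson constants $c,v>0$ at rate $\mu$ exist. Moreover, for any such $c,v$ and any $\gamma,C>0$ there is a constant $K>0$, depending only on $R,J,\kappa_{\mu/2},C_\Phi,N_\Phi,\mu,c,v,\gamma,C$ (and not on $\ell$, $V$, $\mathcal X$), such that the following holds. Let $V\subset\mathcal V$ be a finite set for which $H_V$ has a unique normalized ground state $\psi_0$ (up to a phase) with ground state energy $E_0$, and for which all other eigenvalues of $H_V$ are at least $E_0+\gamma$ (in particular, $\gamma$ may be the length of the gap to the first excited state). Let $P_0$ be the projection onto $\mathbb C\psi_0$, and let $\mathcal X\subset V$ satisfy the boundary–volume condition with constant $C$. Then for every $\ell>R$ there are orthogonal projections $P_{\mathcal X}\in\mathcal A_{\mathcal X}$ and $P_{\mathcal X^c}\in\mathcal A_{V\setminus\mathcal X}$ and an observable $P_{\mathcal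 X_{\rm bd}}\in\mathcal A_{\mathcal X_{\rm bd}(3\ell)}$ with $\|P_{\mathcal X_{\rm bd}}\|\le1$ such that $$\|P_{\mathcal X_{\rm bd}}P_{\mathcal X}P_{\mathcal X^c}-P_0\|\le K\,C_\Phi N_\Phi\,|\partial\mathcal X|^2\,\ell^{7/2}\,e^{-\ell/(2\xi)},\qquad \frac2\xi=\frac{\mu\gamma^2}{\mu^2v^2+\gamma^2}.$$ -/

import Mathlib

open scoped Matrix.Norms.L2Operator ENNReal

noncomputable section

namespace SpinSystem

/-! ### Quantum spin systems: configurations, local algebras, embeddings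

A site `x` carries the Hilbert space `ℂ ^ (n x)`.  The Hilbert space `⨂_{x ∈ X} ℂ ^ (n x)` has an
orthonormal basis indexed by the configurations `Config n X`, so that the algebra of observables
`⨂_{x ∈ X} M_{n x}` is the algebra of matrices indexed by `Config n X`.  It carries the operator
norm coming from the Hilbert space norm (`Matrix.Norms.L2Operator`). -/

/-- Configurations on the finite set `X`: the index set of the product basis of `𝓗_X`. -/
abbrev Config {S : Type*} (n : S → ℕ) (X : Finset S) : Type _ :=
  (x : {x // x ∈ X}) → Fin (n x.1)

/-- The algebra `𝓐_X = ⨂_{x ∈ X} M_{n x}` of observables of the finite set `X`. -/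
abbrev LocalAlgebra {S : Type*} (n : S → ℕ) (X : Finset S) : Type _ :=
  Matrix (Config n X) (Config n X) ℂ

variable {S : Type*} {n : S → ℕ}

/-- Restriction of a configuration on `Y` to `X ⊆ Y`. -/
def restrict {X Y : Finset S} (h : X ⊆ Y) (σ : Config n Y) : Config n X :=
  fun x => σ ⟨x.1, h x.2⟩

open Classical in
/-- The embedding `𝓐_X → 𝓐_Y`, `A ↦ A ⊗ 1`, for `X ⊆ Y`. -/
def embed {X Y : Finset S} (h : X ⊆ Y) (A : LocalAlgebra n X) : LocalAlgebra n Y :=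
  Matrix.of fun σ τ =>
    if ∀ y : {y // y ∈ Y}, y.1 ∉ X → σ y = τ y then A (restrict h σ) (restrict h τ) else 0

/-! ### Interactions and local Hamiltonians -/

/-- An interaction: a self-adjoint element `Φ(X)` of `𝓐_X` for every finite set `X`. -/
structure Interaction {S : Type*} (n : S → ℕ) where
  /-- The interaction term `Φ(X)`. -/
  term : (X : Finset S) → LocalAlgebra n X
  isSelfAdjoint : ∀ X, IsSelfAdjoint (term X)

/-- The local Hamiltonian `H_V = ∑_{X ⊆ V} Φ(X)`. -/
def hamiltonian (Φ : Interaction n) (V : Finset S) : LocalAlgebra n V :=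
  ∑ X ∈ V.powerset.attach, embed (Finset.mem_powerset.1 X.2) (Φ.term X.1)

/-- The finite volume dynamics `τ_t^V(A) = e^{itH_V} A e^{-itH_V}`. -/
def evolve [DecidableEq S] (Φ : Interaction n) (V : Finset S) (t : ℝ) (A : LocalAlgebra n V) :
    LocalAlgebra n V :=
  NormedSpace.exp ((Complex.I * (t : ℂ)) • hamiltonian Φ V) * A *
    NormedSpace.exp (-((Complex.I * (t : ℂ)) • hamiltonian Φ V))

open Classical in
/-- `C_Φ = sup_x ∑_{X ∋ x} χ_Φ(X)`, as an extended nonnegative number. -/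
def countConst (Φ : Interaction n) : ℝ≥0∞ :=
  ⨆ x : S, ∑' X : Finset S, if x ∈ X ∧ Φ.term X ≠ 0 then 1 else 0

open Classical in
/-- `N_Φ = sup_x ∑_{X ∋ x} |X| χ_Φ(X)`, as an extended nonnegative number. -/
def sizeConst (Φ : Interaction n) : ℝ≥0∞ :=
  ⨆ x : S, ∑' X : Finset S, if x ∈ X ∧ Φ.term X ≠ 0 then (X.card : ℝ≥0∞) else 0

/-! ### Geometry -/

/-- `κ_μ = sup_x ∑_y e^{-μ d(x,y)}`, as an extended nonnegative number. -/
def kappa (S : Type*) [MetricSpace S] (μ : ℝ) : ℝ≥0∞ :=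
  ⨆ x : S, ∑' y : S, ENNReal.ofReal (Real.exp (-μ * dist x y))

/-- `d(X, Y) = min {d(x,y) : x ∈ X, y ∈ Y}` (with value `0` if one of the sets is empty). -/
def setDist [MetricSpace S] (X Y : Finset S) : ℝ :=
  sInf {r | ∃ x ∈ X, ∃ y ∈ Y, r = dist x y}

open Classical in
/-- The `Φ`-boundary `∂_Φ X` of a finite set `X`. -/
def phiBoundary (Φ : Interaction n) (X : Finset S) : Finset S :=
  X.filter fun x => ∃ Y : Finset S, x ∈ Y ∧ (∃ y ∈ Y, y ∉ X) ∧ Φ.term Y ≠ 0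

open Classical in
/-- The `R`-boundary `∂X` of `X` as a subset of `V`. -/
def boundary [MetricSpace S] (R : ℝ) (V X : Finset S) : Finset S :=
  X.filter fun x => ∃ y ∈ V, y ∉ X ∧ dist x y ≤ R

open Classical in
/-- The `ℓ`-interior of `X` in `V`. -/
def interiorSet [MetricSpace S] (R : ℝ) (V X : Finset S) (ℓ : ℝ) : Finset S :=
  X.filter fun x => ∀ y ∈ boundary R V X, ℓ ≤ dist x y

open Classical in
/-- The `ℓ`-border of `X` in `V`. -/
def borderSet [MetricSpace S] (R : ℝ) (V X : Finset S) (ℓ : ℝ) : Finset S :=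
  V.filter fun x => ∃ y ∈ boundary R V X, dist x y < ℓ

open Classical in
/-- The `ℓ`-exterior of `X` in `V`. -/
def exteriorSet [MetricSpace S] (R : ℝ) (V X : Finset S) (ℓ : ℝ) : Finset S :=
  V.filter fun x => x ∉ X ∧ ∀ y ∈ boundary R V X, ℓ ≤ dist x y

theorem borderSet_subset [MetricSpace S] (R : ℝ) (V X : Finset S) (ℓ : ℝ) :
    borderSet R V X ℓ ⊆ V :=
  Finset.filter_subset _ _

/-- The boundary-volume condition with constant `C`, for all length scales `ℓ > R`. -/
def BoundaryVolume [MetricSpace S] (R C : ℝ) (V X : Finset S) : Prop :=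
  ∀ ℓ : ℝ, R < ℓ →
    max (((boundary R V (interiorSet R V X ℓ)).card : ℝ))
      (max ((borderSet R V X ℓ).card : ℝ)
        ((boundary R V (exteriorSet R V X ℓ)).card : ℝ)) ≤
      C * ℓ * ((boundary R V X).card : ℝ)

/-! ### Lieb-Robinson constants -/

/-- `c` and `v` are Lieb-Robinson constants (prefactor and velocity) of `Φ` at the rate `μ`:
`‖[τ_t^V(A), B]‖ ≤ c ‖A‖ ‖B‖ min(|∂_Φ X|, |∂_Φ Y|) e^{-μ (d(X,Y) - v|t|)}` for all finite `V`,
all disjoint `X, Y ⊆ V`, all `A ∈ 𝓐_X`, `B ∈ 𝓐_Y`, and all real `t`. -/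
def LiebRobinson [MetricSpace S] [DecidableEq S] (Φ : Interaction n) (μ c v : ℝ) : Prop :=
  ∀ (V X Y : Finset S) (hX : X ⊆ V) (hY : Y ⊆ V), Disjoint X Y →
    ∀ (A : LocalAlgebra n X) (B : LocalAlgebra n Y) (t : ℝ),
      ‖evolve Φ V t (embed hX A) * embed hY B - embed hY B * evolve Φ V t (embed hX A)‖ ≤
        c * ‖A‖ * ‖B‖ *
          min ((phiBoundary Φ X).card : ℝ) ((phiBoundary Φ Y).card : ℝ) *
          Real.exp (-μ * (setDist X Y - v * |t|))

/-! ### Gapped ground states -/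

/-- `ψ` is the unique (up to phase) normalized ground state of the matrix `H`, and every
eigenvalue of `H` other than the ground state energy lies above it by at least `γ`.
For `γ > 0` the last clause says in particular that `E₀` is the smallest eigenvalue. -/
def IsGappedGroundState {ι : Type*} [Fintype ι] [DecidableEq ι] (H : Matrix ι ι ℂ)
    (ψ : ι → ℂ) (γ : ℝ) : Prop :=
  star ψ ⬝ᵥ ψ = 1 ∧ ∃ E₀ : ℝ,
    Module.End.eigenspace (Matrix.toLin' H) (E₀ : ℂ) = Submodule.span ℂ {ψ} ∧
    ∀ E : ℝ, Module.End.HasEigenvalue (Matrix.toLin' H) (E : ℂ) → E ≠ E₀ → E₀ + γ ≤ E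

/-- The projection `|ψ⟩⟨ψ|` onto the line of a normalized vector `ψ`. -/
def groundProjection {ι : Type*} (ψ : ι → ℂ) : Matrix ι ι ℂ :=
  Matrix.vecMulVec ψ (star ψ)

/-! ### The parameters on which the prefactor may depend -/

/-- The numerical parameters on which the prefactor `K` may depend: the range `R`, the bound `J`
on the interaction terms, `κ_{μ/2}`, `C_Φ`, `N_Φ`, the Lieb-Robinson data `μ, c, v`, the gap `γ`,
and the constant `C` of the boundary-volume condition. -/
structure Parameters where
  R : ℝ
  J : ℝ
  kappaHalf : ℝ
  cPhi : ℝ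
  nPhi : ℝ
  μ : ℝ
  c : ℝ
  v : ℝ
  γ : ℝ
  C : ℝ

end SpinSystem

end

/-! Shift the Hamiltonian `H` so that the ground state energy is 0, and split it into the terms
inside the ℓ-interior, those inside the ℓ-exterior, and the remaining border terms. Averaging the
Heisenberg dynamics of `H` over Gaussian distributed times leaves `H` itself unchanged, so `H` is
also the sum of the three averaged pieces plus a scalar. The averaged pieces are much better behaved
than the original ones.

Action on the ground state. The Gaussian average of e^{itH} is a Gaussian function of `H`; because
of the gap it equals P₀ + K H, with K exponentially small in the variance
(`IsGappedGroundState.exists_filter`). Hence the averaged interior piece minus its expectation,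
applied to P₀, is K [H, h] P₀ (`norm_timeAverage_sub_mul_le`), and [H, h] involves only terms at the
edge of the interior. The same holds for the exterior.

Locality of the two sides. A Lieb-Robinson bound allows the full dynamics of these pieces to be
replaced by the dynamics without coupling across the boundary of `X`
(`norm_dyn_subHam_sub_decoupled_le`). This gives self-adjoint M₁ in 𝓐_X and M₂ in 𝓐_{V∖X} with M_i
P₀ of norm at most θ². The spectral projection P_i of M_i onto [-θ, θ] then satisfies ‖M_i P_i‖ ≤ θ
and, by a Chebyshev argument, ‖(1 - P_i) P₀‖ ≤ θ (`exists_side_projection`).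

Locality of the border. H - (M₁ + M₂) is the averaged border piece up to a small error and a scalar,
so e^{itH} e^{-it(M₁+M₂)} almost commutes with observables far from the boundary. Its Gaussian
average T is therefore close to an observable of the 3ℓ-border, obtained by a normalized partial
trace (`exists_local_approximation`).

Conclusion. On the range of P₁P₂ the factor e^{-it(M₁+M₂)} is nearly 1, hence P₀ ≈ P₀P₁P₂ ≈ (average
of e^{itH}) P₁P₂ ≈ T P₁P₂ (`norm_mul_mul_sub_le`, assembled in `exists_projections`). The variance
is chosen proportional to ℓ so that the gap filter and the Lieb-Robinson tails decay at the same
rate (`exp_neg_mul_exp_le`).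

The existence of Lieb-Robinson constants is separate: a trivial a priori bound in finite volume is
improved by a contraction with factor 1/2 until its dependence on the volume disappears
(`active_bound`). -/

noncomputable section

namespace SpinSystem

/-! ### Unitary dynamics in a C⋆-algebra -/

section Dynamics

variable {A : Type*} [CStarAlgebra A]

/-- The commutator `BC - CB`. -/
def com (B C : A) : A := B * C - C * B

theorem com_comm (B C : A) : com B C = -com C B := by simp [com]

theorem com_add_left (B B' C : A) : com (B + B') C = com B C + com B' C := by
  simp only [com]; noncomm_ring

theorem com_sub_left (B B' C : A) : com (B - B') C = com B C - com B' C := by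
  simp only [com]; noncomm_ring

theorem com_sub_right (B C C' : A) : com B (C - C') = com B C - com B C' := by
  simp only [com]; noncomm_ring

theorem com_neg_left (B C : A) : com (-B) C = -com B C := by
  simp only [com]; noncomm_ring

theorem com_sum_left {κ : Type*} (s : Finset κ) (f : κ → A) (C : A) :
    com (∑ i ∈ s, f i) C = ∑ i ∈ s, com (f i) C := by
  simp [com, Finset.mul_sum, Finset.sum_mul]

theorem com_sum_right {κ : Type*} (s : Finset κ) (B : A) (f : κ → A) :
    com B (∑ i ∈ s, f i) = ∑ i ∈ s, com B (f i) := by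
  simp [com, Finset.mul_sum, Finset.sum_mul]

theorem com_eq_zero {B C : A} (h : Commute B C) : com B C = 0 := sub_eq_zero.2 h

theorem com_smul_one_left (z : ℂ) (C : A) : com (z • (1 : A)) C = 0 := by simp [com]

theorem norm_com_le (B C : A) : ‖com B C‖ ≤ 2 * ‖B‖ * ‖C‖ := by
  calc ‖B * C - C * B‖ ≤ ‖B * C‖ + ‖C * B‖ := norm_sub_le _ _
    _ ≤ ‖B‖ * ‖C‖ + ‖C‖ * ‖B‖ := add_le_add (norm_mul_le _ _) (norm_mul_le _ _)
    _ = _ := by ring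

theorem norm_com_comm (B C : A) : ‖com B C‖ = ‖com C B‖ := by
  rw [com_comm, norm_neg]

/-- The propagator `e^{itH}`. -/
def propagator (H : A) (t : ℝ) : A := NormedSpace.exp ((Complex.I * (t : ℂ)) • H)

theorem propagator_zero (H : A) : propagator H 0 = 1 := by simp [propagator]

theorem propagator_add (H : A) (s t : ℝ) :
    propagator H (s + t) = propagator H s * propagator H t := by
  unfold propagator
  let _ : NormedAlgebra ℚ A := NormedAlgebra.restrictScalars ℚ ℂ A
  rw [← NormedSpace.exp_add_of_commute]
  · congr 1; push_cast; rw [← add_smul]; ring_nf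
  · exact ((Commute.refl H).smul_left _).smul_right _

theorem propagator_mul_neg (H : A) (t : ℝ) : propagator H t * propagator H (-t) = 1 := by
  rw [← propagator_add]; simp [propagator_zero]

theorem propagator_neg_mul (H : A) (t : ℝ) : propagator H (-t) * propagator H t = 1 := by
  rw [← propagator_add]; simp [propagator_zero]

theorem propagator_commute {H K : A} (h : Commute H K) (t : ℝ) : Commute (propagator H t) K := by
  let _ : NormedAlgebra ℚ A := NormedAlgebra.restrictScalars ℚ ℂ A
  exact (h.smul_left _).exp_left

theorem propagator_add_of_commute {H K : A} (h : Commute H K) (t : ℝ) :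
    propagator (H + K) t = propagator H t * propagator K t := by
  unfold propagator
  let _ : NormedAlgebra ℚ A := NormedAlgebra.restrictScalars ℚ ℂ A
  rw [smul_add, NormedSpace.exp_add_of_commute ((h.smul_left _).smul_right _)]

theorem star_propagator {H : A} (hH : IsSelfAdjoint H) (t : ℝ) :
    star (propagator H t) = propagator H (-t) := by
  unfold propagator
  rw [NormedSpace.star_exp, star_smul, hH.star_eq]
  simp

theorem propagator_mem_unitary {H : A} (hH : IsSelfAdjoint H) (t : ℝ) :
    propagator H t ∈ unitary A := by
  rw [Unitary.mem_iff, star_propagator hH]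
  exact ⟨propagator_neg_mul H t, propagator_mul_neg H t⟩

theorem norm_propagator_mul {H : A} (hH : IsSelfAdjoint H) (t : ℝ) (B : A) :
    ‖propagator H t * B‖ = ‖B‖ :=
  CStarRing.norm_mem_unitary_mul _ (propagator_mem_unitary hH t)

theorem norm_mul_propagator {H : A} (hH : IsSelfAdjoint H) (t : ℝ) (B : A) :
    ‖B * propagator H t‖ = ‖B‖ :=
  CStarRing.norm_mul_mem_unitary _ (propagator_mem_unitary hH t)

theorem hasDerivAt_propagator (H : A) (t : ℝ) :
    HasDerivAt (propagator H) (propagator H t * (Complex.I • H)) t := by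
  have h := hasDerivAt_exp_smul_const (𝕂 := ℝ) (Complex.I • H) t
  have e : propagator H = fun u : ℝ => NormedSpace.exp (u • (Complex.I • H)) := by
    funext u
    unfold propagator
    rw [mul_smul, smul_comm, Complex.coe_smul]
  rw [e]
  exact h

theorem continuous_propagator (H : A) : Continuous (propagator H) :=
  continuous_iff_continuousAt.2 fun t => (hasDerivAt_propagator H t).continuousAt

/-- The Heisenberg dynamics `e^{itH} B e^{-itH}`. -/
def dyn (H : A) (t : ℝ) (B : A) : A := propagator H t * B * propagator H (-t)

theorem dyn_zero (H B : A) : dyn H 0 B = B := by simp [dyn, propagator_zero]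

theorem dyn_dyn (H : A) (s t : ℝ) (B : A) : dyn H s (dyn H t B) = dyn H (s + t) B := by
  unfold dyn
  rw [propagator_add, show -(s + t) = -t + -s by ring, propagator_add]
  noncomm_ring

theorem dyn_neg_dyn (H : A) (t : ℝ) (B : A) : dyn H (-t) (dyn H t B) = B := by
  rw [dyn_dyn]; simp [dyn_zero]

theorem dyn_dyn_neg (H : A) (t : ℝ) (B : A) : dyn H t (dyn H (-t) B) = B := by
  rw [dyn_dyn]; simp [dyn_zero]

theorem dyn_add (H : A) (t : ℝ) (B C : A) : dyn H t (B + C) = dyn H t B + dyn H t C := by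
  simp [dyn, mul_add, add_mul]

theorem dyn_sub (H : A) (t : ℝ) (B C : A) : dyn H t (B - C) = dyn H t B - dyn H t C := by
  simp [dyn, mul_sub, sub_mul]

theorem dyn_smul (H : A) (t : ℝ) (z : ℂ) (B : A) : dyn H t (z • B) = z • dyn H t B := by
  simp [dyn]

theorem dyn_one (H : A) (t : ℝ) : dyn H t 1 = 1 := by simp [dyn, propagator_mul_neg]

theorem dyn_mul (H : A) (t : ℝ) (B C : A) : dyn H t (B * C) = dyn H t B * dyn H t C := by
  have := propagator_neg_mul H t
  calc dyn H t (B * C) = propagator H t * B * 1 * C * propagator H (-t) := by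
        unfold dyn; noncomm_ring
    _ = _ := by rw [← this]; unfold dyn; noncomm_ring

theorem dyn_com (H : A) (t : ℝ) (B C : A) : dyn H t (com B C) = com (dyn H t B) (dyn H t C) := by
  simp only [com, dyn_sub, dyn_mul]

theorem dyn_sum (H : A) (t : ℝ) {κ : Type*} (s : Finset κ) (f : κ → A) :
    dyn H t (∑ i ∈ s, f i) = ∑ i ∈ s, dyn H t (f i) := by
  simp [dyn, Finset.mul_sum, Finset.sum_mul]

theorem star_dyn {H : A} (hH : IsSelfAdjoint H) (t : ℝ) (B : A) :
    star (dyn H t B) = dyn H t (star B) := by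
  simp [dyn, star_propagator hH, mul_assoc]

theorem norm_dyn {H : A} (hH : IsSelfAdjoint H) (t : ℝ) (B : A) : ‖dyn H t B‖ = ‖B‖ := by
  unfold dyn
  rw [norm_mul_propagator hH, norm_propagator_mul hH]

theorem dyn_of_commute {H B : A} (h : Commute H B) (t : ℝ) : dyn H t B = B := by
  unfold dyn
  rw [(propagator_commute h t).eq, mul_assoc, propagator_mul_neg, mul_one]

theorem dyn_add_of_commute {H K B : A} (h : Commute H K) (hB : Commute K B) (t : ℝ) :
    dyn (H + K) t B = dyn H t B := by
  calc dyn (H + K) t B = dyn H t (dyn K t B) := by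
        have : Commute (propagator H (-t)) (propagator K (-t)) :=
          (propagator_commute (propagator_commute h (-t)).symm (-t)).symm
        unfold dyn
        rw [propagator_add_of_commute h, propagator_add_of_commute h, this.eq]
        noncomm_ring
    _ = _ := by rw [dyn_of_commute hB]

theorem dyn_add_smul_one (H B : A) (z : ℂ) (t : ℝ) : dyn (H + z • (1 : A)) t B = dyn H t B :=
  dyn_add_of_commute ((Commute.one_right H).smul_right z) ((Commute.one_left B).smul_left z) t

theorem propagator_neg_left (H : A) (t : ℝ) : propagator (-H) t = propagator H (-t) := by
  simp [propagator]

theorem dyn_neg_left (H : A) (t : ℝ) (B : A) : dyn (-H) t B = dyn H (-t) B := by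
  simp [dyn, propagator_neg_left]

theorem continuous_dyn (H B : A) : Continuous fun t => dyn H t B := by
  unfold dyn
  exact ((continuous_propagator H).mul continuous_const).mul
    ((continuous_propagator H).comp continuous_neg)

theorem hasDerivAt_dyn (H B : A) (t : ℝ) :
    HasDerivAt (fun t => dyn H t B) (dyn H t (Complex.I • com H B)) t := by
  have h1 := hasDerivAt_propagator H t
  have h2 : HasDerivAt (fun s => propagator H (-s)) (-(propagator H (-t) * (Complex.I • H))) t := by
    simpa [Function.comp_def] using (hasDerivAt_propagator H (-t)).scomp t (hasDerivAt_neg t)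
  have h := (h1.mul_const B).mul h2
  have hc : propagator H (-t) * H = H * propagator H (-t) := propagator_commute (Commute.refl H) _
  refine h.congr_deriv ?_
  simp only [dyn, com, mul_smul_comm, smul_mul_assoc, hc, smul_sub]
  simp only [mul_sub, sub_mul, mul_neg, mul_assoc, mul_smul_comm, smul_mul_assoc]
  abel

theorem norm_com_dyn {H : A} (hH : IsSelfAdjoint H) (t : ℝ) (B C : A) :
    ‖com (dyn H t B) C‖ = ‖com B (dyn H (-t) C)‖ := by
  rw [← norm_dyn hH t (com B (dyn H (-t) C)), dyn_com, dyn_dyn_neg]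

/-- Interaction picture: `dyn H (-s) (dyn H' s B)` starts at `B` and its velocity is a conjugate by
`H` of i[H' - H, dyn H' s B]. That conjugation is isometric, so the bound on the commutator can be
integrated. -/
theorem norm_dyn_sub_dyn_le_of_nonneg {H H' : A} (hH : IsSelfAdjoint H)
    (B : A) {g G : ℝ → ℝ} (hG : ∀ s, HasDerivAt G (g s) s)
    {t : ℝ} (ht : 0 ≤ t)
    (hg : ∀ s, 0 ≤ s → s ≤ t → ‖com (H - H') (dyn H' s B)‖ ≤ g s) :
    ‖dyn H t B - dyn H' t B‖ ≤ G t - G 0 := by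
  set f : ℝ → A := fun s => dyn H (-s) (dyn H' s B) - B with hf
  have hd : ∀ s, HasDerivAt f (dyn H (-s) (Complex.I • com (H' - H) (dyn H' s B))) s := by
    intro s
    have h0 : HasDerivAt (fun s => propagator H s) (propagator H s * (Complex.I • H)) s :=
      hasDerivAt_propagator H s
    have h1 : HasDerivAt (fun s => propagator H (-s))
        (-(propagator H (-s) * (Complex.I • H))) s := by
      simpa [Function.comp_def] using (hasDerivAt_propagator H (-s)).scomp s (hasDerivAt_neg s)
    have h2 := hasDerivAt_dyn H' B s
    have h3 := ((h1.mul h2).mul h0).sub_const B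
    have e : f = fun s => propagator H (-s) * dyn H' s B * propagator H s - B := by
      funext s; simp [hf, dyn]
    rw [e]
    refine h3.congr_deriv ?_
    have hc : propagator H s * H = H * propagator H s := propagator_commute (Commute.refl H) _
    have hl : dyn H' s (Complex.I • com H' B) = Complex.I • com H' (dyn H' s B) := by
      rw [dyn_smul, dyn_com, dyn_of_commute (Commute.refl H')]
    rw [hl]
    simp only [com, dyn, Pi.mul_apply, neg_neg, mul_smul_comm, smul_mul_assoc, hc, smul_sub, mul_sub, sub_mul,
      neg_mul, mul_assoc, add_mul]
    abel
  have key := image_norm_le_of_norm_deriv_right_le_deriv_boundary (a := 0) (b := t) (f := f)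
    (f' := fun s => dyn H (-s) (Complex.I • com (H' - H) (dyn H' s B)))
    (B := fun s => G s - G 0) (B' := g)
    (fun s _ => (hd s).continuousAt.continuousWithinAt) (fun s _ => (hd s).hasDerivWithinAt)
    (by simp [hf, dyn_zero]) (fun s => (hG s).sub_const _)
    (fun s hs => by
      rw [norm_dyn hH, norm_smul, Complex.norm_I, one_mul, ← neg_sub, com_neg_left, norm_neg]
      exact hg s hs.1 hs.2.le) (Set.right_mem_Icc.2 ht)
  rw [← norm_dyn hH (-t), dyn_sub, dyn_neg_dyn, ← norm_neg, neg_sub]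
  exact key

/-- Duhamel's estimate for the difference of two dynamics. -/
theorem norm_dyn_sub_dyn_le {H H' : A} (hH : IsSelfAdjoint H)
    (B : A) {g G : ℝ → ℝ} (hG : ∀ s, HasDerivAt G (g s) s) (t : ℝ)
    (hg : ∀ s, |s| ≤ |t| → ‖com (H - H') (dyn H' s B)‖ ≤ g |s|) :
    ‖dyn H t B - dyn H' t B‖ ≤ G |t| - G 0 := by
  rcases le_total 0 t with ht | ht
  · rw [abs_of_nonneg ht] at hg ⊢
    exact norm_dyn_sub_dyn_le_of_nonneg hH B hG ht
      (fun s hs hst => by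
        have := hg s (by rwa [abs_of_nonneg hs])
        rwa [abs_of_nonneg hs] at this)
  · rw [abs_of_nonpos ht] at hg ⊢
    -- Negative times reduce to positive ones by reversing the sign of both generators.
    have h := norm_dyn_sub_dyn_le_of_nonneg (H := -H) (H' := -H') hH.neg B hG (neg_nonneg.2 ht)
      (fun s hs hst => by
        have := hg (-s) (by rwa [abs_neg, abs_of_nonneg hs])
        rw [abs_neg, abs_of_nonneg hs] at this
        rw [dyn_neg_left, neg_sub_neg, ← neg_sub, com_neg_left, norm_neg]
        exact this)
    simpa [dyn_neg_left] using h

/-- Duhamel's estimate with a uniform bound on the integrand. -/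
theorem norm_dyn_sub_dyn_le_mul {H H' : A} (hH : IsSelfAdjoint H)
    (B : A) {t δ : ℝ} (hg : ∀ s, |s| ≤ |t| → ‖com (H - H') (dyn H' s B)‖ ≤ δ) :
    ‖dyn H t B - dyn H' t B‖ ≤ |t| * δ := by
  have h := norm_dyn_sub_dyn_le hH B (G := fun s => s * δ) (g := fun _ => δ)
    (fun s => by simpa using (hasDerivAt_id s).mul_const δ) t hg
  simpa using h

/-- Comparison of two dynamics through the comparison of their generators. -/
theorem norm_dyn_sub_dyn_le_of_com {H H' B : A} {t δ : ℝ}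
    (h : ∀ s, |s| ≤ |t| → ‖dyn H s (com H B) - dyn H' s (com H' B)‖ ≤ δ) :
    ‖dyn H t B - dyn H' t B‖ ≤ |t| * δ := by
  have hd : ∀ s ∈ Set.uIcc 0 t, HasDerivWithinAt (fun s => dyn H s B - dyn H' s B)
      (dyn H s (Complex.I • com H B) - dyn H' s (Complex.I • com H' B)) (Set.uIcc 0 t) s :=
    fun s _ => ((hasDerivAt_dyn H B s).sub (hasDerivAt_dyn H' B s)).hasDerivWithinAt
  have := (convex_uIcc 0 t).norm_image_sub_le_of_norm_hasDerivWithin_le hd (C := δ) (fun s hs => by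
    rw [dyn_smul, dyn_smul, ← smul_sub, norm_smul, Complex.norm_I, one_mul]
    refine h s ?_
    simpa using Set.abs_sub_left_of_mem_uIcc hs) Set.left_mem_uIcc Set.right_mem_uIcc
  simpa [dyn_zero, mul_comm] using this

end Dynamics

end SpinSystem

namespace SpinSystem

/-! ### Averaging over a group of monomial unitaries -/

section MonomialAveraging

open Matrix
open scoped Kronecker

variable {α β κ : Type*} [Fintype α] [DecidableEq α] [Fintype β] [DecidableEq β]
  [Fintype κ] [DecidableEq κ]

/-- The monomial matrix with entries `d i` at the places `(i, σ i)`. -/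
def monomialMatrix (σ : Equiv.Perm κ) (d : κ → ℂ) : Matrix κ κ ℂ :=
  Matrix.of fun i j => if σ i = j then d i else 0

theorem one_kronecker_monomialMatrix {α β : Type*} [DecidableEq α] [DecidableEq β]
    (σ : Equiv.Perm β) (d : β → ℂ) :
    (1 : Matrix α α ℂ) ⊗ₖ monomialMatrix σ d =
      monomialMatrix (Equiv.prodCongr (Equiv.refl α) σ) (fun i => d i.2) := by
  ext ⟨a, b⟩ ⟨a', b'⟩
  simp only [kroneckerMap_apply, monomialMatrix, of_apply, one_apply, Equiv.prodCongr_apply,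
    Prod.map_apply, Prod.mk.injEq, Equiv.refl_apply]
  split_ifs <;> simp_all

theorem monomialMatrix_conj_apply (σ : Equiv.Perm κ) (d : κ → ℂ) (T : Matrix κ κ ℂ) (i j : κ) :
    (monomialMatrix σ d * T * star (monomialMatrix σ d)) i j = d i * star (d j) * T (σ i) (σ j) := by
  simp [Matrix.mul_apply, monomialMatrix, star_eq_conjTranspose, ite_mul, apply_ite]
  ring

theorem monomialMatrix_mul_star (σ : Equiv.Perm κ) {d : κ → ℂ} (hd : ∀ i, d i * star (d i) = 1) :
    monomialMatrix σ d * star (monomialMatrix σ d) = 1 := by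
  ext i j
  have h := monomialMatrix_conj_apply σ d 1 i j
  rw [mul_one] at h
  rw [h, Matrix.one_apply, Matrix.one_apply]
  by_cases hij : i = j
  · subst hij; simpa using hd i
  · simp [hij]

theorem monomialMatrix_mem_unitary (σ : Equiv.Perm κ) {d : κ → ℂ}
    (hd : ∀ i, d i * star (d i) = 1) : monomialMatrix σ d ∈ unitary (Matrix κ κ ℂ) := by
  rw [Unitary.mem_iff]
  have := monomialMatrix_mul_star σ hd
  exact ⟨mul_eq_one_comm.1 this, this⟩


/-- The normalized partial trace. -/
def partialTrace (T : Matrix (α × β) (α × β) ℂ) : Matrix α α ℂ :=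
  Matrix.of fun a a' => (Fintype.card β : ℂ)⁻¹ * ∑ b, T (a, b) (a', b)

/-- The unitaries are products of clock and shift matrices on ℤ/N, with N the cardinality of β.
Summing over characters kills the entries off the diagonal of the second factor; summing over shifts
averages the diagonal ones. -/
theorem exists_average_partialTrace [Nonempty β] :
    ∃ (ω : Type) (_ : Fintype ω) (_ : Nonempty ω) (U : ω → Matrix β β ℂ),
      (∀ i, U i ∈ unitary (Matrix β β ℂ)) ∧ ∀ T : Matrix (α × β) (α × β) ℂ,
        partialTrace T ⊗ₖ (1 : Matrix β β ℂ) =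
          (Fintype.card ω : ℂ)⁻¹ • ∑ i, (1 ⊗ₖ U i) * T * star (1 ⊗ₖ U i) := by
  set N := Fintype.card β with hN
  have : NeZero N := ⟨Fintype.card_ne_zero⟩
  let g : β ≃ ZMod N := Fintype.equivOfCardEq (by rw [ZMod.card])
  let τ : ZMod N → Equiv.Perm β := fun k => (g.trans (Equiv.addRight k)).trans g.symm
  have hd : ∀ (ψ : AddChar (ZMod N) ℂ) (b : β), ψ (g b) * star (ψ (g b)) = 1 := by
    intro ψ b
    have h1 : ‖ψ (g b)‖ = 1 := AddChar.norm_apply ψ _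
    have := Complex.mul_conj (ψ (g b))
    rw [Complex.normSq_eq_norm_sq, h1] at this
    simpa using this
  have hcard : Fintype.card (AddChar (ZMod N) ℂ × ZMod N) = N * N := by
    rw [Fintype.card_prod, AddChar.card_eq, ZMod.card]
  refine ⟨AddChar (ZMod N) ℂ × ZMod N, inferInstance, inferInstance,
    fun i => monomialMatrix (τ i.2) (fun b => i.1 (g b)),
    fun i => monomialMatrix_mem_unitary _ (hd i.1), fun T => ?_⟩
  ext ⟨a, b⟩ ⟨a', b'⟩
  simp only [one_kronecker_monomialMatrix, Matrix.smul_apply, Matrix.sum_apply, monomialMatrix_conj_apply,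
    Fintype.sum_prod_type, hcard]
  have hψ : ∑ ψ : AddChar (ZMod N) ℂ, ψ (g b) * star (ψ (g b')) = if b = b' then (N : ℂ) else 0 := by
    have := AddChar.sum_apply_eq_ite (α := ZMod N) (g b - g b')
    rw [ZMod.card] at this
    simp only [sub_eq_zero, EmbeddingLike.apply_eq_iff_eq] at this
    rw [← this]
    refine Finset.sum_congr rfl fun ψ _ => ?_
    rw [AddChar.map_sub_eq_div, div_eq_mul_inv]
    congr 1
    rw [eq_comm, inv_eq_of_mul_eq_one_right (hd ψ b')]
  have hsum : ∀ x y : β, ∑ k : ZMod N, T (a, τ k x) (a', τ k x) = ∑ c, T (a, c) (a', c) := by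
    intro x y
    refine Fintype.sum_equiv ((Equiv.addLeft (g x)).trans g.symm) _ _ fun k => ?_
    simp [τ]
  simp only [kroneckerMap_apply, partialTrace, of_apply, one_apply, Equiv.prodCongr_apply,
    Prod.map_apply, Equiv.refl_apply, smul_eq_mul]
  simp_rw [← Finset.mul_sum, ← Finset.sum_mul, hψ]
  have hN0 : (N : ℂ) ≠ 0 := Nat.cast_ne_zero.2 (NeZero.ne N)
  by_cases hb : b = b'
  · subst hb
    rw [hsum b b]
    rw [← hN, if_pos rfl, if_pos rfl]
    push_cast
    field_simp
  · simp [hb]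

theorem norm_average_le {ω : Type*} [Fintype ω] [Nonempty ω] {E : Type*} [NormedAddCommGroup E]
    [NormedSpace ℂ E] (f : ω → E) {δ : ℝ} (h : ∀ i, ‖f i‖ ≤ δ) :
    ‖(Fintype.card ω : ℂ)⁻¹ • ∑ i, f i‖ ≤ δ := by
  have h0 : (0 : ℝ) < Fintype.card ω := Nat.cast_pos.2 Fintype.card_pos
  rw [norm_smul, norm_inv, Complex.norm_natCast, inv_mul_le_iff₀ h0]
  calc ‖∑ i, f i‖ ≤ ∑ _i : ω, δ := norm_sum_le_of_le _ fun i _ => h i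
    _ = _ := by simp

theorem norm_partialTrace_kronecker_le [Nonempty β] (T : Matrix (α × β) (α × β) ℂ) :
    ‖partialTrace T ⊗ₖ (1 : Matrix β β ℂ)‖ ≤ ‖T‖ := by
  obtain ⟨ω, _, _, U, hU, h⟩ := exists_average_partialTrace (α := α) (β := β)
  rw [h]
  have hU' : ∀ i, (1 : Matrix α α ℂ) ⊗ₖ U i ∈ unitary (Matrix (α × β) (α × β) ℂ) :=
    fun i => kronecker_mem_unitary (one_mem _) (hU i)
  refine norm_average_le _ fun i => ?_
  rw [CStarRing.norm_mul_mem_unitary _ (Unitary.star_mem (hU' i)),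
    CStarRing.norm_mem_unitary_mul _ (hU' i)]

/-- Each conjugate U T U* differs from T by exactly the norm of the commutator of T with U, and the
partial trace is an average of such conjugates. -/
theorem norm_partialTrace_kronecker_sub_le [Nonempty β] (T : Matrix (α × β) (α × β) ℂ) {δ : ℝ}
    (h : ∀ U ∈ unitary (Matrix β β ℂ), ‖com T (1 ⊗ₖ U)‖ ≤ δ) :
    ‖partialTrace T ⊗ₖ (1 : Matrix β β ℂ) - T‖ ≤ δ := by
  obtain ⟨ω, _, _, U, hU, hav⟩ := exists_average_partialTrace (α := α) (β := β)
  have hU' : ∀ i, (1 : Matrix α α ℂ) ⊗ₖ U i ∈ unitary (Matrix (α × β) (α × β) ℂ) :=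
    fun i => kronecker_mem_unitary (one_mem _) (hU i)
  have h0 : (Fintype.card ω : ℂ) ≠ 0 := Nat.cast_ne_zero.2 Fintype.card_ne_zero
  have : partialTrace T ⊗ₖ (1 : Matrix β β ℂ) - T =
      (Fintype.card ω : ℂ)⁻¹ • ∑ i, ((1 ⊗ₖ U i) * T * star (1 ⊗ₖ U i) - T) := by
    rw [hav T, Finset.sum_sub_distrib, smul_sub]
    simp [← Nat.cast_smul_eq_nsmul ℂ, smul_smul, h0]
  rw [this]
  refine norm_average_le _ fun i => ?_
  rw [← CStarRing.norm_mul_mem_unitary _ (hU' i), sub_mul, mul_assoc _ (star _),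
    (Unitary.mem_iff.1 (hU' i)).1, mul_one, ← norm_neg, neg_sub]
  exact h _ (hU i)

end MonomialAveraging

/-! ### The embeddings of the local algebras -/

section Embedding

open Matrix
open scoped Kronecker

variable {S : Type*} {n : S → ℕ} [DecidableEq S]

/-- Splitting a configuration on `V` into its parts on `X ⊆ V` and on `V \ X`. -/
def splitConfig {X V : Finset S} (h : X ⊆ V) : Config n V ≃ Config n X × Config n (V \ X) where
  toFun σ := (restrict h σ, restrict Finset.sdiff_subset σ)
  invFun p x := if hx : x.1 ∈ X then p.1 ⟨x.1, hx⟩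
    else p.2 ⟨x.1, Finset.mem_sdiff.2 ⟨x.2, hx⟩⟩
  left_inv σ := by
    funext x
    by_cases hx : x.1 ∈ X <;> simp [restrict, hx]
  right_inv p := by
    refine Prod.ext ?_ ?_
    · funext x
      simp [restrict]
    · funext x
      have := (Finset.mem_sdiff.1 x.2).2
      simp [restrict, this]

theorem embed_eq_submatrix {X V : Finset S} (h : X ⊆ V) (A : LocalAlgebra n X) :
    embed h A = (A ⊗ₖ (1 : LocalAlgebra n (V \ X))).submatrix (splitConfig h) (splitConfig h) := by
  ext σ τ
  simp only [embed, of_apply, submatrix_apply, kroneckerMap_apply, splitConfig, Equiv.coe_fn_mk,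
    one_apply]
  have : (∀ y : {y // y ∈ V}, y.1 ∉ X → σ y = τ y) ↔
      restrict (Finset.sdiff_subset (s := V) (t := X)) σ = restrict Finset.sdiff_subset τ := by
    constructor
    · intro h'
      funext y
      exact h' ⟨y.1, _⟩ (Finset.mem_sdiff.1 y.2).2
    · intro h' y hy
      exact congrFun h' ⟨y.1, Finset.mem_sdiff.2 ⟨y.2, hy⟩⟩
  by_cases hc : ∀ y : {y // y ∈ V}, y.1 ∉ X → σ y = τ y
  · rw [if_pos hc, if_pos (this.1 hc), mul_one]
  · rw [if_neg hc, if_neg fun h' => hc (this.2 h'), mul_zero]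

theorem embed_sdiff_eq_submatrix {X V : Finset S} (h : X ⊆ V) (B : LocalAlgebra n (V \ X)) :
    embed (Finset.sdiff_subset : V \ X ⊆ V) B =
      ((1 : LocalAlgebra n X) ⊗ₖ B).submatrix (splitConfig h) (splitConfig h) := by
  ext σ τ
  simp only [embed, of_apply, submatrix_apply, kroneckerMap_apply, splitConfig, Equiv.coe_fn_mk,
    one_apply]
  have : (∀ y : {y // y ∈ V}, y.1 ∉ V \ X → σ y = τ y) ↔ restrict h σ = restrict h τ := by
    constructor
    · intro h'
      funext y
      exact h' ⟨y.1, _⟩ fun hy => (Finset.mem_sdiff.1 hy).2 y.2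
    · intro h' y hy
      have hyX : y.1 ∈ X := by
        by_contra hn
        exact hy (Finset.mem_sdiff.2 ⟨y.2, hn⟩)
      exact congrFun h' ⟨y.1, hyX⟩
  by_cases hc : ∀ y : {y // y ∈ V}, y.1 ∉ V \ X → σ y = τ y
  · rw [if_pos hc, if_pos (this.1 hc), one_mul]
  · rw [if_neg hc, if_neg fun h' => hc (this.2 h'), zero_mul]

/-- The embedding `A ↦ A ⊗ 1` as a homomorphism of star algebras. -/
def embedHom {X V : Finset S} (h : X ⊆ V) : LocalAlgebra n X →⋆ₐ[ℂ] LocalAlgebra n V where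
  toFun := embed h
  map_one' := by rw [embed_eq_submatrix]; simp
  map_mul' A B := by
    simp only [embed_eq_submatrix]
    rw [submatrix_mul_equiv, ← mul_kronecker_mul, one_mul]
  map_zero' := by rw [embed_eq_submatrix]; simp
  map_add' A B := by simp only [embed_eq_submatrix, add_kronecker, submatrix_add]; rfl
  commutes' z := by
    rw [embed_eq_submatrix, Algebra.algebraMap_eq_smul_one, Algebra.algebraMap_eq_smul_one,
      smul_kronecker, one_kronecker_one, submatrix_smul]
    simp
  map_star' A := by
    simp only [embed_eq_submatrix, star_eq_conjTranspose, conjTranspose_submatrix,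
      conjTranspose_kronecker, conjTranspose_one]

theorem embedHom_apply {X V : Finset S} (h : X ⊆ V) (A : LocalAlgebra n X) :
    embedHom h A = embed h A := rfl

theorem embed_embed {X Y V : Finset S} (h : X ⊆ Y) (h' : Y ⊆ V) (A : LocalAlgebra n X) :
    embed h' (embed h A) = embed (h.trans h') A := by
  ext σ τ
  simp only [embed, of_apply]
  have : (∀ y : {y // y ∈ V}, y.1 ∉ X → σ y = τ y) ↔ (∀ y : {y // y ∈ V}, y.1 ∉ Y → σ y = τ y) ∧
      ∀ y : {y // y ∈ Y}, y.1 ∉ X → restrict h' σ y = restrict h' τ y := by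
    constructor
    · exact fun H => ⟨fun y hy => H y fun hx => hy (h hx), fun y hy => H ⟨y.1, h' y.2⟩ hy⟩
    · rintro ⟨H1, H2⟩ y hy
      by_cases hY : y.1 ∈ Y
      · exact H2 ⟨y.1, hY⟩ hy
      · exact H1 y hY
  simp only [this]
  by_cases h1 : ∀ y : {y // y ∈ V}, y.1 ∉ Y → σ y = τ y
  · by_cases h2 : ∀ y : {y // y ∈ Y}, y.1 ∉ X → restrict h' σ y = restrict h' τ y
    · rw [if_pos h1, if_pos h2, if_pos ⟨h1, h2⟩]; rfl
    · rw [if_pos h1, if_neg h2, if_neg fun h => h2 h.2]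
  · rw [if_neg h1, if_neg fun h => h1 h.1]

theorem embed_commute {X Y V : Finset S} (hX : X ⊆ V) (hY : Y ⊆ V) (hXY : Disjoint X Y)
    (A : LocalAlgebra n X) (B : LocalAlgebra n Y) : Commute (embed hX A) (embed hY B) := by
  have hYX : Y ⊆ V \ X := Finset.subset_sdiff.2 ⟨hY, hXY.symm⟩
  rw [← embed_embed hYX Finset.sdiff_subset, embed_sdiff_eq_submatrix hX, embed_eq_submatrix]
  unfold Commute SemiconjBy
  rw [submatrix_mul_equiv, submatrix_mul_equiv, ← mul_kronecker_mul, ← mul_kronecker_mul]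
  simp

variable [∀ x, NeZero (n x)]

theorem embed_injective {X V : Finset S} (h : X ⊆ V) :
    Function.Injective (embed h : LocalAlgebra n X → LocalAlgebra n V) := by
  intro A B hAB
  rw [embed_eq_submatrix, embed_eq_submatrix] at hAB
  obtain ⟨c⟩ : Nonempty (Config n (V \ X)) := ⟨fun _ => 0⟩
  ext a b
  have := congrFun (congrFun hAB ((splitConfig h).symm (a, c))) ((splitConfig h).symm (b, c))
  simpa using this

/-- An injective star homomorphism of C⋆-algebras is isometric; injectivity needs a configuration on
the complement, hence the nonvanishing local dimensions. -/
theorem norm_embed {X V : Finset S} (h : X ⊆ V) (A : LocalAlgebra n X) : ‖embed h A‖ = ‖A‖ :=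
  NonUnitalStarAlgHom.norm_map (embedHom h) (embed_injective h) A

theorem continuous_embed {X V : Finset S} (h : X ⊆ V) :
    Continuous (embed h : LocalAlgebra n X → LocalAlgebra n V) :=
  (AddMonoidHomClass.isometry_of_norm (embedHom h) (norm_embed h)).continuous

theorem embed_propagator {X V : Finset S} (h : X ⊆ V) (H : LocalAlgebra n X) (t : ℝ) :
    embed h (propagator H t) = propagator (embed h H) t := by
  let _ : NormedAlgebra ℚ (LocalAlgebra n X) := NormedAlgebra.restrictScalars ℚ ℂ _
  let _ : NormedAlgebra ℚ (LocalAlgebra n V) := NormedAlgebra.restrictScalars ℚ ℂ _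
  unfold propagator
  rw [← embedHom_apply, ← embedHom_apply, ← map_smul]
  exact NormedSpace.map_exp (embedHom h) (continuous_embed h) _

theorem embed_dyn {X V : Finset S} (h : X ⊆ V) (H B : LocalAlgebra n X) (t : ℝ) :
    embed h (dyn H t B) = dyn (embed h H) t (embed h B) := by
  unfold dyn
  rw [← embed_propagator, ← embed_propagator]
  simp only [← embedHom_apply, map_mul]

theorem norm_submatrix_equiv {α β : Type*} [Fintype α] [DecidableEq α] [Fintype β] [DecidableEq β]
    (e : α ≃ β) (T : Matrix β β ℂ) : ‖T.submatrix e e‖ = ‖T‖ := by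
  let f : Matrix β β ℂ →⋆ₐ[ℂ] Matrix α α ℂ :=
    { toFun := fun T => T.submatrix e e
      map_one' := by simp
      map_mul' := fun A B => (submatrix_mul_equiv A B e e e).symm
      map_zero' := by simp
      map_add' := fun A B => rfl
      commutes' := fun z => by
        rw [Algebra.algebraMap_eq_smul_one, Algebra.algebraMap_eq_smul_one, submatrix_smul]; simp
      map_star' := fun A => by simp [star_eq_conjTranspose] }
  refine NonUnitalStarAlgHom.norm_map f (fun A B hAB => ?_) T
  ext a b
  have : A (e (e.symm a)) (e (e.symm b)) = B (e (e.symm a)) (e (e.symm b)) :=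
    congrFun (congrFun hAB (e.symm a)) (e.symm b)
  simpa using this

/-- An observable almost commuting with everything outside of `X` is close to an observable
of `X`. -/
theorem exists_local_approximation {X Y V : Finset S} (hX : X ⊆ V) (hY : Y ⊆ V) (hXY : V \ X ⊆ Y)
    (T : LocalAlgebra n V) {δ : ℝ}
    (h : ∀ B : LocalAlgebra n Y, ‖B‖ ≤ 1 → ‖com T (embed hY B)‖ ≤ δ) :
    ∃ T' : LocalAlgebra n X, ‖T'‖ ≤ ‖T‖ ∧ ‖embed hX T' - T‖ ≤ δ := by
  let e := splitConfig (n := n) hX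
  let T₀ : Matrix (Config n X × Config n (V \ X)) (Config n X × Config n (V \ X)) ℂ :=
    T.submatrix e.symm e.symm
  have hT : T = T₀.submatrix e e := by simp [T₀]
  have hne : Nonempty (Config n (V \ X)) := ⟨fun _ => 0⟩
  -- The normalized partial trace is a contraction; this is what later yields norm at most 1 for the
  -- border observable.
  refine ⟨partialTrace T₀, ?_, ?_⟩
  · rw [← norm_embed hX, embed_eq_submatrix, norm_submatrix_equiv]
    exact (norm_partialTrace_kronecker_le T₀).trans_eq (norm_submatrix_equiv e.symm T)
  · have : embed hX (partialTrace T₀) - T = (partialTrace T₀ ⊗ₖ 1 - T₀).submatrix e e := by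
      rw [embed_eq_submatrix]; conv_lhs => rw [hT]
      rfl
    rw [this, norm_submatrix_equiv]
    refine norm_partialTrace_kronecker_sub_le T₀ fun U hU => ?_
    have h1 := h (embed hXY U) (by
      rw [norm_embed]
      exact (CStarRing.norm_of_mem_unitary hU).le)
    rw [embed_embed, embed_sdiff_eq_submatrix hX, hT] at h1
    simp only [com] at h1 ⊢
    rw [submatrix_mul_equiv, submatrix_mul_equiv] at h1
    have h2 := norm_submatrix_equiv e (T₀ * (1 ⊗ₖ U) - 1 ⊗ₖ U * T₀)
    rw [← h2]
    exact h1

end Embedding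

end SpinSystem

namespace SpinSystem

/-! ### Observables of a finite volume supported on a subset -/

section Local

variable {S : Type*} {n : S → ℕ}

/-- The observable `A` of `V` belongs to the subalgebra of observables of `X ⊆ V`. -/
def IsLocal {V : Finset S} (X : Finset S) (A : LocalAlgebra n V) : Prop :=
  ∃ (h : X ⊆ V) (B : LocalAlgebra n X), embed h B = A

variable {V X Y : Finset S}

theorem isLocal_embed (h : X ⊆ V) (B : LocalAlgebra n X) : IsLocal X (embed h B) := ⟨h, B, rfl⟩

variable {A B : LocalAlgebra n V}

theorem embed_self (A : LocalAlgebra n V) : embed subset_rfl A = A := by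
  ext σ τ
  have h : ∀ y : {y // y ∈ V}, y.1 ∉ V → σ y = τ y := fun y hy => (hy y.2).elim
  simp only [embed, Matrix.of_apply]
  rw [if_pos h]
  rfl

theorem isLocal_self (A : LocalAlgebra n V) : IsLocal V A := ⟨subset_rfl, A, embed_self A⟩

variable [DecidableEq S]

theorem IsLocal.mono (h : IsLocal X A) (hXY : X ⊆ Y) (hY : Y ⊆ V) : IsLocal Y A := by
  obtain ⟨_, B, rfl⟩ := h
  exact ⟨hY, embed hXY B, embed_embed _ _ _⟩

theorem IsLocal.add (hA : IsLocal X A) (hB : IsLocal X B) : IsLocal X (A + B) := by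
  obtain ⟨h, A, rfl⟩ := hA
  obtain ⟨_, B, rfl⟩ := hB
  exact ⟨h, A + B, map_add (embedHom h) A B⟩

theorem IsLocal.sub (hA : IsLocal X A) (hB : IsLocal X B) : IsLocal X (A - B) := by
  obtain ⟨h, A, rfl⟩ := hA
  obtain ⟨_, B, rfl⟩ := hB
  exact ⟨h, A - B, map_sub (embedHom h) A B⟩

theorem IsLocal.mul (hA : IsLocal X A) (hB : IsLocal X B) : IsLocal X (A * B) := by
  obtain ⟨h, A, rfl⟩ := hA
  obtain ⟨_, B, rfl⟩ := hB
  exact ⟨h, A * B, map_mul (embedHom h) A B⟩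

theorem IsLocal.com (hA : IsLocal X A) (hB : IsLocal X B) : IsLocal X (com A B) :=
  (hA.mul hB).sub (hB.mul hA)

theorem isLocal_zero (h : X ⊆ V) : IsLocal X (0 : LocalAlgebra n V) := ⟨h, 0, map_zero (embedHom h)⟩

theorem isLocal_sum (h : X ⊆ V) {κ : Type*} (s : Finset κ) (f : κ → LocalAlgebra n V)
    (hf : ∀ i ∈ s, IsLocal X (f i)) : IsLocal X (∑ i ∈ s, f i) :=
  Finset.sum_induction f (IsLocal X) (fun _ _ => IsLocal.add) (isLocal_zero h) hf

theorem IsLocal.commute (hA : IsLocal X A) (hB : IsLocal Y B) (hXY : Disjoint X Y) :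
    Commute A B := by
  obtain ⟨hX, A, rfl⟩ := hA
  obtain ⟨hY, B, rfl⟩ := hB
  exact embed_commute hX hY hXY A B

/-- `K` commutes with both `H` and `A`, so it drops out and the evolution takes place inside 𝓐_X. -/
theorem IsLocal.dyn [∀ x, NeZero (n x)] {H K : LocalAlgebra n V} (hH : IsLocal X H)
    (hK : IsLocal (V \ X) K) (hA : IsLocal X A) (t : ℝ) : IsLocal X (dyn (H + K) t A) := by
  rw [dyn_add_of_commute (hH.commute hK Finset.disjoint_sdiff)
    (hK.commute hA Finset.sdiff_disjoint)]
  obtain ⟨h, A, rfl⟩ := hA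
  obtain ⟨_, H, rfl⟩ := hH
  exact ⟨h, SpinSystem.dyn H t A, embed_dyn h H A t⟩

end Local

/-! ### Sums of interaction terms -/

section Terms

variable {S : Type*} {n : S → ℕ} [DecidableEq S] (Φ : Interaction n) (V : Finset S)

/-- The interaction term `Φ(Z)` as an observable of `V`. -/
def termIn (Z : Finset S) : LocalAlgebra n V :=
  if h : Z ⊆ V then embed h (Φ.term Z) else 0

open Classical in
/-- The nonempty subsets of `V` on which the interaction does not vanish. -/
def activeSets : Finset (Finset S) :=
  V.powerset.filter fun Z => Z.Nonempty ∧ Φ.term Z ≠ 0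

/-- The active sets contained in `W`. -/
def activeIn (W : Finset S) : Finset (Finset S) := (activeSets Φ V).filter fun Z => Z ⊆ W

/-- The active sets which meet both `W` and its complement. -/
def crossing (W : Finset S) : Finset (Finset S) :=
  (activeSets Φ V).filter fun Z => ¬ Z ⊆ W ∧ ¬ Disjoint Z W

/-- The Hamiltonian of `W` as an observable of `V`, without the constant term `Φ(∅)`. -/
def subHam (W : Finset S) : LocalAlgebra n V := ∑ Z ∈ activeIn Φ V W, termIn Φ V Z

/-- The Hamiltonian of `V` with all interactions between `X` and its complement removed. -/
def decoupledHam (X : Finset S) : LocalAlgebra n V := subHam Φ V X + subHam Φ V (V \ X)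

variable {Φ V} {Z W X : Finset S}

theorem mem_activeSets : Z ∈ activeSets Φ V ↔ Z ⊆ V ∧ Z.Nonempty ∧ Φ.term Z ≠ 0 := by
  simp [activeSets]

theorem mem_activeIn : Z ∈ activeIn Φ V W ↔ Z ∈ activeSets Φ V ∧ Z ⊆ W := by
  simp [activeIn]

theorem mem_crossing :
    Z ∈ crossing Φ V W ↔ Z ∈ activeSets Φ V ∧ ¬ Z ⊆ W ∧ ¬ Disjoint Z W := by
  simp [crossing]

theorem isSelfAdjoint_termIn : IsSelfAdjoint (termIn Φ V Z) := by
  unfold termIn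
  split_ifs with h
  · exact (Φ.isSelfAdjoint Z).map (embedHom h)
  · exact IsSelfAdjoint.zero _

theorem isLocal_termIn (h : Z ⊆ V) : IsLocal Z (termIn Φ V Z) := by
  rw [termIn, dif_pos h]
  exact isLocal_embed h _

theorem isSelfAdjoint_subHam : IsSelfAdjoint (subHam Φ V W) :=
  isSelfAdjoint_sum _ fun _ _ => isSelfAdjoint_termIn

theorem isSelfAdjoint_decoupledHam : IsSelfAdjoint (decoupledHam Φ V X) :=
  isSelfAdjoint_subHam.add isSelfAdjoint_subHam

theorem isLocal_subHam (h : W ⊆ V) : IsLocal W (subHam Φ V W) :=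
  isLocal_sum h _ _ fun Z hZ => by
    obtain ⟨hZ, hZW⟩ := mem_activeIn.1 hZ
    exact (isLocal_termIn (mem_activeSets.1 hZ).1).mono hZW h

theorem subHam_empty : subHam Φ V ∅ = 0 := by
  refine Finset.sum_eq_zero fun Z hZ => ?_
  obtain ⟨hZ, hZ0⟩ := mem_activeIn.1 hZ
  rw [Finset.subset_empty.1 hZ0] at hZ
  exact absurd (mem_activeSets.1 hZ).2.1 (by simp)

theorem decoupledHam_self : decoupledHam Φ V V = subHam Φ V V := by
  rw [decoupledHam, Finset.sdiff_self, subHam_empty, add_zero]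

theorem subHam_eq_sum : subHam Φ V V = ∑ Z ∈ activeSets Φ V, termIn Φ V Z := by
  refine Finset.sum_congr (Finset.ext fun Z => ?_) fun _ _ => rfl
  rw [mem_activeIn, and_iff_left_of_imp]
  exact fun h => (mem_activeSets.1 h).1

theorem disjoint_sdiff_iff_subset (h : Z ⊆ V) : Disjoint Z (V \ X) ↔ Z ⊆ X := by
  rw [Finset.disjoint_left]
  refine forall_congr' fun x => forall_congr' fun hx => ?_
  simp [h hx]

/-- This symmetry lets the one-sided estimates be applied to `V \ X` as well as to `X`. -/
theorem crossing_sdiff : crossing Φ V (V \ X) = crossing Φ V X := by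
  ext Z
  rw [mem_crossing, mem_crossing]
  refine and_congr_right fun hZ => ?_
  have hZV := (mem_activeSets.1 hZ).1
  rw [disjoint_sdiff_iff_subset hZV, Finset.subset_sdiff, and_iff_right hZV, and_comm]

/-- An active set lies in `X`, or in `V \ X`, or crosses; nonemptiness makes the alternatives
exclusive. -/
theorem subHam_sub_decoupledHam :
    subHam Φ V V - decoupledHam Φ V X = ∑ Z ∈ crossing Φ V X, termIn Φ V Z := by
  rw [subHam_eq_sum, decoupledHam, subHam, subHam, activeIn, activeIn, crossing, sub_eq_iff_eq_add,
    Finset.sum_filter, Finset.sum_filter, Finset.sum_filter, ← Finset.sum_add_distrib,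
    ← Finset.sum_add_distrib]
  refine Finset.sum_congr rfl fun Z hZ => ?_
  obtain ⟨hZV, ⟨z, hz⟩, -⟩ := mem_activeSets.1 hZ
  by_cases h1 : Z ⊆ X
  · have h2 : ¬ Z ⊆ V \ X := fun h => (Finset.mem_sdiff.1 (h hz)).2 (h1 hz)
    simp [h1, h2]
  · by_cases h2 : Disjoint Z X
    · simp [h1, h2, Finset.subset_sdiff, hZV]
    · simp [h1, h2, Finset.subset_sdiff]

theorem com_termIn_eq_zero {Z' : Finset S} (hZ : Z ⊆ V) (hZ' : Z' ⊆ V) (h : Disjoint Z Z') :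
    com (termIn Φ V Z) (termIn Φ V Z') = 0 :=
  com_eq_zero ((isLocal_termIn hZ).commute (isLocal_termIn hZ') h)

/-- The constant `Φ(∅)`. -/
def emptyTerm (Φ : Interaction n) : ℝ :=
  (Φ.term ∅ (fun x => absurd x.2 (Finset.notMem_empty _))
    (fun x => absurd x.2 (Finset.notMem_empty _))).re

/-- There is a single configuration on the empty set, so Φ(∅) is a self-adjoint 1×1 matrix, that is,
a real scalar. It does not affect the dynamics. -/
theorem termIn_empty : termIn Φ V ∅ = ((emptyTerm Φ : ℝ) : ℂ) • 1 := by
  have huniq : ∀ σ τ : Config n (∅ : Finset S), σ = τ := fun σ τ =>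
    funext fun x => absurd x.2 (Finset.notMem_empty _)
  set c : Config n (∅ : Finset S) := fun x => absurd x.2 (Finset.notMem_empty _) with hc
  have hreal : ((emptyTerm Φ : ℝ) : ℂ) = Φ.term ∅ c c := by
    have h := congrFun (congrFun (Φ.isSelfAdjoint ∅) c) c
    exact Complex.conj_eq_iff_re.1 h
  rw [termIn, dif_pos (Finset.empty_subset V)]
  ext σ τ
  rw [Matrix.smul_apply, Matrix.one_apply, hreal]
  simp only [embed, Matrix.of_apply, Finset.notMem_empty, not_false_eq_true, true_implies]
  by_cases h : σ = τ
  · subst h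
    rw [huniq (restrict (Finset.empty_subset V) σ) c]
    simp
  · rw [if_neg fun h' => h (funext h'), if_neg h, smul_zero]

theorem embed_hamiltonian (h : X ⊆ V) :
    embed h (hamiltonian Φ X) = subHam Φ V X + ((emptyTerm Φ : ℝ) : ℂ) • 1 := by
  have h1 : embed h (hamiltonian Φ X) = ∑ Z ∈ X.powerset, termIn Φ V Z := by
    rw [hamiltonian, ← embedHom_apply, map_sum, ← Finset.sum_attach X.powerset]
    refine Finset.sum_congr rfl fun Z _ => ?_
    have hZ := Finset.mem_powerset.1 Z.2
    rw [termIn, dif_pos (hZ.trans h), embedHom_apply, embed_embed]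
  rw [h1, ← Finset.add_sum_erase _ _ (Finset.empty_mem_powerset X), termIn_empty, add_comm, subHam]
  congr 1
  symm
  refine Finset.sum_subset (fun Z hZ => ?_) fun Z hZ hZ' => ?_
  · obtain ⟨hZ, hZX⟩ := mem_activeIn.1 hZ
    exact Finset.mem_erase.2 ⟨(mem_activeSets.1 hZ).2.1.ne_empty, Finset.mem_powerset.2 hZX⟩
  · obtain ⟨hne, hZX⟩ := Finset.mem_erase.1 hZ
    rw [Finset.mem_powerset] at hZX
    have h0 : Φ.term Z = 0 := by
      by_contra h0
      exact hZ' (mem_activeIn.2 ⟨mem_activeSets.2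
        ⟨hZX.trans h, Finset.nonempty_iff_ne_empty.2 hne, h0⟩, hZX⟩)
    rw [termIn, dif_pos (hZX.trans h), h0]
    exact map_zero (embedHom _)

theorem hamiltonian_eq : hamiltonian Φ V = subHam Φ V V + ((emptyTerm Φ : ℝ) : ℂ) • 1 := by
  rw [← embed_hamiltonian subset_rfl, embed_self]

theorem evolve_eq_dyn (t : ℝ) (A : LocalAlgebra n V) :
    evolve Φ V t A = dyn (hamiltonian Φ V) t A := by
  simp [evolve, dyn, propagator]

/-- This identity turns Lieb-Robinson bounds in the volume `X` into bounds for the decoupled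
dynamics in `V`. -/
theorem embed_evolve [∀ x, NeZero (n x)] (h : X ⊆ V) (t : ℝ) (A : LocalAlgebra n X) :
    embed h (evolve Φ X t A) = dyn (decoupledHam Φ V X) t (embed h A) := by
  have h1 := isLocal_subHam (Φ := Φ) h
  have h2 := isLocal_subHam (Φ := Φ) (W := V \ X) (V := V) Finset.sdiff_subset
  rw [evolve_eq_dyn, embed_dyn, embed_hamiltonian, dyn_add_smul_one, decoupledHam,
    dyn_add_of_commute (h1.commute h2 Finset.disjoint_sdiff)
      (h2.commute (isLocal_embed h A) Finset.sdiff_disjoint)]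

end Terms

end SpinSystem

namespace SpinSystem

/-! ### Interactions of finite range -/

/-- Quantitative bounds on an interaction: range `R`, strength `J`, at most `c` terms
containing any given site, and at most `N` sites in every term. -/
structure FiniteRange {S : Type*} [MetricSpace S] [DecidableEq S] {n : S → ℕ} (Φ : Interaction n)
    (R J c N : ℝ) : Prop where
  dist_le : ∀ {Z : Finset S}, Φ.term Z ≠ 0 → ∀ x ∈ Z, ∀ y ∈ Z, dist x y ≤ R
  norm_le : ∀ Z, ‖Φ.term Z‖ ≤ J
  count_le : ∀ (x : S) (F : Finset (Finset S)), (∀ Z ∈ F, x ∈ Z ∧ Φ.term Z ≠ 0) → (F.card : ℝ) ≤ c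
  card_le : ∀ {Z : Finset S}, Φ.term Z ≠ 0 → (Z.card : ℝ) ≤ N
  range_pos : 0 < R
  strength_pos : 0 < J
  count_nonneg : 0 ≤ c
  size_nonneg : 0 ≤ N

/-! ### Distances between finite sets -/

section SetDist

variable {S : Type*} [MetricSpace S] {X Y Z : Finset S}

theorem setDist_le_dist {x y : S} (hx : x ∈ X) (hy : y ∈ Y) : setDist X Y ≤ dist x y :=
  csInf_le ⟨0, by rintro r ⟨x, -, y, -, rfl⟩; exact dist_nonneg⟩ ⟨x, hx, y, hy, rfl⟩

theorem setDist_nonneg : 0 ≤ setDist X Y :=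
  Real.sInf_nonneg (by rintro r ⟨x, -, y, -, rfl⟩; exact dist_nonneg)

theorem le_setDist (hX : X.Nonempty) (hY : Y.Nonempty) {r : ℝ}
    (h : ∀ x ∈ X, ∀ y ∈ Y, r ≤ dist x y) : r ≤ setDist X Y := by
  obtain ⟨x, hx⟩ := hX
  obtain ⟨y, hy⟩ := hY
  exact le_csInf ⟨_, x, hx, y, hy, rfl⟩ (by rintro r ⟨x, hx, y, hy, rfl⟩; exact h x hx y hy)

theorem setDist_eq_zero (h : ¬ Disjoint X Y) : setDist X Y = 0 := by
  obtain ⟨x, hx, hy⟩ := Finset.not_disjoint_iff.1 h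
  exact le_antisymm ((setDist_le_dist hx hy).trans_eq (dist_self x)) setDist_nonneg

theorem setDist_comm : setDist X Y = setDist Y X := by
  unfold setDist
  congr 1
  ext r
  constructor
  · rintro ⟨x, hx, y, hy, rfl⟩; exact ⟨y, hy, x, hx, dist_comm _ _⟩
  · rintro ⟨x, hx, y, hy, rfl⟩; exact ⟨y, hy, x, hx, dist_comm _ _⟩

theorem setDist_le_add (hY : Y.Nonempty) {R : ℝ} {x : S} (hx : x ∈ X) (hxZ : x ∈ Z)
    (hZ : ∀ z ∈ Z, dist x z ≤ R) : setDist X Y ≤ setDist Z Y + R := by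
  rw [← sub_le_iff_le_add]
  refine le_setDist ⟨x, hxZ⟩ hY fun z hz y hy => ?_
  have h1 := setDist_le_dist hx hy
  have h2 := dist_triangle x z y
  linarith [hZ z hz]

end SetDist

/-! ### Counting the interaction terms near a set -/

section Bounds

theorem card_phiBoundary_le {S : Type*} {n : S → ℕ} {Φ : Interaction n} (X : Finset S) :
    (phiBoundary Φ X).card ≤ X.card := by
  refine Finset.card_le_card fun x hx => ?_
  simp only [phiBoundary, Finset.mem_filter] at hx
  exact hx.1

/-- A crossing set contains a site inside and a site outside. -/
theorem exists_of_mem_crossing {S : Type*} [DecidableEq S] {n : S → ℕ} {Φ : Interaction n}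
    {V X Z : Finset S} (h : Z ∈ crossing Φ V X) :
    Z ⊆ V ∧ Φ.term Z ≠ 0 ∧ (∃ x ∈ Z, x ∈ X) ∧ ∃ y ∈ Z, y ∉ X := by
  obtain ⟨hZ, h1, h2⟩ := mem_crossing.1 h
  obtain ⟨hZV, -, h0⟩ := mem_activeSets.1 hZ
  obtain ⟨x, hx, hxX⟩ := Finset.not_disjoint_iff.1 h2
  exact ⟨hZV, h0, ⟨x, hx, hxX⟩, Finset.not_subset.1 h1⟩

variable {S : Type*} [MetricSpace S] [DecidableEq S] {n : S → ℕ} {Φ : Interaction n}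
  {R J c N : ℝ} {V X Z : Finset S}

/-- Union bound over the sites of `B`; all later counts of terms come from it. -/
theorem FiniteRange.card_le_mul (hΦ : FiniteRange Φ R J c N) (F : Finset (Finset S)) (B : Finset S)
    (h : ∀ Z ∈ F, Φ.term Z ≠ 0 ∧ ∃ x ∈ B, x ∈ Z) : (F.card : ℝ) ≤ c * B.card := by
  have hsub : F ⊆ B.biUnion fun x => F.filter fun Z => x ∈ Z := by
    intro Z hZ
    obtain ⟨-, x, hx, hxZ⟩ := h Z hZ
    exact Finset.mem_biUnion.2 ⟨x, hx, Finset.mem_filter.2 ⟨hZ, hxZ⟩⟩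
  calc (F.card : ℝ) ≤ ((∑ x ∈ B, (F.filter fun Z => x ∈ Z).card : ℕ) : ℝ) :=
        Nat.cast_le.2 ((Finset.card_le_card hsub).trans Finset.card_biUnion_le)
    _ = ∑ x ∈ B, ((F.filter fun Z => x ∈ Z).card : ℝ) := by push_cast; rfl
    _ ≤ ∑ _x ∈ B, c := Finset.sum_le_sum fun x _ => hΦ.count_le x _ fun Z hZ =>
        ⟨(Finset.mem_filter.1 hZ).2, (h Z (Finset.mem_filter.1 hZ).1).1⟩
    _ = c * B.card := by rw [Finset.sum_const, nsmul_eq_mul, mul_comm]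

theorem FiniteRange.norm_termIn_le [∀ x, NeZero (n x)] (hΦ : FiniteRange Φ R J c N) :
    ‖termIn Φ V Z‖ ≤ J := by
  unfold termIn
  split_ifs with h
  · rw [norm_embed]; exact hΦ.norm_le Z
  · rw [norm_zero]; exact hΦ.strength_pos.le

theorem FiniteRange.card_crossing_le_phiBoundary (hΦ : FiniteRange Φ R J c N) :
    ((crossing Φ V X).card : ℝ) ≤ c * (phiBoundary Φ X).card := by
  refine hΦ.card_le_mul _ _ fun Z hZ => ?_
  obtain ⟨-, h0, ⟨x, hx, hxX⟩, y, hy, hyX⟩ := exists_of_mem_crossing hZ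
  refine ⟨h0, x, ?_, hx⟩
  simp only [phiBoundary, Finset.mem_filter]
  exact ⟨hxX, Z, hx, ⟨y, hy, hyX⟩, h0⟩

theorem FiniteRange.mem_boundary (hΦ : FiniteRange Φ R J c N) (hZ : Z ∈ crossing Φ V X) {x : S}
    (hx : x ∈ Z) (hxX : x ∈ X) : x ∈ boundary R V X := by
  obtain ⟨hZV, h0, -, y, hy, hyX⟩ := exists_of_mem_crossing hZ
  simp only [boundary, Finset.mem_filter]
  exact ⟨hxX, y, hZV hy, hyX, hΦ.dist_le h0 x hx y hy⟩

theorem FiniteRange.card_crossing_le_boundary (hΦ : FiniteRange Φ R J c N) :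
    ((crossing Φ V X).card : ℝ) ≤ c * (boundary R V X).card := by
  refine hΦ.card_le_mul _ _ fun Z hZ => ?_
  obtain ⟨-, h0, ⟨x, hx, hxX⟩, -⟩ := exists_of_mem_crossing hZ
  exact ⟨h0, x, hΦ.mem_boundary hZ hx hxX, hx⟩

end Bounds

/-! ### Existence of Lieb-Robinson constants -/

section Switch

variable {S : Type*} [DecidableEq S] {n : S → ℕ} {Φ : Interaction n} {V X : Finset S}

/-- Switching off the interactions across the boundary of `X`. -/
theorem norm_com_dyn_le_of_crossing {A B : LocalAlgebra n V} {ρ lam : ℝ} (hlam : 0 < lam)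
    (h : ∀ s, ∑ Z ∈ crossing Φ V X, ‖com (dyn (subHam Φ V V) s (termIn Φ V Z)) B‖ ≤
      ρ * Real.exp (lam * |s|)) (t : ℝ) :
    ‖com (dyn (subHam Φ V V) t A) B‖ ≤ ‖com (dyn (decoupledHam Φ V X) t A) B‖ +
      2 * ‖A‖ * (ρ / lam * Real.exp (lam * |t|)) := by
  set H := subHam Φ V V
  set H' := decoupledHam Φ V X
  have hH : IsSelfAdjoint H := isSelfAdjoint_subHam
  have hH' : IsSelfAdjoint H' := isSelfAdjoint_decoupledHam
  have hρ : 0 ≤ ρ := by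
    have := (Finset.sum_nonneg fun _ _ => norm_nonneg _).trans (h 0)
    simpa using this
  have hG : ∀ s : ℝ, HasDerivAt (fun s => ρ / lam * Real.exp (lam * s))
      (ρ * Real.exp (lam * s)) s := by
    intro s
    have h1 : HasDerivAt (fun s => Real.exp (lam * s)) (Real.exp (lam * s) * lam) s := by
      simpa using ((hasDerivAt_id s).const_mul lam).exp
    refine (h1.const_mul (ρ / lam)).congr_deriv ?_
    field_simp
  -- The dynamics is moved onto `B`: Duhamel then produces commutators of the crossing terms with
  -- the evolved `B`, which are the quantities bounded by `h`.
  have hD := norm_dyn_sub_dyn_le (H := H') (H' := H) hH' B hG (-t) (fun s _ => by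
    rw [← neg_sub, com_neg_left, norm_neg, subHam_sub_decoupledHam, com_sum_left]
    refine (norm_sum_le _ _).trans ?_
    have := h (-s)
    rw [abs_neg] at this
    refine le_trans (Finset.sum_le_sum fun Z _ => ?_) this
    rw [norm_com_dyn hH, neg_neg])
  rw [abs_neg] at hD
  have h1 : com A (dyn H (-t) B) = com A (dyn H' (-t) B) - com A (dyn H' (-t) B - dyn H (-t) B) := by
    rw [com_sub_right]; abel
  rw [norm_com_dyn hH, h1, norm_com_dyn hH']
  refine (norm_sub_le _ _).trans (add_le_add le_rfl ((norm_com_le _ _).trans ?_))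
  refine mul_le_mul_of_nonneg_left (hD.trans ?_) (by positivity)
  have : 0 ≤ ρ / lam * Real.exp (lam * 0) := by positivity
  linarith

end Switch

/-- The exponential growth rate in the Lieb-Robinson bound. -/
def growthRate (R J c N μ : ℝ) : ℝ := 4 * (c * N) * J * Real.exp (μ * R) + 1

theorem FiniteRange.growthRate_pos {S : Type*} [MetricSpace S] [DecidableEq S] {n : S → ℕ}
    {Φ : Interaction n} {R J c N : ℝ} (hΦ : FiniteRange Φ R J c N) (μ : ℝ) :
    0 < growthRate R J c N μ := by
  have h1 := hΦ.strength_pos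
  have h2 := hΦ.count_nonneg
  have h3 := hΦ.size_nonneg
  unfold growthRate
  positivity

/-! ### The Lieb-Robinson bound by iteration over interaction terms -/

section Existence

variable {S : Type*} [MetricSpace S] [DecidableEq S] {n : S → ℕ} [∀ x, NeZero (n x)]
  {Φ : Interaction n} {R J c N : ℝ} {V X Y : Finset S}

theorem norm_com_dyn_decoupled_le {A B : LocalAlgebra n V} (hX : X ⊆ V) (hA : IsLocal X A)
    (hB : IsLocal Y B) (μ t : ℝ) :
    ‖com (dyn (decoupledHam Φ V X) t A) B‖ ≤ 2 * ‖A‖ * ‖B‖ * Real.exp (-μ * setDist X Y) := by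
  by_cases h : Disjoint X Y
  · have hl : IsLocal X (dyn (decoupledHam Φ V X) t A) :=
      (isLocal_subHam hX).dyn (isLocal_subHam Finset.sdiff_subset) hA t
    rw [com_eq_zero (hl.commute hB h), norm_zero]
    positivity
  · rw [setDist_eq_zero h, mul_zero, Real.exp_zero, mul_one, ← norm_dyn
      (isSelfAdjoint_decoupledHam (Φ := Φ) (V := V) (X := X)) t A]
    exact norm_com_le _ _

/-- A crossing term touches `X` and has diameter at most `R`, so passing from its distance to `Y` to
that of `X` costs a factor e^{μR}. -/
theorem sum_crossing_le (hΦ : FiniteRange Φ R J c N) (hY : Y.Nonempty) {B : LocalAlgebra n V}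
    {μ lam σ : ℝ} (hμ : 0 < μ) (hσ : 0 ≤ σ)
    (h : ∀ Z ∈ activeSets Φ V, ∀ A : LocalAlgebra n V, IsLocal Z A → ∀ t,
      ‖com (dyn (subHam Φ V V) t A) B‖ ≤
        σ * ‖A‖ * Real.exp (-μ * setDist Z Y) * Real.exp (lam * |t|)) (s : ℝ) :
    ∑ Z ∈ crossing Φ V X, ‖com (dyn (subHam Φ V V) s (termIn Φ V Z)) B‖ ≤
      (crossing Φ V X).card * (σ * J * Real.exp (μ * R) * Real.exp (-μ * setDist X Y)) *
        Real.exp (lam * |s|) := by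
  rw [mul_assoc, ← nsmul_eq_mul]
  refine Finset.sum_le_card_nsmul _ _ _ fun Z hZ => ?_
  obtain ⟨hZV, h0, ⟨x, hx, hxX⟩, -⟩ := exists_of_mem_crossing hZ
  refine (h Z (mem_crossing.1 hZ).1 _ (isLocal_termIn hZV) s).trans ?_
  have hd : setDist X Y ≤ setDist Z Y + R :=
    setDist_le_add hY hxX hx fun z hz => hΦ.dist_le h0 x hx z hz
  have he : Real.exp (-μ * setDist Z Y) ≤ Real.exp (μ * R) * Real.exp (-μ * setDist X Y) := by
    rw [← Real.exp_add]
    refine Real.exp_le_exp.2 ?_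
    nlinarith
  have hJ := hΦ.strength_pos
  refine mul_le_mul_of_nonneg_right ?_ (Real.exp_pos _).le
  rw [mul_assoc (σ * J)]
  exact mul_le_mul (mul_le_mul_of_nonneg_left hΦ.norm_termIn_le hσ) he (Real.exp_pos _).le
    (by positivity)

/-- Switching off the crossing terms of `Z` leaves the decoupled contribution 2‖B‖ plus a time
integral of the old bound. The integral gains 1/λ, and λ exceeds 4cNJe^{μR}, so the old constant
returns with the factor 1/2. -/
theorem improve_active_bound (hΦ : FiniteRange Φ R J c N) (hY : Y.Nonempty) {B : LocalAlgebra n V}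
    (hB : IsLocal Y B) {μ σ : ℝ} (hμ : 0 < μ) (hσ : 0 ≤ σ)
    (h : ∀ Z ∈ activeSets Φ V, ∀ A : LocalAlgebra n V, IsLocal Z A → ∀ t,
      ‖com (dyn (subHam Φ V V) t A) B‖ ≤
        σ * ‖A‖ * Real.exp (-μ * setDist Z Y) * Real.exp (growthRate R J c N μ * |t|))
    {Z : Finset S} (hZ : Z ∈ activeSets Φ V) {A : LocalAlgebra n V} (hA : IsLocal Z A) (t : ℝ) :
    ‖com (dyn (subHam Φ V V) t A) B‖ ≤ (2 * ‖B‖ + σ / 2) * ‖A‖ *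
      Real.exp (-μ * setDist Z Y) * Real.exp (growthRate R J c N μ * |t|) := by
  set lam := growthRate R J c N μ with hlam
  have hl : 0 < lam := hΦ.growthRate_pos μ
  obtain ⟨hZV, -, hZ0⟩ := mem_activeSets.1 hZ
  have hJ := hΦ.strength_pos
  have hc := hΦ.count_nonneg
  have hN := hΦ.size_nonneg
  refine (norm_com_dyn_le_of_crossing (X := Z) hl (sum_crossing_le hΦ hY hμ hσ h) t).trans ?_
  have h1 := norm_com_dyn_decoupled_le (Φ := Φ) hZV hA hB μ t
  set E := Real.exp (-μ * setDist Z Y)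
  set F := Real.exp (lam * |t|) with hF
  have hE : 0 < E := Real.exp_pos _
  have hF1 : 1 ≤ F := Real.one_le_exp (by positivity)
  have hcard : ((crossing Φ V Z).card : ℝ) ≤ c * N :=
    hΦ.card_crossing_le_phiBoundary.trans (mul_le_mul_of_nonneg_left
      ((Nat.cast_le.2 (card_phiBoundary_le Z)).trans (hΦ.card_le hZ0)) hc)
  have h2 : (crossing Φ V Z).card * (σ * J * Real.exp (μ * R) * E) / lam ≤ σ / 4 * E := by
    rw [div_le_iff₀ hl]
    calc (crossing Φ V Z).card * (σ * J * Real.exp (μ * R) * E)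
        ≤ (c * N) * (σ * J * Real.exp (μ * R) * E) :=
          mul_le_mul_of_nonneg_right hcard (by positivity)
      _ = σ / 4 * E * (4 * (c * N) * J * Real.exp (μ * R)) := by ring
      _ ≤ σ / 4 * E * lam := mul_le_mul_of_nonneg_left (by rw [hlam, growthRate]; linarith)
          (by positivity)
  calc _ ≤ 2 * ‖A‖ * ‖B‖ * E + 2 * ‖A‖ * (σ / 4 * E * F) := by gcongr
    _ ≤ 2 * ‖A‖ * ‖B‖ * E * F + 2 * ‖A‖ * (σ / 4 * E * F) :=
        add_le_add (le_mul_of_one_le_right (by positivity) hF1) le_rfl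
    _ = _ := by ring

/-- 4‖B‖ is the fixed point of σ ↦ 2‖B‖ + σ/2. Iterating from any finite starting constant converges
to it, which removes the dependence on the volume. -/
theorem active_bound (hΦ : FiniteRange Φ R J c N) (hY : Y.Nonempty) {B : LocalAlgebra n V}
    (hB : IsLocal Y B) {μ : ℝ} (hμ : 0 < μ) :
    ∀ Z ∈ activeSets Φ V, ∀ A : LocalAlgebra n V, IsLocal Z A → ∀ t,
      ‖com (dyn (subHam Φ V V) t A) B‖ ≤ 4 * ‖B‖ * ‖A‖ *
        Real.exp (-μ * setDist Z Y) * Real.exp (growthRate R J c N μ * |t|) := by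
  set lam := growthRate R J c N μ with hlam
  have hl : 0 < lam := hΦ.growthRate_pos μ
  -- A crude bound on all distances to `Y`: it makes the trivial commutator estimate an admissible
  -- starting point.
  set D : ℝ := ∑ Z ∈ activeSets Φ V, setDist Z Y
  set r : ℝ := 2 * ‖B‖ * Real.exp (μ * D) with hr
  have hk : ∀ k : ℕ, ∀ Z ∈ activeSets Φ V, ∀ A : LocalAlgebra n V, IsLocal Z A → ∀ t,
      ‖com (dyn (subHam Φ V V) t A) B‖ ≤ (4 * ‖B‖ + r * (1 / 2) ^ k) * ‖A‖ *
        Real.exp (-μ * setDist Z Y) * Real.exp (lam * |t|) := by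
    intro k
    induction k with
    | zero =>
      intro Z hZ A _ t
      have hD : setDist Z Y ≤ D :=
        Finset.single_le_sum (f := fun Z => setDist Z Y) (fun _ _ => setDist_nonneg) hZ
      have h1 : 1 ≤ Real.exp (μ * D) * Real.exp (-μ * setDist Z Y) := by
        rw [← Real.exp_add]
        exact Real.one_le_exp (by nlinarith)
      have h2 : 1 ≤ Real.exp (lam * |t|) := Real.one_le_exp (by positivity)
      calc ‖com (dyn (subHam Φ V V) t A) B‖ ≤ 2 * ‖A‖ * ‖B‖ := by
            rw [← norm_dyn (isSelfAdjoint_subHam (Φ := Φ) (V := V) (W := V)) t A]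
            exact norm_com_le _ _
        _ ≤ 2 * ‖A‖ * ‖B‖ * (Real.exp (μ * D) * Real.exp (-μ * setDist Z Y)) :=
            le_mul_of_one_le_right (by positivity) h1
        _ = r * ‖A‖ * Real.exp (-μ * setDist Z Y) := by rw [hr]; ring
        _ ≤ (4 * ‖B‖ + r * (1 / 2) ^ 0) * ‖A‖ * Real.exp (-μ * setDist Z Y) := by
            rw [pow_zero, mul_one]
            gcongr
            linarith [norm_nonneg B]
        _ ≤ _ := le_mul_of_one_le_right (by positivity) h2
    | succ k ih =>
      intro Z hZ A hA t
      refine (improve_active_bound hΦ hY hB hμ (by positivity) ih hZ hA t).trans_eq ?_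
      ring
  intro Z hZ A hA t
  have hlim : Filter.Tendsto (fun k : ℕ => (4 * ‖B‖ + r * (1 / 2) ^ k) * ‖A‖ *
        Real.exp (-μ * setDist Z Y) * Real.exp (lam * |t|)) Filter.atTop
      (nhds ((4 * ‖B‖ + r * 0) * ‖A‖ *
        Real.exp (-μ * setDist Z Y) * Real.exp (lam * |t|))) :=
    (((((tendsto_pow_atTop_nhds_zero_of_lt_one (by norm_num) (by norm_num)).const_mul r).const_add
      _).mul_const _).mul_const _).mul_const _
  have := ge_of_tendsto' hlim fun k => hk k Z hZ A hA t
  simpa using this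

/-- One more switching, now for an arbitrary `X`: disjointness kills the decoupled term, and the
number of crossing terms contributes the factor |∂_Φ X|. -/
theorem norm_com_dyn_le_phiBoundary (hΦ : FiniteRange Φ R J c N) {μ : ℝ} (hμ : 0 < μ) (hX : X ⊆ V)
    (hXY : Disjoint X Y) {A B : LocalAlgebra n V} (hA : IsLocal X A) (hB : IsLocal Y B) (t : ℝ) :
    ‖com (dyn (subHam Φ V V) t A) B‖ ≤
      (8 * c * J * Real.exp (μ * R) / growthRate R J c N μ) * ‖A‖ * ‖B‖ * (phiBoundary Φ X).card *
        Real.exp (-μ * (setDist X Y - growthRate R J c N μ / μ * |t|)) := by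
  set lam := growthRate R J c N μ with hlam
  have hl : 0 < lam := hΦ.growthRate_pos μ
  have hJ := hΦ.strength_pos
  have hc := hΦ.count_nonneg
  rcases Y.eq_empty_or_nonempty with rfl | hY
  · rw [com_eq_zero ((isLocal_self _).commute hB (Finset.disjoint_empty_right _)), norm_zero]
    positivity
  have hl' : IsLocal X (dyn (decoupledHam Φ V X) t A) :=
    (isLocal_subHam hX).dyn (isLocal_subHam Finset.sdiff_subset) hA t
  have h := norm_com_dyn_le_of_crossing (X := X) (A := A) hl (sum_crossing_le (X := X) hΦ hY hμ
    (by positivity) (active_bound hΦ hY hB hμ)) t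
  rw [com_eq_zero (hl'.commute hB hXY), norm_zero, zero_add] at h
  have he : Real.exp (-μ * (setDist X Y - lam / μ * |t|)) =
      Real.exp (-μ * setDist X Y) * Real.exp (lam * |t|) := by
    rw [← Real.exp_add]; congr 1; field_simp; ring
  rw [he]
  refine h.trans ?_
  set E := Real.exp (-μ * setDist X Y)
  calc _ ≤ 2 * ‖A‖ * ((c * (phiBoundary Φ X).card) * (4 * ‖B‖ * J * Real.exp (μ * R) * E) / lam *
        Real.exp (lam * |t|)) := by
        gcongr
        exact hΦ.card_crossing_le_phiBoundary
    _ = _ := by ring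

theorem FiniteRange.exists_liebRobinson (hΦ : FiniteRange Φ R J c N) {μ : ℝ} (hμ : 0 < μ) :
    ∃ k v : ℝ, 0 < k ∧ 0 < v ∧ LiebRobinson Φ μ k v := by
  set lam := growthRate R J c N μ with hlam
  have hl : 0 < lam := hΦ.growthRate_pos μ
  have hJ := hΦ.strength_pos
  have hc := hΦ.count_nonneg
  -- The added 1 keeps the prefactor positive when `c = 0`.
  refine ⟨8 * c * J * Real.exp (μ * R) / lam + 1, lam / μ, by positivity, by positivity, ?_⟩
  intro V X Y hX hY hXY A B t
  rw [evolve_eq_dyn, hamiltonian_eq, dyn_add_smul_one]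
  have hA := isLocal_embed hX A
  have hB := isLocal_embed hY B
  have h1 := norm_com_dyn_le_phiBoundary hΦ hμ hX hXY hA hB t
  -- Exchanging the roles of the observables and reversing time gives the bound with |∂_Φ Y|, hence
  -- the minimum.
  have h2 := norm_com_dyn_le_phiBoundary hΦ hμ hY hXY.symm hB hA (-t)
  rw [norm_com_dyn isSelfAdjoint_subHam, neg_neg, norm_com_comm, abs_neg, setDist_comm] at h2
  rw [norm_embed, norm_embed] at h1 h2
  set K := 8 * c * J * Real.exp (μ * R) / lam with hK
  have hK0 : 0 ≤ K := by positivity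
  set E := Real.exp (-μ * (setDist X Y - lam / μ * |t|))
  have hle : ∀ m : ℝ, 0 ≤ m → K * ‖A‖ * ‖B‖ * m * E ≤ (K + 1) * ‖A‖ * ‖B‖ * m * E :=
    fun m hm => by gcongr; linarith
  rcases min_choice ((phiBoundary Φ X).card : ℝ) ((phiBoundary Φ Y).card : ℝ) with hm | hm
  · rw [hm]; exact h1.trans (hle _ (Nat.cast_nonneg _))
  · rw [hm, mul_right_comm K] at *
    exact h2.trans (by rw [mul_right_comm K]; exact hle _ (Nat.cast_nonneg _))

end Existence

/-! ### Using Lieb-Robinson constants -/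

theorem embed_com {S : Type*} [DecidableEq S] {n : S → ℕ} {X V : Finset S} (h : X ⊆ V)
    (A B : LocalAlgebra n X) : embed h (com A B) = com (embed h A) (embed h B) := by
  unfold com
  rw [← embedHom_apply, map_sub, map_mul, map_mul]
  rfl

section Use

variable {S : Type*} [MetricSpace S] [DecidableEq S] {n : S → ℕ} [∀ x, NeZero (n x)]
  {Φ : Interaction n} {V W X Y Z : Finset S} {μ k v : ℝ}

/-- Lieb-Robinson constants are uniform in the volume, so they may be used in `X` itself. -/
theorem LiebRobinson.norm_com_le (h : LiebRobinson Φ μ k v) (hμ : 0 < μ) (hk : 0 < k)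
    (hX : X ⊆ V) (hW : W ⊆ X) (hY : Y ⊆ X) {r : ℝ} (hr0 : 0 < r)
    (hr : ∀ w ∈ W, ∀ y ∈ Y, r ≤ dist w y)
    {A B : LocalAlgebra n V} (hA : IsLocal W A) (hB : IsLocal Y B) (t : ℝ) :
    ‖com (dyn (decoupledHam Φ V X) t A) B‖ ≤
      k * ‖A‖ * ‖B‖ * W.card * Real.exp (-μ * (r - v * |t|)) := by
  obtain ⟨_, A, rfl⟩ := hA
  obtain ⟨_, B, rfl⟩ := hB
  have hWY : Disjoint W Y := Finset.disjoint_left.2 fun x hx hy => by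
    have := hr x hx x hy
    rw [dist_self] at this
    exact absurd this (not_le.2 hr0)
  have h1 := h X W Y hW hY hWY A B t
  rw [← embed_embed hW hX, ← embed_embed hY hX, ← embed_evolve, ← embed_com, norm_embed, norm_embed,
    norm_embed, norm_embed, norm_embed]
  refine h1.trans ?_
  have hcW : min ((phiBoundary Φ W).card : ℝ) ((phiBoundary Φ Y).card : ℝ) ≤ W.card :=
    (min_le_left _ _).trans (Nat.cast_le.2 (card_phiBoundary_le W))
  rcases W.eq_empty_or_nonempty with rfl | hWne
  · simp [phiBoundary]
  rcases Y.eq_empty_or_nonempty with rfl | hYne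
  -- For an empty `Y` the distance takes its default value 0, so smallness has to come from the
  -- vanishing boundary factor.
  · simp only [phiBoundary, Finset.filter_empty, Finset.card_empty, Nat.cast_zero]
    rw [min_eq_right (Nat.cast_nonneg _)]
    simp only [mul_zero, zero_mul]
    positivity
  have hd : r ≤ setDist W Y := le_setDist hWne hYne hr
  gcongr ?_ * ?_
  · gcongr
  · refine Real.exp_le_exp.2 ?_
    nlinarith

/-- The observable `B` may reach out of the volume `X` of the dynamics. -/
theorem LiebRobinson.norm_com_le_of_inter (h : LiebRobinson Φ μ k v) (hμ : 0 < μ) (hk : 0 < k)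
    (hX : X ⊆ V) (hW : W ⊆ X) {r : ℝ} (hr0 : 0 < r)
    (hr : ∀ w ∈ W, ∀ y ∈ Z, y ∈ X → r ≤ dist w y)
    {A B : LocalAlgebra n V} (hA : IsLocal W A) (hB : IsLocal Z B) (t : ℝ) :
    ‖com (dyn (decoupledHam Φ V X) t A) B‖ ≤
      2 * (k * ‖A‖ * W.card * Real.exp (-μ * (r - v * |t|))) * ‖B‖ := by
  have hl : IsLocal X (dyn (decoupledHam Φ V X) t A) :=
    (isLocal_subHam hX).dyn (isLocal_subHam Finset.sdiff_subset) (hA.mono hW hX) t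
  set T := dyn (decoupledHam Φ V X) t A with hT
  obtain ⟨_, T₀, hT₀⟩ := id hl
  set δ := k * ‖A‖ * W.card * Real.exp (-μ * (r - v * |t|)) with hδ
  -- The evolved observable almost commutes with observables of `Z ∩ X`, so it is close to one of `X
  -- \ Z`, which commutes exactly with `B`.
  obtain ⟨T', -, hT'⟩ := exists_local_approximation (X := X \ Z) (Y := Z ∩ X) (V := X)
    Finset.sdiff_subset Finset.inter_subset_right
    (by intro x hx; simp only [Finset.mem_sdiff, Finset.mem_inter] at *; tauto) T₀ (δ := δ)
    (fun b hb => by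
      have hbl : IsLocal (Z ∩ X) (embed hX (embed Finset.inter_subset_right b)) :=
        ⟨Finset.inter_subset_right.trans hX, b, (embed_embed _ _ _).symm⟩
      have := h.norm_com_le hμ hk hX hW Finset.inter_subset_right hr0
        (fun w hw y hy => hr w hw y (Finset.mem_inter.1 hy).1 (Finset.mem_inter.1 hy).2) hA hbl t
      rw [← hT, ← hT₀, ← embed_com, norm_embed, norm_embed, norm_embed] at this
      refine this.trans ?_
      have h0 : 0 ≤ δ := by positivity
      calc _ = δ * ‖b‖ := by rw [hδ]; ring
        _ ≤ δ := mul_le_of_le_one_right h0 hb)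
  have hloc : IsLocal (X \ Z) (embed hX (embed Finset.sdiff_subset T')) :=
    ⟨Finset.sdiff_subset.trans hX, T', (embed_embed _ _ _).symm⟩
  have hsplit : com T B = -com (embed hX (embed Finset.sdiff_subset T') - T) B := by
    rw [com_sub_left, com_eq_zero (hloc.commute hB Finset.sdiff_disjoint)]; abel
  rw [hsplit, norm_neg]
  refine (SpinSystem.norm_com_le _ _).trans ?_
  have : ‖embed hX (embed Finset.sdiff_subset T') - T‖ ≤ δ := by
    rw [← hT₀, ← embedHom_apply hX, ← embedHom_apply hX, ← map_sub, embedHom_apply, norm_embed]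
    exact hT'
  gcongr

end Use

end SpinSystem

namespace SpinSystem

/-! ### Comparison of the full and the decoupled dynamics -/

section Neighbours

variable {S : Type*} [DecidableEq S] {n : S → ℕ} {Φ : Interaction n} {V I : Finset S}

variable (Φ V I) in
/-- The active subsets of `I` which meet `Z`. -/
def neighbours (Z : Finset S) : Finset (Finset S) :=
  (activeIn Φ V I).filter fun Z' => ¬ Disjoint Z Z'

/-- The Hamiltonian decoupled at `I` commutes with `subHam Φ V I`. What remains is a sum over the
edge of `I`, with no volume factor. -/
theorem com_subHam_eq_sum (hI : I ⊆ V) :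
    com (subHam Φ V V) (subHam Φ V I) = ∑ Z ∈ crossing Φ V I, ∑ Z' ∈ neighbours Φ V I Z,
      com (termIn Φ V Z) (termIn Φ V Z') := by
  have h0 : com (decoupledHam Φ V I) (subHam Φ V I) = 0 := by
    have h1 := isLocal_subHam (Φ := Φ) hI
    have h2 := isLocal_subHam (Φ := Φ) (V := V) (W := V \ I) Finset.sdiff_subset
    exact com_eq_zero ((Commute.refl _).add_left (h2.commute h1 Finset.sdiff_disjoint))
  rw [← sub_zero (com _ _), ← h0, ← com_sub_left, subHam_sub_decoupledHam, com_sum_left]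
  refine Finset.sum_congr rfl fun Z hZ => ?_
  have hZV := (mem_activeSets.1 (mem_crossing.1 hZ).1).1
  rw [subHam, com_sum_right, neighbours]
  symm
  refine Finset.sum_subset (Finset.filter_subset _ _) fun Z' hZ' hn => ?_
  have hd : Disjoint Z Z' := by
    by_contra hd
    exact hn (Finset.mem_filter.2 ⟨hZ', hd⟩)
  exact com_termIn_eq_zero hZV (mem_activeSets.1 (mem_activeIn.1 hZ').1).1 hd

end Neighbours

theorem FiniteRange.card_neighbours_le {S : Type*} [MetricSpace S] [DecidableEq S] {n : S → ℕ}
    {Φ : Interaction n} {R J c N : ℝ} {V I Z : Finset S} (hΦ : FiniteRange Φ R J c N) (hZ : Φ.term Z ≠ 0) :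
    ((neighbours Φ V I Z).card : ℝ) ≤ c * N := by
  refine (hΦ.card_le_mul _ Z fun Z' hZ' => ?_).trans
    (mul_le_mul_of_nonneg_left (hΦ.card_le hZ) hΦ.count_nonneg)
  obtain ⟨h1, h2⟩ := Finset.mem_filter.1 hZ'
  obtain ⟨x, hx, hx'⟩ := Finset.not_disjoint_iff.1 h2
  exact ⟨(mem_activeSets.1 (mem_activeIn.1 h1).1).2.2, x, hx, hx'⟩

/-! ### Comparison of the two dynamics on one side of the boundary -/

section Side

variable {S : Type*} [MetricSpace S] [DecidableEq S] {n : S → ℕ}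
  {Φ : Interaction n} {R J c N μ k v : ℝ} {V X I W Z : Finset S}

/-- A double sum over crossing sets and their neighbours, bounded termwise. -/
theorem norm_sum_crossing_neighbours_le (hΦ : FiniteRange Φ R J c N) {b : ℝ}
    (hb : ((crossing Φ V I).card : ℝ) ≤ c * b) {E : Type*} [NormedAddCommGroup E]
    (f : Finset S → Finset S → E) {δ : ℝ} (hδ : 0 ≤ δ)
    (hf : ∀ Z ∈ crossing Φ V I, ∀ Z' ∈ neighbours Φ V I Z, ‖f Z Z'‖ ≤ δ) :
    ‖∑ Z ∈ crossing Φ V I, ∑ Z' ∈ neighbours Φ V I Z, f Z Z'‖ ≤ c * b * (c * N * δ) := by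
  have hc := hΦ.count_nonneg
  have hN := hΦ.size_nonneg
  refine (norm_sum_le _ _).trans ((Finset.sum_le_card_nsmul _ _ (c * N * δ) fun Z hZ => ?_).trans ?_)
  · refine (norm_sum_le _ _).trans ((Finset.sum_le_card_nsmul _ _ _ (hf Z hZ)).trans ?_)
    rw [nsmul_eq_mul]
    exact mul_le_mul_of_nonneg_right
      (hΦ.card_neighbours_le (mem_activeSets.1 (mem_crossing.1 hZ).1).2.2) hδ
  · rw [nsmul_eq_mul]
    exact mul_le_mul_of_nonneg_right hb (by positivity)

variable [∀ x, NeZero (n x)]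

/-- Duhamel with the decoupled evolution inside the commutator: up to time |t|, the observable has
hardly reached the terms crossing the boundary of `X`. -/
theorem norm_dyn_sub_decoupled_le (hΦ : FiniteRange Φ R J c N) (hLR : LiebRobinson Φ μ k v)
    (hμ : 0 < μ) (hk : 0 < k) (hv : 0 < v) (hX : X ⊆ V) (hW : W ⊆ X) {r : ℝ} (hr0 : 0 < r)
    (hr : ∀ w ∈ W, ∀ Z ∈ crossing Φ V X, ∀ y ∈ Z, y ∈ X → r ≤ dist w y)
    {q : LocalAlgebra n V} (hq : IsLocal W q) (t : ℝ) :
    ‖dyn (subHam Φ V V) t q - dyn (decoupledHam Φ V X) t q‖ ≤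
      |t| * ((crossing Φ V X).card * (2 * k * J * ‖q‖ * W.card * Real.exp (-μ * (r - v * |t|)))) := by
  refine norm_dyn_sub_dyn_le_mul isSelfAdjoint_subHam q fun s hs => ?_
  rw [subHam_sub_decoupledHam, com_sum_left, ← nsmul_eq_mul]
  refine (norm_sum_le _ _).trans (Finset.sum_le_card_nsmul _ _ _ fun Z hZ => ?_)
  have hZV := (mem_activeSets.1 (mem_crossing.1 hZ).1).1
  rw [norm_com_comm]
  refine (hLR.norm_com_le_of_inter hμ hk hX hW hr0 (fun w hw y hy hyX => hr w hw Z hZ y hy hyX) hq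
    (isLocal_termIn (Φ := Φ) hZV) s).trans ?_
  have hJ : ‖termIn Φ V Z‖ ≤ J := hΦ.norm_termIn_le
  have he : Real.exp (-μ * (r - v * |s|)) ≤ Real.exp (-μ * (r - v * |t|)) := by
    refine Real.exp_le_exp.2 ?_
    have := mul_le_mul_of_nonneg_left hs (mul_pos hμ hv).le
    nlinarith
  calc _ ≤ 2 * (k * ‖q‖ * W.card * Real.exp (-μ * (r - v * |t|))) * J := by gcongr
    _ = _ := by ring

theorem norm_com_termIn_le (hΦ : FiniteRange Φ R J c N) (Z Z' : Finset S) :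
    ‖com (termIn Φ V Z) (termIn Φ V Z')‖ ≤ 2 * J ^ 2 := by
  have h1 : ‖termIn Φ V Z‖ ≤ J := hΦ.norm_termIn_le
  have h2 : ‖termIn Φ V Z'‖ ≤ J := hΦ.norm_termIn_le
  have hJ := hΦ.strength_pos
  refine (norm_com_le _ _).trans ?_
  calc 2 * ‖termIn Φ V Z‖ * ‖termIn Φ V Z'‖ ≤ 2 * J * J := by gcongr
    _ = _ := by ring

theorem norm_com_subHam_le (hΦ : FiniteRange Φ R J c N) (hI : I ⊆ V) {b : ℝ}
    (hb : ((crossing Φ V I).card : ℝ) ≤ c * b) :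
    ‖com (subHam Φ V V) (subHam Φ V I)‖ ≤ c * b * (c * N * (2 * J ^ 2)) := by
  rw [com_subHam_eq_sum hI]
  exact norm_sum_crossing_neighbours_le hΦ hb _ (by positivity)
    fun _ _ _ _ => norm_com_termIn_le hΦ _ _

/-- Comparing the evolutions of `subHam Φ V I` directly would cost its volume. Their time
derivatives are evolutions of the commutator with `H`, a sum over the edge of `I` of local pieces,
to each of which `norm_dyn_sub_decoupled_le` applies. The two time integrations give the factor t².
-/
theorem norm_dyn_subHam_sub_decoupled_le (hΦ : FiniteRange Φ R J c N) (hLR : LiebRobinson Φ μ k v)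
    (hμ : 0 < μ) (hk : 0 < k) (hv : 0 < v) (hX : X ⊆ V) (hI : I ⊆ X) {r : ℝ} (hr0 : R < r)
    (hr : ∀ w ∈ I, ∀ Z ∈ crossing Φ V X, ∀ y ∈ Z, y ∈ X → r ≤ dist w y) {a b : ℝ}
    (ha : ((crossing Φ V X).card : ℝ) ≤ c * a) (hb : ((crossing Φ V I).card : ℝ) ≤ c * b) (t : ℝ) :
    ‖dyn (subHam Φ V V) t (subHam Φ V I) - dyn (decoupledHam Φ V X) t (subHam Φ V I)‖ ≤
      |t| * (c * b * (c * N * (|t| * (c * a * (2 * k * J * (2 * J ^ 2) * (2 * N) *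
        Real.exp (-μ * (r - R - v * |t|))))))) := by
  have hJ := hΦ.strength_pos
  have hN := hΦ.size_nonneg
  have hca : 0 ≤ c * a := (Nat.cast_nonneg _).trans ha
  set H := subHam Φ V V
  set H' := decoupledHam Φ V X
  have hZI : ∀ Z ∈ crossing Φ V X, Disjoint Z I := fun Z hZ => Finset.disjoint_left.2 fun x hx hxI => by
    have := hr x hxI Z hZ x hx (hI hxI)
    rw [dist_self] at this
    linarith [hΦ.range_pos]
  -- The terms removed in `H'` are supported away from `I`, so both generators act alike on `subHam
  -- Φ V I`.
  have hcom : com H' (subHam Φ V I) = com H (subHam Φ V I) := by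
    rw [eq_comm, ← sub_eq_zero, ← com_sub_left, subHam_sub_decoupledHam, com_sum_left]
    refine Finset.sum_eq_zero fun Z hZ => com_eq_zero ?_
    exact (isLocal_termIn (mem_activeSets.1 (mem_crossing.1 hZ).1).1).commute
      (isLocal_subHam (hI.trans hX)) (hZI Z hZ)
  refine norm_dyn_sub_dyn_le_of_com fun s hs => ?_
  rw [hcom, com_subHam_eq_sum (hI.trans hX), dyn_sum, dyn_sum, ← Finset.sum_sub_distrib]
  simp_rw [dyn_sum, ← Finset.sum_sub_distrib]
  refine norm_sum_crossing_neighbours_le hΦ hb _ (by positivity) fun Z hZ Z' hZ' => ?_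
  obtain ⟨hZV, hZ0, ⟨z, hz, hzI⟩, -⟩ := exists_of_mem_crossing hZ
  obtain ⟨hZ'a, hZZ'⟩ := Finset.mem_filter.1 hZ'
  obtain ⟨hZ'a, hZ'I⟩ := mem_activeIn.1 hZ'a
  have hZ'0 := (mem_activeSets.1 hZ'a).2.2
  obtain ⟨x, hxZ, hxZ'⟩ := Finset.not_disjoint_iff.1 hZZ'
  have hZX : Z ⊆ X := by
    by_contra hZX
    have hcr : Z ∈ crossing Φ V X := mem_crossing.2 ⟨(mem_crossing.1 hZ).1, hZX,
      Finset.not_disjoint_iff.2 ⟨z, hz, hI hzI⟩⟩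
    exact Finset.disjoint_left.1 (hZI Z hcr) hz hzI
  have hsub : Z ∪ Z' ⊆ X := Finset.union_subset hZX (hZ'I.trans hI)
  have hloc : IsLocal (Z ∪ Z') (com (termIn Φ V Z) (termIn Φ V Z')) :=
    ((isLocal_termIn hZV).mono Finset.subset_union_left (hsub.trans hX)).com
      ((isLocal_termIn ((hZ'I.trans hI).trans hX)).mono Finset.subset_union_right (hsub.trans hX))
  have hcard : ((Z ∪ Z').card : ℝ) ≤ 2 * N := by
    have h1 : ((Z ∪ Z').card : ℝ) ≤ Z.card + Z'.card := by exact_mod_cast Finset.card_union_le _ _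
    linarith [hΦ.card_le hZ0, hΦ.card_le hZ'0]
  refine (norm_dyn_sub_decoupled_le hΦ hLR hμ hk hv hX hsub (r := r - R) (by linarith)
    (fun w hw Y hY y hy hyX => ?_) hloc s).trans ?_
  · have h1 := hr x (hZ'I hxZ') Y hY y hy hyX
    have h2 : dist x w ≤ R := by
      rcases Finset.mem_union.1 hw with hw | hw
      · exact hΦ.dist_le hZ0 x hxZ w hw
      · exact hΦ.dist_le hZ'0 x hxZ' w hw
    linarith [dist_triangle x w y]
  · have he : Real.exp (-μ * (r - R - v * |s|)) ≤ Real.exp (-μ * (r - R - v * |t|)) := by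
      refine Real.exp_le_exp.2 ?_
      have := mul_le_mul_of_nonneg_left hs (mul_pos hμ hv).le
      nlinarith
    have := norm_com_termIn_le (V := V) hΦ Z Z'
    gcongr

end Side

/-! ### The decomposition into interior, border and exterior -/

section Decomposition

section Membership

variable {S : Type*} [MetricSpace S] {R ℓ : ℝ} {V X : Finset S}

theorem mem_interiorSet {x : S} :
    x ∈ interiorSet R V X ℓ ↔ x ∈ X ∧ ∀ y ∈ boundary R V X, ℓ ≤ dist x y := by
  simp only [interiorSet, Finset.mem_filter]

theorem mem_borderSet {x : S} :
    x ∈ borderSet R V X ℓ ↔ x ∈ V ∧ ∃ y ∈ boundary R V X, dist x y < ℓ := by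
  simp only [borderSet, Finset.mem_filter]

theorem mem_exteriorSet {x : S} :
    x ∈ exteriorSet R V X ℓ ↔ x ∈ V ∧ x ∉ X ∧ ∀ y ∈ boundary R V X, ℓ ≤ dist x y := by
  simp only [exteriorSet, Finset.mem_filter]

theorem interiorSet_subset : interiorSet R V X ℓ ⊆ X := fun _ h => (mem_interiorSet.1 h).1

end Membership

variable {S : Type*} [MetricSpace S] [DecidableEq S] {n : S → ℕ}
  {Φ : Interaction n} {R J c N μ k v ℓ : ℝ} {V X Z : Finset S}

theorem exteriorSet_subset : exteriorSet R V X ℓ ⊆ V \ X := fun _ h =>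
  Finset.mem_sdiff.2 ⟨(mem_exteriorSet.1 h).1, (mem_exteriorSet.1 h).2.1⟩

/-- The part of a crossing set inside `X` lies in the boundary, so even ℓ would do; `ℓ - R` matches
the exterior, where one more step of length `R` is needed. -/
theorem le_dist_of_mem_interiorSet (hΦ : FiniteRange Φ R J c N) :
    ∀ w ∈ interiorSet R V X ℓ, ∀ Z ∈ crossing Φ V X, ∀ y ∈ Z, y ∈ X → ℓ - R ≤ dist w y :=
  fun w hw Z hZ y hy hyX => by
    have := (mem_interiorSet.1 hw).2 y (hΦ.mem_boundary hZ hy hyX)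
    linarith [hΦ.range_pos]

theorem le_dist_of_mem_exteriorSet (hΦ : FiniteRange Φ R J c N) :
    ∀ w ∈ exteriorSet R V X ℓ, ∀ Z ∈ crossing Φ V (V \ X), ∀ y ∈ Z, y ∈ V \ X →
      ℓ - R ≤ dist w y := fun w hw Z hZ y hy _ => by
  rw [crossing_sdiff] at hZ
  obtain ⟨-, h0, ⟨x, hx, hxX⟩, -⟩ := exists_of_mem_crossing hZ
  have h1 := (mem_exteriorSet.1 hw).2.2 x (hΦ.mem_boundary hZ hx hxX)
  have h2 := hΦ.dist_le h0 y hy x hx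
  linarith [dist_triangle w y x]


variable (Φ R ℓ V X) in
/-- The part of the Hamiltonian which belongs neither to the interior nor to the exterior. -/
def borderHam : LocalAlgebra n V :=
  subHam Φ V V - subHam Φ V (interiorSet R V X ℓ) - subHam Φ V (exteriorSet R V X ℓ)

variable (Φ R ℓ V X) in
/-- The active sets contained neither in the interior nor in the exterior. -/
def borderTerms : Finset (Finset S) :=
  (activeSets Φ V).filter fun Z => ¬ Z ⊆ interiorSet R V X ℓ ∧ ¬ Z ⊆ exteriorSet R V X ℓ

theorem borderHam_eq_sum : borderHam Φ R ℓ V X = ∑ Z ∈ borderTerms Φ R ℓ V X, termIn Φ V Z := by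
  rw [borderHam, sub_eq_iff_eq_add, sub_eq_iff_eq_add, subHam_eq_sum, subHam, subHam, activeIn,
    activeIn, borderTerms, Finset.sum_filter, Finset.sum_filter, Finset.sum_filter,
    ← Finset.sum_add_distrib, ← Finset.sum_add_distrib]
  refine Finset.sum_congr rfl fun Z hZ => ?_
  obtain ⟨-, ⟨z, hz⟩, -⟩ := mem_activeSets.1 hZ
  by_cases h1 : Z ⊆ interiorSet R V X ℓ
  · have h2 : ¬ Z ⊆ exteriorSet R V X ℓ := fun h =>
      (mem_exteriorSet.1 (h hz)).2.1 (mem_interiorSet.1 (h1 hz)).1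
    simp [h1, h2]
  · by_cases h2 : Z ⊆ exteriorSet R V X ℓ <;> simp [h1, h2]

/-- A border term with all its sites at distance at least ℓ from the boundary would contain sites on
both sides. It would then cross, and its site in `X` would be a boundary site, at distance 0 from
the boundary. -/
theorem exists_mem_borderSet (hΦ : FiniteRange Φ R J c N) (hℓ : 0 < ℓ)
    (hZ : Z ∈ borderTerms Φ R ℓ V X) :
    Z ⊆ V ∧ Φ.term Z ≠ 0 ∧ ∃ x ∈ borderSet R V X ℓ, x ∈ Z := by
  obtain ⟨hZa, h1, h2⟩ := Finset.mem_filter.1 hZ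
  obtain ⟨hZV, -, h0⟩ := mem_activeSets.1 hZa
  refine ⟨hZV, h0, ?_⟩
  by_contra hn
  have hfar : ∀ z ∈ Z, ∀ y ∈ boundary R V X, ℓ ≤ dist z y := fun z hz y hy => by
    by_contra hlt
    exact hn ⟨z, mem_borderSet.2 ⟨hZV hz, y, hy, not_le.1 hlt⟩, hz⟩
  obtain ⟨z₁, hz₁, hz₁'⟩ := Finset.not_subset.1 h1
  obtain ⟨z₂, hz₂, hz₂'⟩ := Finset.not_subset.1 h2
  have hX₁ : z₁ ∉ X := fun h => hz₁' (mem_interiorSet.2 ⟨h, hfar z₁ hz₁⟩)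
  have hX₂ : z₂ ∈ X := by
    by_contra h
    exact hz₂' (mem_exteriorSet.2 ⟨hZV hz₂, h, hfar z₂ hz₂⟩)
  have hcr : Z ∈ crossing Φ V X := mem_crossing.2 ⟨hZa, fun h => hX₁ (h hz₁),
    Finset.not_disjoint_iff.2 ⟨z₂, hz₂, hX₂⟩⟩
  have := hfar z₂ hz₂ z₂ (hΦ.mem_boundary hcr hz₂ hX₂)
  rw [dist_self] at this
  linarith

theorem card_borderTerms_le (hΦ : FiniteRange Φ R J c N) (hℓ : 0 < ℓ) :
    ((borderTerms Φ R ℓ V X).card : ℝ) ≤ c * (borderSet R V X ℓ).card :=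
  hΦ.card_le_mul _ _ fun _ hZ => (exists_mem_borderSet hΦ hℓ hZ).2

/-- A border term reaches at most ℓ + R from some boundary site, and `B` lives beyond 3ℓ, which
leaves 2ℓ - R for the Lieb-Robinson bound. -/
theorem norm_com_dyn_borderHam_le [∀ x, NeZero (n x)] (hΦ : FiniteRange Φ R J c N) (hLR : LiebRobinson Φ μ k v)
    (hμ : 0 < μ) (hk : 0 < k) (hℓ : R < ℓ) {B : LocalAlgebra n V}
    (hB : IsLocal (V \ borderSet R V X (3 * ℓ)) B) {b : ℝ}
    (hb : ((borderSet R V X ℓ).card : ℝ) ≤ b) (s : ℝ) :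
    ‖com (dyn (subHam Φ V V) s (borderHam Φ R ℓ V X)) B‖ ≤
      c * b * (k * J * ‖B‖ * N * Real.exp (-μ * (2 * ℓ - R - v * |s|))) := by
  have hR := hΦ.range_pos
  have hJ := hΦ.strength_pos
  have hN := hΦ.size_nonneg
  rw [borderHam_eq_sum, dyn_sum, com_sum_left]
  refine (norm_sum_le _ _).trans ?_
  refine (Finset.sum_le_card_nsmul _ _ (k * J * ‖B‖ * N * Real.exp (-μ * (2 * ℓ - R - v * |s|)))
    fun Z hZ => ?_).trans ?_
  · obtain ⟨hZV, h0, x, hx, hxZ⟩ := exists_mem_borderSet hΦ (hR.trans hℓ) hZ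
    obtain ⟨-, y, hy, hxy⟩ := mem_borderSet.1 hx
    have h := hLR.norm_com_le hμ hk (subset_refl V) hZV
      (Finset.sdiff_subset (s := V) (t := borderSet R V X (3 * ℓ))) (r := 2 * ℓ - R)
      (by linarith) (fun z hz w hw => by
        obtain ⟨hwV, hw⟩ := Finset.mem_sdiff.1 hw
        have h1 : 3 * ℓ ≤ dist w y := by
          by_contra hlt
          exact hw (mem_borderSet.2 ⟨hwV, y, hy, not_le.1 hlt⟩)
        have h2 := hΦ.dist_le h0 z hz x hxZ
        have h3 := dist_triangle w z y
        have h4 := dist_triangle z x y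
        rw [dist_comm z w]
        linarith) (isLocal_termIn (Φ := Φ) hZV) hB s
    rw [decoupledHam_self] at h
    refine h.trans ?_
    have h1 : ‖termIn Φ V Z‖ ≤ J := hΦ.norm_termIn_le
    have h2 := hΦ.card_le h0
    calc _ ≤ k * J * ‖B‖ * N * Real.exp (-μ * (2 * ℓ - R - v * |s|)) := by gcongr
      _ = _ := rfl
  · rw [nsmul_eq_mul]
    refine mul_le_mul_of_nonneg_right ?_ (by positivity)
    exact (card_borderTerms_le hΦ (hR.trans hℓ)).trans
      (mul_le_mul_of_nonneg_left hb hΦ.count_nonneg)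

end Decomposition

end SpinSystem

namespace SpinSystem

/-! ### Functions of a Hermitian matrix -/

section SpectralFunctions

open Matrix

variable {ι : Type*} [Fintype ι] [DecidableEq ι] {H : Matrix ι ι ℂ}

/-- The function `f` of the Hermitian matrix `H`. -/
def specFun (hH : H.IsHermitian) (f : ℝ → ℂ) : Matrix ι ι ℂ :=
  (hH.eigenvectorUnitary : Matrix ι ι ℂ) * diagonal (fun i => f (hH.eigenvalues i)) *
    star (hH.eigenvectorUnitary : Matrix ι ι ℂ)

variable (hH : H.IsHermitian) (f g : ℝ → ℂ)

theorem specFun_mul : specFun hH f * specFun hH g = specFun hH fun x => f x * g x := by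
  have h := (Unitary.mem_iff.1 hH.eigenvectorUnitary.2).1
  set U := (hH.eigenvectorUnitary : Matrix ι ι ℂ)
  calc specFun hH f * specFun hH g
      = U * diagonal (fun i => f (hH.eigenvalues i)) * (star U * U) *
        diagonal (fun i => g (hH.eigenvalues i)) * star U := by
        simp only [specFun, U, mul_assoc]
    _ = specFun hH fun x => f x * g x := by
        rw [h, mul_one, mul_assoc U, diagonal_mul_diagonal]; rfl

theorem specFun_sub : specFun hH f - specFun hH g = specFun hH fun x => f x - g x := by
  simp only [specFun]
  rw [← sub_mul, ← mul_sub, diagonal_sub]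

theorem specFun_one : specFun hH (fun _ => 1) = 1 := by
  simp only [specFun, diagonal_one, mul_one]
  exact (Unitary.mem_iff.1 hH.eigenvectorUnitary.2).2

theorem specFun_id : specFun hH (fun x => (x : ℂ)) = H := by
  conv_rhs => rw [hH.spectral_theorem]
  rfl

theorem mul_specFun : H * specFun hH f = specFun hH fun x => x * f x := by
  have h := specFun_mul hH (fun x => (x : ℂ)) f
  rwa [specFun_id] at h

theorem specFun_mul_self : specFun hH f * H = specFun hH fun x => f x * x := by
  have h := specFun_mul hH f fun x => (x : ℂ)
  rwa [specFun_id] at h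

theorem star_specFun : star (specFun hH f) = specFun hH fun x => star (f x) := by
  simp only [specFun, star_mul, star_star, mul_assoc]
  congr 2
  rw [star_eq_conjTranspose, diagonal_conjTranspose]
  rfl

variable {f g}

theorem norm_specFun_le {r : ℝ} (hr : 0 ≤ r) (h : ∀ i, ‖f (hH.eigenvalues i)‖ ≤ r) :
    ‖specFun hH f‖ ≤ r := by
  rw [specFun, CStarRing.norm_mul_mem_unitary _ (Unitary.star_mem hH.eigenvectorUnitary.2),
    CStarRing.norm_mem_unitary_mul _ hH.eigenvectorUnitary.2, l2_opNorm_diagonal]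
  exact (pi_norm_le_iff_of_nonneg hr).2 h

variable (f) in
theorem specFun_eq_sum : specFun hH f = ∑ i, f (hH.eigenvalues i) •
    ((hH.eigenvectorUnitary : Matrix ι ι ℂ) * diagonal (Pi.single i 1) *
      star (hH.eigenvectorUnitary : Matrix ι ι ℂ)) := by
  have : diagonal (fun i => f (hH.eigenvalues i)) =
      ∑ i, f (hH.eigenvalues i) • (diagonal (Pi.single i 1) : Matrix ι ι ℂ) := by
    ext a b
    rw [Matrix.sum_apply]
    by_cases h : a = b
    · subst h; simp [Pi.single_apply]
    · simp [h]
  rw [specFun, this, Finset.mul_sum, Finset.sum_mul]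
  simp

theorem propagator_eq_specFun (t : ℝ) :
    propagator H t = specFun hH fun x => Complex.exp (t * x * Complex.I) := by
  have hU : IsUnit (hH.eigenvectorUnitary : Matrix ι ι ℂ) :=
    (Unitary.toUnits hH.eigenvectorUnitary).isUnit
  have hinv : (hH.eigenvectorUnitary : Matrix ι ι ℂ)⁻¹ =
      star (hH.eigenvectorUnitary : Matrix ι ι ℂ) :=
    Matrix.inv_eq_right_inv (Unitary.mem_iff.1 hH.eigenvectorUnitary.2).2
  have h1 : (Complex.I * (t : ℂ)) • H = (hH.eigenvectorUnitary : Matrix ι ι ℂ) *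
      diagonal (fun i => (t : ℂ) * hH.eigenvalues i * Complex.I) *
      (hH.eigenvectorUnitary : Matrix ι ι ℂ)⁻¹ := by
    conv_lhs => rw [← specFun_id hH]
    rw [hinv, specFun, ← smul_mul_assoc, ← mul_smul_comm, ← diagonal_smul]
    congr 3
    funext i
    simp only [Pi.smul_apply, smul_eq_mul]
    ring
  rw [propagator, h1, Matrix.exp_conj _ _ hU, Matrix.exp_diagonal, hinv, specFun]
  congr 3
  funext i
  rw [Complex.exp_eq_exp_ℂ]
  exact Pi.coe_exp (fun i => (t : ℂ) * hH.eigenvalues i * Complex.I) i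

theorem integrable_propagator {A : Type*} [CStarAlgebra A] {H : A} (hH : IsSelfAdjoint H)
    (ν : MeasureTheory.Measure ℝ) [MeasureTheory.IsProbabilityMeasure ν] :
    MeasureTheory.Integrable (propagator H) ν :=
  (MeasureTheory.integrable_const (‖(1 : A)‖ : ℝ)).mono' (continuous_propagator H).aestronglyMeasurable
    (Filter.Eventually.of_forall fun t => by rw [← mul_one (propagator H t), norm_propagator_mul hH])

/-- On the eigenvalue x the average of e^{itx} is by definition the characteristic function of ν. -/
theorem integral_propagator (ν : MeasureTheory.Measure ℝ) [MeasureTheory.IsProbabilityMeasure ν] :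
    ∫ t, propagator H t ∂ν = specFun hH fun x => MeasureTheory.charFun ν x := by
  simp_rw [propagator_eq_specFun hH, specFun_eq_sum hH]
  rw [MeasureTheory.integral_finsetSum]
  · refine Finset.sum_congr rfl fun i _ => ?_
    rw [integral_smul_const, MeasureTheory.charFun_apply_real]
    congr 2
    funext t
    ring_nf
  · intro i _
    refine MeasureTheory.Integrable.smul_const ?_ _
    refine (MeasureTheory.integrable_const (1 : ℝ)).mono'
      (Continuous.aestronglyMeasurable (by fun_prop)) (Filter.Eventually.of_forall fun t => ?_)
    rw [Complex.norm_exp]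
    simp

/-- Spectral projection onto the eigenvalues of modulus at most `θ`. -/
theorem exists_spectral_projection {M : Matrix ι ι ℂ} (hM : IsSelfAdjoint M) {θ : ℝ} (hθ : 0 ≤ θ) :
    ∃ P L : Matrix ι ι ℂ, IsStarProjection P ∧ ‖M * P‖ ≤ θ ∧ 1 - P = L * M ∧ ‖L‖ * θ ≤ 1 := by
  have hM' : M.IsHermitian := hM
  refine ⟨specFun hM' fun x => if |x| ≤ θ then 1 else 0,
    specFun hM' fun x => if |x| ≤ θ then 0 else ((x⁻¹ : ℝ) : ℂ), ⟨?_, ?_⟩, ?_, ?_, ?_⟩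
  · rw [IsIdempotentElem, specFun_mul]
    congr 1; funext x; split_ifs <;> simp
  · rw [IsSelfAdjoint, star_specFun]
    congr 1; funext x; split_ifs <;> simp
  · rw [mul_specFun]
    refine norm_specFun_le hM' hθ fun i => ?_
    split_ifs with h
    · simpa using h
    · simpa using hθ
  · rw [specFun_mul_self, ← specFun_one hM', specFun_sub]
    congr 1
    funext x
    split_ifs with h
    · simp
    · have hx : x ≠ 0 := by
        rintro rfl
        exact h (by simpa using hθ)
      push_cast
      rw [inv_mul_cancel₀ (Complex.ofReal_ne_zero.2 hx), sub_zero]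
  -- The cutoff 0 is allowed: it gives the kernel projection, which the exactly decoupled case uses.
  · rcases hθ.eq_or_lt with rfl | hθ'
    · simp
    · rw [← le_div_iff₀ hθ', one_div]
      refine norm_specFun_le hM' (by positivity) fun i => ?_
      split_ifs with h
      · simpa using hθ
      · rw [Complex.norm_real, norm_inv, Real.norm_eq_abs]
        exact inv_anti₀ hθ' (not_le.1 h).le

end SpectralFunctions

/-! ### Gapped ground states -/

section Gap

open Matrix

variable {ι : Type*} [Fintype ι] {ψ : ι → ℂ}

theorem isStarProjection_groundProjection (h : star ψ ⬝ᵥ ψ = 1) :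
    IsStarProjection (groundProjection ψ) := by
  constructor
  · rw [IsIdempotentElem, groundProjection, vecMulVec_mul_vecMulVec, h, one_smul]
  · rw [IsSelfAdjoint, groundProjection, star_eq_conjTranspose, conjTranspose_vecMulVec, star_star]

theorem groundProjection_mul_mul (A : Matrix ι ι ℂ) :
    groundProjection ψ * A * groundProjection ψ = (star ψ ⬝ᵥ A *ᵥ ψ) • groundProjection ψ := by
  rw [groundProjection, mul_assoc, mul_vecMulVec, vecMulVec_mul_vecMulVec, vecMulVec_smul]

theorem exists_real_expectation {A : Matrix ι ι ℂ} (hA : IsSelfAdjoint A) :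
    ∃ e : ℝ, groundProjection ψ * A * groundProjection ψ = (e : ℂ) • groundProjection ψ := by
  refine ⟨(star ψ ⬝ᵥ A *ᵥ ψ).re, ?_⟩
  rw [groundProjection_mul_mul]
  congr 1
  have hA' : A.IsHermitian := hA
  exact Complex.ext (by simp) (by simpa using hA'.im_star_dotProduct_mulVec_self ψ)

/-- The Gaussian average of the propagator of a gapped Hamiltonian approximates the ground state
projection. -/
theorem IsGappedGroundState.exists_filter [DecidableEq ι] {H : Matrix ι ι ℂ} (hH : IsSelfAdjoint H) {γ : ℝ}
    (hγ : 0 < γ) (h : IsGappedGroundState H ψ γ) :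
    ∃ E : ℝ, (H - (E : ℂ) • 1) * groundProjection ψ = 0 ∧
      (∀ Q, (H - (E : ℂ) • 1) * Q = 0 → groundProjection ψ * Q = Q) ∧
      ∀ v : NNReal, ∃ K, ∫ t, propagator (H - (E : ℂ) • 1) t ∂(ProbabilityTheory.gaussianReal 0 v)
          - groundProjection ψ = K * (H - (E : ℂ) • 1) ∧
        ‖K‖ ≤ Real.exp (-v * γ ^ 2 / 2) / γ ∧
        ‖∫ t, propagator (H - (E : ℂ) • 1) t ∂(ProbabilityTheory.gaussianReal 0 v)
          - groundProjection ψ‖ ≤ Real.exp (-v * γ ^ 2 / 2) := by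
  obtain ⟨hψ, E, hE, hgap⟩ := h
  have hker : ∀ w : ι → ℂ, (H - (E : ℂ) • 1) *ᵥ w = 0 ↔ ∃ z : ℂ, z • ψ = w := by
    intro w
    rw [← Submodule.mem_span_singleton, ← hE, Module.End.mem_eigenspace_iff, toLin'_apply,
      sub_mulVec, smul_mulVec, one_mulVec, sub_eq_zero]
  set K := H - (E : ℂ) • 1 with hK
  have hKs : K.IsHermitian := hH.sub (by
    rw [IsSelfAdjoint, star_smul, star_one]; simp)
  have hKP : K * groundProjection ψ = 0 := by
    rw [groundProjection, mul_vecMulVec, (hker ψ).2 ⟨1, one_smul _ _⟩, zero_vecMulVec]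
  have hQ : ∀ Q, K * Q = 0 → groundProjection ψ * Q = Q := by
    intro Q hQ
    ext i j
    obtain ⟨z, hz⟩ := (hker fun i => Q i j).1 (by
      funext i
      exact congrFun (congrFun hQ i) j)
    have h1 : (star ψ ᵥ* Q) j = z := by
      change star ψ ⬝ᵥ (fun i => Q i j) = z
      rw [← hz, dotProduct_smul, hψ, smul_eq_mul, mul_one]
    rw [groundProjection, vecMulVec_mul, vecMulVec_apply, h1, mul_comm]
    exact congrFun hz i
  have hspec : ∀ i, hKs.eigenvalues i = 0 ∨ γ ≤ hKs.eigenvalues i := by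
    intro i
    by_contra! hcon
    set lam := hKs.eigenvalues i with hlam
    set w : ι → ℂ := ⇑(hKs.eigenvectorBasis i) with hw
    have hv : K *ᵥ w = lam • w := hKs.mulVec_eigenvectorBasis i
    have hw0 : w ≠ 0 := by
      intro h0
      have := hKs.eigenvectorBasis.toBasis.ne_zero i
      rw [OrthonormalBasis.coe_toBasis] at this
      exact this (by ext j; exact congrFun h0 j)
    have hHw : H *ᵥ w = ((E + lam : ℝ) : ℂ) • w := by
      rw [hK, sub_mulVec, smul_mulVec, one_mulVec, sub_eq_iff_eq_add] at hv
      rw [hv]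
      push_cast
      rw [add_smul, add_comm]
      rfl
    have hev : Module.End.HasEigenvalue (toLin' H) ((E + lam : ℝ) : ℂ) :=
      Module.End.hasEigenvalue_of_hasEigenvector
        ⟨Module.End.mem_eigenspace_iff.2 (by rw [toLin'_apply, hHw]), hw0⟩
    have := hgap (E + lam) hev (by simpa using hcon.1)
    linarith [hcon.2]
  -- Each projection absorbs the other: `K` annihilates `Q`, and `1 - Q` is a multiple of `K`, which
  -- annihilates ψ.
  have hP0 : specFun hKs (fun x => if x = 0 then 1 else 0) = groundProjection ψ := by
    set Q := specFun hKs fun x => if x = 0 then 1 else 0 with hQdef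
    have h1 : groundProjection ψ * Q = Q := hQ Q (by
      rw [mul_specFun]
      have : (fun x : ℝ => (x : ℂ) * if x = 0 then 1 else 0) = fun _ => 0 := by
        funext x
        by_cases hx : x = 0 <;> simp [hx]
      rw [this]
      simp [specFun])
    have h2 : Q * groundProjection ψ = groundProjection ψ := by
      have h3 : 1 - Q = specFun hKs (fun x => if x = 0 then 0 else ((x⁻¹ : ℝ) : ℂ)) * K := by
        rw [specFun_mul_self, ← specFun_one hKs, specFun_sub]
        congr 1
        funext x
        by_cases hx : x = 0 <;> simp [hx]
      have h4 : (1 - Q) * groundProjection ψ = 0 := by rw [h3, mul_assoc, hKP, mul_zero]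
      rw [sub_mul, one_mul, sub_eq_zero] at h4
      exact h4.symm
    have hs : star Q = Q := by
      rw [hQdef, star_specFun]
      congr 1; funext x; split_ifs <;> simp
    have hsP := (isStarProjection_groundProjection hψ).isSelfAdjoint.star_eq
    have h5 := congrArg star h1
    rw [star_mul, hs, hsP, h2] at h5
    exact h5.symm
  refine ⟨E, hKP, hQ, fun v => ?_⟩
  set g : ℝ → ℂ := fun x => MeasureTheory.charFun (ProbabilityTheory.gaussianReal 0 v) x with hg
  have hg0 : g 0 = 1 := by simp [hg]
  have hgle : ∀ x, γ ≤ x → ‖g x‖ ≤ Real.exp (-v * γ ^ 2 / 2) := by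
    intro x hx
    have : g x = ((Real.exp (-v * x ^ 2 / 2) : ℝ) : ℂ) := by
      rw [hg]
      simp only [ProbabilityTheory.charFun_gaussianReal]
      push_cast
      congr 1
      ring
    rw [this, Complex.norm_real, Real.norm_eq_abs, abs_of_pos (Real.exp_pos _)]
    refine Real.exp_le_exp.2 ?_
    have h1 : γ ^ 2 ≤ x ^ 2 := by gcongr
    have h2 := mul_le_mul_of_nonneg_left h1 v.coe_nonneg
    linarith
  rw [integral_propagator hKs, ← hP0, specFun_sub]
  -- The filter minus P₀ vanishes at the eigenvalue 0 and can be divided by x on the rest of the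
  -- spectrum, where x ≥ γ.
  refine ⟨specFun hKs fun x => if x = 0 then 0 else g x * ((x⁻¹ : ℝ) : ℂ), ?_, ?_, ?_⟩
  · rw [specFun_mul_self]
    congr 1
    funext x
    by_cases hx : x = 0
    · simp only [hx, if_true, Complex.ofReal_zero, mul_zero]
      exact sub_eq_zero.2 hg0
    · simp only [hx, if_false, sub_zero]
      push_cast
      rw [mul_assoc, inv_mul_cancel₀ (Complex.ofReal_ne_zero.2 hx), mul_one]
  · refine norm_specFun_le hKs (by positivity) fun i => ?_
    rcases hspec i with h0 | h0
    · rw [if_pos h0, norm_zero]; positivity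
    · rw [if_neg (by linarith), norm_mul, Complex.norm_real, norm_inv, Real.norm_eq_abs,
        abs_of_pos (by linarith : (0 : ℝ) < _), div_eq_mul_inv]
      exact mul_le_mul (hgle _ h0) (inv_anti₀ hγ h0)
        (inv_nonneg.2 (by linarith)) (Real.exp_pos _).le
  · refine norm_specFun_le hKs (Real.exp_pos _).le fun i => ?_
    rcases hspec i with h0 | h0
    · have h1 : g (hKs.eigenvalues i) - 1 = 0 := by rw [h0, hg0, sub_self]
      rw [if_pos h0]
      change ‖g (hKs.eigenvalues i) - 1‖ ≤ _
      rw [h1, norm_zero]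
      exact (Real.exp_pos _).le
    · rw [if_neg (by linarith), sub_zero]
      exact hgle _ h0

end Gap

end SpinSystem

namespace SpinSystem

/-! ### Exponential moments of Gaussian measures -/

section Moments

open MeasureTheory ProbabilityTheory

theorem exp_mul_abs_le (β t : ℝ) :
    Real.exp (β * |t|) ≤ Real.exp (β * t) + Real.exp (-β * t) := by
  rcases abs_cases t with ⟨h, -⟩ | ⟨h, -⟩ <;> rw [h]
  · linarith [Real.exp_pos (-β * t)]
  · rw [mul_neg, ← neg_mul]; linarith [Real.exp_pos (β * t)]

theorem integrable_exp_mul_abs (β : ℝ) (v : NNReal) :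
    Integrable (fun t => Real.exp (β * |t|)) (gaussianReal 0 v) := by
  refine ((integrable_exp_mul_gaussianReal β).add (integrable_exp_mul_gaussianReal (-β))).mono'
    (Continuous.aestronglyMeasurable (by fun_prop)) (Filter.Eventually.of_forall fun t => ?_)
  rw [Real.norm_eq_abs, abs_of_pos (Real.exp_pos _)]
  exact exp_mul_abs_le β t

theorem integral_exp_mul_gaussianReal (β : ℝ) (v : NNReal) :
    ∫ t, Real.exp (β * t) ∂(gaussianReal 0 v) = Real.exp (v * β ^ 2 / 2) := by
  have := congrFun (mgf_fun_id_gaussianReal (μ := 0) (v := v)) β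
  simpa [mgf] using this

theorem integral_exp_mul_abs_le (β : ℝ) (v : NNReal) :
    ∫ t, Real.exp (β * |t|) ∂(gaussianReal 0 v) ≤ 2 * Real.exp (v * β ^ 2 / 2) := by
  calc ∫ t, Real.exp (β * |t|) ∂(gaussianReal 0 v)
      ≤ ∫ t, (Real.exp (β * t) + Real.exp (-β * t)) ∂(gaussianReal 0 v) :=
        integral_mono (integrable_exp_mul_abs β v)
          ((integrable_exp_mul_gaussianReal β).add (integrable_exp_mul_gaussianReal (-β)))
          (exp_mul_abs_le β)
    _ = _ := by
        rw [integral_add (integrable_exp_mul_gaussianReal β) (integrable_exp_mul_gaussianReal (-β)),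
          integral_exp_mul_gaussianReal, integral_exp_mul_gaussianReal, neg_sq, two_mul]

/-- Powers of |t| are traded for a slightly larger exponential rate, so that only exponential
moments of the Gaussian are needed. -/
theorem abs_le_exp_mul_abs {δ : ℝ} (hδ : 0 < δ) (t : ℝ) : |t| ≤ δ⁻¹ * Real.exp (δ * |t|) := by
  rw [inv_mul_eq_div, le_div_iff₀ hδ]
  linarith [Real.add_one_le_exp (δ * |t|)]

theorem abs_mul_abs_le_exp_mul_abs {δ : ℝ} (hδ : 0 < δ) (t : ℝ) :
    |t| * |t| ≤ 2 * (δ⁻¹) ^ 2 * Real.exp (δ * |t|) := by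
  have h := Real.quadratic_le_exp_of_nonneg (mul_nonneg hδ.le (abs_nonneg t))
  have h1 : (δ * |t|) ^ 2 ≤ 2 * Real.exp (δ * |t|) := by
    have : 0 ≤ δ * |t| := by positivity
    linarith
  have h2 : |t| * |t| = (δ⁻¹) ^ 2 * (δ * |t|) ^ 2 := by field_simp
  rw [h2]
  calc (δ⁻¹) ^ 2 * (δ * |t|) ^ 2 ≤ (δ⁻¹) ^ 2 * (2 * Real.exp (δ * |t|)) := by gcongr
    _ = _ := by ring

end Moments

/-! ### Averaging over time -/

section TimeAverage

open MeasureTheory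

variable {A : Type*} [CStarAlgebra A] {ν : Measure ℝ}

theorem mul_integral (C : A) {f : ℝ → A} (hf : Integrable f ν) :
    C * ∫ t, f t ∂ν = ∫ t, C * f t ∂ν :=
  ((ContinuousLinearMap.mul ℝ A C).integral_comp_comm hf).symm

theorem integral_mul (C : A) {f : ℝ → A} (hf : Integrable f ν) :
    (∫ t, f t ∂ν) * C = ∫ t, f t * C ∂ν :=
  (((ContinuousLinearMap.mul ℝ A).flip C).integral_comp_comm hf).symm

theorem integrable_mul {C : A} {f : ℝ → A} (hf : Integrable f ν) :
    Integrable (fun t => f t * C) ν :=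
  ((ContinuousLinearMap.mul ℝ A).flip C).integrable_comp hf

theorem integrable_mul' {C : A} {f : ℝ → A} (hf : Integrable f ν) :
    Integrable (fun t => C * f t) ν :=
  (ContinuousLinearMap.mul ℝ A C).integrable_comp hf

variable {H M B : A}

theorem norm_com_integral_le {f : ℝ → A} (hf : Integrable f ν) {g : ℝ → ℝ} (hg : Integrable g ν)
    (h : ∀ t, ‖com (f t) B‖ ≤ g t) : ‖com (∫ t, f t ∂ν) B‖ ≤ ∫ t, g t ∂ν := by
  rw [com, integral_mul B hf, mul_integral B hf, ← integral_sub (integrable_mul hf)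
    (integrable_mul' hf)]
  exact norm_integral_le_of_norm_le hg (Filter.Eventually.of_forall h)

variable [IsProbabilityMeasure ν]

/-- The average of the dynamics over a probability distribution of times. -/
def timeAverage (ν : Measure ℝ) (H B : A) : A := ∫ t, dyn H t B ∂ν

theorem integrable_of_continuous_of_norm_le {f : ℝ → A} (hf : Continuous f) {r : ℝ}
    (h : ∀ t, ‖f t‖ ≤ r) : Integrable f ν :=
  (integrable_const r).mono' hf.aestronglyMeasurable (Filter.Eventually.of_forall h)

theorem integrable_dyn (hH : IsSelfAdjoint H) (B : A) : Integrable (fun t => dyn H t B) ν :=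
  integrable_of_continuous_of_norm_le (continuous_dyn H B) fun t => (norm_dyn hH t B).le

theorem isSelfAdjoint_timeAverage (hH : IsSelfAdjoint H) (hB : IsSelfAdjoint B) :
    IsSelfAdjoint (timeAverage ν H B) := by
  have h := ((starL' ℝ : A ≃L[ℝ] A) : A →L[ℝ] A).integral_comp_comm (integrable_dyn (ν := ν) hH B)
  rw [IsSelfAdjoint, timeAverage]
  refine h.symm.trans (integral_congr_ae (Filter.Eventually.of_forall fun t => ?_))
  change star (dyn H t B) = dyn H t B
  rw [star_dyn hH, hB.star_eq]

theorem timeAverage_add (hH : IsSelfAdjoint H) (B C : A) :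
    timeAverage ν H (B + C) = timeAverage ν H B + timeAverage ν H C := by
  simp only [timeAverage, dyn_add]
  exact integral_add (integrable_dyn hH B) (integrable_dyn hH C)

theorem timeAverage_of_commute (h : Commute H B) : timeAverage ν H B = B := by
  simp [timeAverage, dyn_of_commute h]

theorem norm_timeAverage_sub_le {H' : A} (hH : IsSelfAdjoint H) (hH' : IsSelfAdjoint H') (B : A)
    {g : ℝ → ℝ} (hg : Integrable g ν) (h : ∀ t, ‖dyn H t B - dyn H' t B‖ ≤ g t) :
    ‖timeAverage ν H B - timeAverage ν H' B‖ ≤ ∫ t, g t ∂ν := by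
  rw [timeAverage, timeAverage, ← integral_sub (integrable_dyn hH B) (integrable_dyn hH' B)]
  exact norm_integral_le_of_norm_le hg (Filter.Eventually.of_forall h)

theorem dyn_timeAverage (hH : IsSelfAdjoint H) (B : A) (s : ℝ) :
    dyn H s (timeAverage ν H B) = ∫ u, dyn H (s + u) B ∂ν := by
  have h := integrable_dyn (ν := ν) hH B
  rw [timeAverage, dyn, mul_integral _ h, integral_mul _ (integrable_mul' h)]
  simp_rw [← dyn_dyn]
  rfl

theorem propagator_mul_of_mul_eq_zero {P : A} (h : H * P = 0) (t : ℝ) : propagator H t * P = P := by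
  have hd : ∀ s, HasDerivAt (fun s => propagator H s * P) 0 s := fun s => by
    have := (hasDerivAt_propagator H s).mul_const P
    rwa [mul_assoc, smul_mul_assoc, h, smul_zero, mul_zero] at this
  have := is_const_of_deriv_eq_zero (fun s => (hd s).differentiableAt) (fun s => (hd s).deriv) t 0
  simpa [propagator_zero] using this

theorem norm_propagator_sub_one_mul_le (hH : IsSelfAdjoint H) (P : A) (t : ℝ) :
    ‖(propagator H t - 1) * P‖ ≤ |t| * ‖H * P‖ := by
  have hd : ∀ s ∈ Set.uIcc 0 t, HasDerivWithinAt (fun s => propagator H s * P)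
      (propagator H s * (Complex.I • H) * P) (Set.uIcc 0 t) s := fun s _ =>
    ((hasDerivAt_propagator H s).mul_const P).hasDerivWithinAt
  have := (convex_uIcc 0 t).norm_image_sub_le_of_norm_hasDerivWithin_le hd (C := ‖H * P‖)
    (fun s _ => by
      rw [mul_assoc, norm_propagator_mul hH, smul_mul_assoc, norm_smul, Complex.norm_I, one_mul])
    Set.left_mem_uIcc Set.right_mem_uIcc
  simpa [propagator_zero, sub_mul, mul_comm] using this

/-- The time average of an observable acts on the ground state approximately as a scalar. -/
theorem norm_timeAverage_sub_mul_le (hH : IsSelfAdjoint H) {P K : A} {e : ℂ}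
    (hP : ‖P‖ ≤ 1) (hHP : H * P = 0) (hB : P * B * P = e • P)
    (hK : ∫ t, propagator H t ∂ν - P = K * H) :
    ‖(timeAverage ν H B - e • 1) * P‖ ≤ ‖K‖ * ‖com H B‖ := by
  have h1 : timeAverage ν H B * P = (∫ t, propagator H t ∂ν) * (B * P) := by
    rw [timeAverage, integral_mul _ (integrable_dyn hH B), integral_mul _ (integrable_propagator hH ν)]
    congr 1
    funext t
    rw [dyn, mul_assoc, propagator_mul_of_mul_eq_zero hHP, mul_assoc]
  -- The average times P is (P + K H) B P; the part P B P is the subtracted scalar, and H P = 0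
  -- completes H B to a commutator.
  have h2 : (timeAverage ν H B - e • 1) * P = K * com H B * P := by
    rw [sub_mul, h1, eq_add_of_sub_eq hK, smul_mul_assoc, one_mul, ← hB, com, mul_sub, sub_mul,
      mul_assoc K (B * H), mul_assoc B, hHP]
    noncomm_ring
  rw [h2]
  calc ‖K * com H B * P‖ ≤ ‖K‖ * ‖com H B‖ * ‖P‖ :=
        (norm_mul_le _ _).trans (mul_le_mul_of_nonneg_right (norm_mul_le _ _) (norm_nonneg _))
    _ ≤ ‖K‖ * ‖com H B‖ := mul_le_of_le_one_right (by positivity) hP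

/-- The unitary `e^{itH} e^{-itM}` almost commutes with everything that almost commutes with
the evolution of `H - M`. -/
theorem norm_com_propagator_mul_propagator_le (hH : IsSelfAdjoint H) (hM : IsSelfAdjoint M) (B : A)
    {t δ : ℝ} (h : ∀ s, |s| ≤ |t| → ‖com (dyn H s (H - M)) B‖ ≤ δ) :
    ‖com (propagator H t * propagator M (-t)) B‖ ≤ |t| * δ := by
  -- The commutator is, up to unitary factors, the difference between `B` and its evolution forward
  -- with `H` after backward with `M`, so Duhamel applies.
  have h1 : com (propagator H t * propagator M (-t)) B =
      (dyn H t (dyn M (-t) B) - B) * propagator H t * propagator M (-t) := by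
    have e1 : dyn H t (dyn M (-t) B) * propagator H t = propagator H t * dyn M (-t) B := by
      rw [dyn, mul_assoc, propagator_neg_mul, mul_one]
    have e2 : dyn M (-t) B * propagator M (-t) = propagator M (-t) * B := by
      rw [dyn, neg_neg, mul_assoc, propagator_mul_neg, mul_one]
    rw [sub_mul, e1, sub_mul, mul_assoc, e2, com]
    simp only [mul_assoc]
  rw [h1, norm_mul_propagator hM, norm_mul_propagator hH, ← norm_dyn hH (-t), dyn_sub, dyn_neg_dyn,
    ← abs_neg t]
  refine norm_dyn_sub_dyn_le_mul hM B fun s hs => ?_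
  rw [← neg_sub, com_neg_left, norm_neg]
  have := h (-s) (by rwa [abs_neg, ← abs_neg t])
  rwa [norm_com_dyn hH, neg_neg] at this

theorem norm_isStarProjection_le {P : A} (hP : IsStarProjection P) : ‖P‖ ≤ 1 := by
  have h : ‖star P * P‖ = ‖P‖ * ‖P‖ := CStarRing.norm_star_mul_self
  rw [hP.isSelfAdjoint.star_eq, hP.isIdempotentElem.eq] at h
  by_contra! hlt
  nlinarith

/-- The ground state projection is approximated by the product of an approximation of the averaged
interaction propagator and two approximate spectral projections. -/
theorem norm_mul_mul_sub_le {M₁ M₂ P₁ P₂ P₀ Q : A} (hH : IsSelfAdjoint H)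
    (hM₁ : IsSelfAdjoint M₁) (hM₂ : IsSelfAdjoint M₂) (hP₁ : IsStarProjection P₁)
    (hP₂ : IsStarProjection P₂) (hP₀ : IsStarProjection P₀) (hMP : Commute M₂ P₁)
    (hPP : Commute P₁ P₂) {θ θ' δ η τ : ℝ}
    (h₁ : ‖M₁ * P₁‖ ≤ θ) (h₂ : ‖M₂ * P₂‖ ≤ θ) (h₁' : ‖(1 - P₁) * P₀‖ ≤ θ')
    (h₂' : ‖(1 - P₂) * P₀‖ ≤ θ') (hη : ‖∫ t, propagator H t ∂ν - P₀‖ ≤ η)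
    (hδ : ‖Q - ∫ t, propagator H t * propagator (M₁ + M₂) (-t) ∂ν‖ ≤ δ)
    (hτ : Integrable (fun t => |t|) ν) (hτ' : ∫ t, |t| ∂ν ≤ τ) :
    ‖Q * P₁ * P₂ - P₀‖ ≤ δ + 2 * θ * τ + η + 2 * θ' := by
  set M := M₁ + M₂
  have hM : IsSelfAdjoint M := hM₁.add hM₂
  have n₁ := norm_isStarProjection_le hP₁
  have n₂ := norm_isStarProjection_le hP₂
  have n₀ := norm_isStarProjection_le hP₀
  have hθ : 0 ≤ θ := (norm_nonneg _).trans h₁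
  have hMPP : ‖M * (P₁ * P₂)‖ ≤ 2 * θ := by
    have : M * (P₁ * P₂) = M₁ * P₁ * P₂ + P₁ * (M₂ * P₂) := by
      rw [add_mul, ← mul_assoc, ← mul_assoc M₂, hMP.eq, mul_assoc P₁]
    rw [this]
    refine (norm_add_le _ _).trans ?_
    have a1 := (norm_mul_le (M₁ * P₁) P₂).trans (mul_le_mul h₁ n₂ (norm_nonneg _) hθ)
    have a2 := (norm_mul_le P₁ (M₂ * P₂)).trans (mul_le_mul n₁ h₂ (norm_nonneg _) zero_le_one)
    linarith
  have hPn : ‖P₁ * P₂‖ ≤ 1 :=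
    (norm_mul_le _ _).trans (mul_le_one₀ n₁ (norm_nonneg _) n₂)
  have hU : Integrable (fun t => propagator H t * propagator M (-t)) ν :=
    integrable_of_continuous_of_norm_le ((continuous_propagator H).mul
      ((continuous_propagator M).comp continuous_neg)) (r := ‖(1 : A)‖) fun t => by
        rw [norm_propagator_mul hH, ← one_mul (propagator M (-t)), norm_mul_propagator hM]
  set T := ∫ t, propagator H t * propagator M (-t) ∂ν
  set G := ∫ t, propagator H t ∂ν
  have e1 : ‖(T - G) * (P₁ * P₂)‖ ≤ 2 * θ * τ := by
    have hG := integrable_propagator hH ν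
    have hUG : Integrable (fun t => propagator H t * propagator M (-t) - propagator H t) ν :=
      hU.sub hG
    rw [← integral_sub hU hG, integral_mul _ hUG]
    calc _ ≤ ∫ t, |t| * (2 * θ) ∂ν := by
          refine norm_integral_le_of_norm_le (hτ.mul_const _) (Filter.Eventually.of_forall fun t => ?_)
          have : (propagator H t * propagator M (-t) - propagator H t) * (P₁ * P₂) =
              propagator H t * ((propagator M (-t) - 1) * (P₁ * P₂)) := by noncomm_ring
          rw [this, norm_propagator_mul hH]
          refine (norm_propagator_sub_one_mul_le hM _ _).trans ?_
          rw [abs_neg]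
          gcongr
      _ = (∫ t, |t| ∂ν) * (2 * θ) := MeasureTheory.integral_mul_const _ _
      _ ≤ τ * (2 * θ) := by gcongr
      _ = _ := by ring
  have e2 : ‖(Q - T) * (P₁ * P₂)‖ ≤ δ :=
    (norm_mul_le _ _).trans ((mul_le_of_le_one_right (norm_nonneg _) hPn).trans hδ)
  have e3 : ‖(G - P₀) * (P₁ * P₂)‖ ≤ η :=
    (norm_mul_le _ _).trans ((mul_le_of_le_one_right (norm_nonneg _) hPn).trans hη)
  have e4 : ‖P₀ * (1 - P₁ * P₂)‖ ≤ 2 * θ' := by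
    rw [← norm_star, star_mul, hP₀.isSelfAdjoint.star_eq, star_sub, star_one, star_mul,
      hP₁.isSelfAdjoint.star_eq, hP₂.isSelfAdjoint.star_eq, ← hPP.eq]
    have : (1 - P₁ * P₂) * P₀ = (1 - P₁) * P₀ + P₁ * ((1 - P₂) * P₀) := by noncomm_ring
    rw [this]
    refine (norm_add_le _ _).trans ?_
    have := (norm_mul_le P₁ ((1 - P₂) * P₀)).trans
      (mul_le_mul n₁ h₂' (norm_nonneg _) zero_le_one)
    linarith
  -- The four errors: localization of T, removal of e^{-itM} on the range of P₁P₂, the gap filter,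
  -- and the loss P₀(1 - P₁P₂).
  have key : Q * P₁ * P₂ - P₀ = (Q - T) * (P₁ * P₂) + (T - G) * (P₁ * P₂) +
      (G - P₀) * (P₁ * P₂) - P₀ * (1 - P₁ * P₂) := by noncomm_ring
  rw [key]
  refine (norm_sub_le _ _).trans (add_le_add ((norm_add_le _ _).trans
    (add_le_add ((norm_add_le _ _).trans (add_le_add e2 e1)) e3)) e4)

end TimeAverage

end SpinSystem

namespace SpinSystem

/-! ### Approximate ground state projections -/

section Main

open MeasureTheory ProbabilityTheory

theorem isSelfAdjoint_real_smul_one {A : Type*} [CStarAlgebra A] (e : ℝ) :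
    IsSelfAdjoint ((e : ℂ) • (1 : A)) := by
  rw [IsSelfAdjoint, star_smul, star_one]
  simp

theorem timeAverage_add_smul_one {A : Type*} [CStarAlgebra A] {ν : Measure ℝ} (H B : A) (z : ℂ) :
    timeAverage ν (H + z • 1) B = timeAverage ν H B := by
  simp only [timeAverage, dyn_add_smul_one]

variable {S : Type*} {n : S → ℕ} [DecidableEq S] {Φ : Interaction n} {V X : Finset S}

theorem isSelfAdjoint_hamiltonian : IsSelfAdjoint (hamiltonian Φ V) := by
  rw [hamiltonian_eq]
  exact isSelfAdjoint_subHam.add (isSelfAdjoint_real_smul_one _)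

theorem isLocal_smul_one (hX : X ⊆ V) (z : ℂ) : IsLocal X (z • (1 : LocalAlgebra n V)) :=
  ⟨hX, z • 1, by rw [← embedHom_apply, map_smul, map_one]⟩

variable [∀ x, NeZero (n x)]

theorem isLocal_timeAverage {ν : Measure ℝ} [IsProbabilityMeasure ν] {B : LocalAlgebra n V}
    (hB : IsLocal X B) : IsLocal X (timeAverage ν (decoupledHam Φ V X) B) := by
  obtain ⟨hX, B, rfl⟩ := hB
  refine ⟨hX, timeAverage ν (hamiltonian Φ X) B, ?_⟩
  let L : LocalAlgebra n X →L[ℝ] LocalAlgebra n V :=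
    ⟨((embedHom hX).toAlgHom.toLinearMap).restrictScalars ℝ, continuous_embed hX⟩
  have h := L.integral_comp_comm (integrable_dyn (ν := ν) (isSelfAdjoint_hamiltonian (Φ := Φ)) B)
  refine h.symm.trans ?_
  unfold timeAverage
  congr 1
  funext t
  rw [← embed_evolve, evolve_eq_dyn]
  rfl

theorem exists_local_spectral_projection (hX : X ⊆ V) {M : LocalAlgebra n V}
    (hM : IsSelfAdjoint M) (hMX : IsLocal X M) {θ : ℝ} (hθ : 0 ≤ θ) :
    ∃ (p : LocalAlgebra n X) (L : LocalAlgebra n V), IsStarProjection p ∧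
      ‖M * embed hX p‖ ≤ θ ∧ 1 - embed hX p = L * M ∧ ‖L‖ * θ ≤ 1 := by
  obtain ⟨_, m, rfl⟩ := hMX
  have hm : IsSelfAdjoint m := embed_injective hX (by
    rw [← embedHom_apply, map_star]
    exact hM)
  obtain ⟨p, l, hp, h1, h2, h3⟩ := exists_spectral_projection hm hθ
  refine ⟨p, embed hX l, hp, ?_, ?_, by rwa [norm_embed]⟩
  · rw [← embedHom_apply, ← embedHom_apply, ← map_mul, embedHom_apply, norm_embed]
    exact h1
  · rw [← embedHom_apply, ← embedHom_apply, ← embedHom_apply, ← map_mul, ← h2, map_sub, map_one]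

variable [MetricSpace S] {R J c N μ k v : ℝ} {I : Finset S}

/-- The bound on the difference of the averaged full and decoupled dynamics. -/
def averagingError (R J c N μ k v ℓ δ a b : ℝ) (w : NNReal) : ℝ :=
  c * b * (c * N) * (c * a * (8 * k * J ^ 3 * N)) * (2 * δ⁻¹ ^ 2) * Real.exp (-μ * (ℓ - 2 * R)) *
    (2 * Real.exp (w * (μ * v + δ) ^ 2 / 2))

/-- The pointwise error grows like t² e^{μv|t|}. Absorbing t² into e^{δ|t|} leaves a Gaussian
exponential moment at rate μv + δ. -/
theorem norm_timeAverage_subHam_sub_le (hΦ : FiniteRange Φ R J c N) (hLR : LiebRobinson Φ μ k v)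
    (hμ : 0 < μ) (hk : 0 < k) (hv : 0 < v) (hX : X ⊆ V) (hI : I ⊆ X) {ℓ : ℝ} (hℓ : 2 * R < ℓ)
    (hr : ∀ w ∈ I, ∀ Z ∈ crossing Φ V X, ∀ y ∈ Z, y ∈ X → ℓ - R ≤ dist w y) {a b : ℝ}
    (hb0 : 0 ≤ b)
    (ha : ((crossing Φ V X).card : ℝ) ≤ c * a) (hb : ((crossing Φ V I).card : ℝ) ≤ c * b)
    {δ : ℝ} (hδ : 0 < δ) (w : NNReal) :
    ‖timeAverage (gaussianReal 0 w) (subHam Φ V V) (subHam Φ V I) -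
      timeAverage (gaussianReal 0 w) (decoupledHam Φ V X) (subHam Φ V I)‖ ≤
      averagingError R J c N μ k v ℓ δ a b w := by
  have hJ := hΦ.strength_pos
  have hN := hΦ.size_nonneg
  have hc := hΦ.count_nonneg
  have hca : 0 ≤ c * a := (Nat.cast_nonneg _).trans ha
  set K := c * b * (c * N) * (c * a * (8 * k * J ^ 3 * N)) * (2 * δ⁻¹ ^ 2) *
    Real.exp (-μ * (ℓ - 2 * R)) with hK
  have hK0 : 0 ≤ K := by positivity
  refine (norm_timeAverage_sub_le isSelfAdjoint_subHam isSelfAdjoint_decoupledHam _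
    (g := fun t => K * Real.exp ((μ * v + δ) * |t|)) ((integrable_exp_mul_abs _ w).const_mul K)
    fun t => ?_).trans ?_
  · refine (norm_dyn_subHam_sub_decoupled_le hΦ hLR hμ hk hv hX hI (r := ℓ - R) (by linarith) hr
      ha hb t).trans ?_
    have h1 := abs_mul_abs_le_exp_mul_abs hδ t
    have e1 : Real.exp (-μ * (ℓ - R - R - v * |t|)) =
        Real.exp (-μ * (ℓ - 2 * R)) * Real.exp (μ * v * |t|) := by
      rw [← Real.exp_add]; congr 1; ring
    have e2 : Real.exp ((μ * v + δ) * |t|) = Real.exp (μ * v * |t|) * Real.exp (δ * |t|) := by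
      rw [← Real.exp_add]; congr 1; ring
    rw [e1]
    rw [e2]
    calc _ = (c * b * (c * N) * (c * a * (8 * k * J ^ 3 * N)) *
          (Real.exp (-μ * (ℓ - 2 * R)) * Real.exp (μ * v * |t|))) * (|t| * |t|) := by ring
      _ ≤ (c * b * (c * N) * (c * a * (8 * k * J ^ 3 * N)) *
          (Real.exp (-μ * (ℓ - 2 * R)) * Real.exp (μ * v * |t|))) *
          (2 * δ⁻¹ ^ 2 * Real.exp (δ * |t|)) := by gcongr
      _ = _ := by rw [hK]; ring
  · rw [MeasureTheory.integral_const_mul]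
    exact mul_le_mul_of_nonneg_left (integral_exp_mul_abs_le _ w) hK0

/-- The averaged Hamiltonian of one side of the boundary and its spectral projection. -/
theorem exists_side_projection (hΦ : FiniteRange Φ R J c N) (hLR : LiebRobinson Φ μ k v)
    (hμ : 0 < μ) (hk : 0 < k) (hv : 0 < v) (hX : X ⊆ V) (hI : I ⊆ X) {ℓ : ℝ} (hℓ : 2 * R < ℓ)
    (hr : ∀ w ∈ I, ∀ Z ∈ crossing Φ V X, ∀ y ∈ Z, y ∈ X → ℓ - R ≤ dist w y) {a b : ℝ}
    (hb0 : 0 ≤ b)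
    (ha : ((crossing Φ V X).card : ℝ) ≤ c * a) (hb : ((crossing Φ V I).card : ℝ) ≤ c * b)
    {δ : ℝ} (hδ : 0 < δ) (w : NNReal) {ψ : Config n V → ℂ} (hψ : star ψ ⬝ᵥ ψ = 1) {z : ℂ}
    (hH : IsSelfAdjoint (subHam Φ V V + z • 1)) {K : LocalAlgebra n V}
    (hHψ : (subHam Φ V V + z • 1) * groundProjection ψ = 0)
    (hK : ∫ t, propagator (subHam Φ V V + z • 1) t ∂(gaussianReal 0 w) - groundProjection ψ =
      K * (subHam Φ V V + z • 1)) {θ : ℝ} (hθ : 0 < θ)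
    (hθ' : ‖K‖ * (c * b * (c * N * (2 * J ^ 2))) + averagingError R J c N μ k v ℓ δ a b w ≤ θ ^ 2) :
    ∃ (p : LocalAlgebra n X) (M : LocalAlgebra n V) (e : ℂ), IsStarProjection p ∧
      IsSelfAdjoint M ∧ IsLocal X M ∧ ‖M * embed hX p‖ ≤ θ ∧
      ‖(1 - embed hX p) * groundProjection ψ‖ ≤ θ ∧
      ‖timeAverage (gaussianReal 0 w) (subHam Φ V V + z • 1) (subHam Φ V I) - (M + e • 1)‖ ≤
        averagingError R J c N μ k v ℓ δ a b w := by
  set ν := gaussianReal 0 w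
  set H := subHam Φ V V + z • 1
  set P₀ := groundProjection ψ
  have hP₀ : IsStarProjection P₀ := isStarProjection_groundProjection hψ
  have hn := norm_isStarProjection_le hP₀
  obtain ⟨e, he⟩ := exists_real_expectation (ψ := ψ) (isSelfAdjoint_subHam (Φ := Φ) (V := V) (W := I))
  have hD := norm_timeAverage_subHam_sub_le hΦ hLR hμ hk hv hX hI hℓ hr hb0 ha hb hδ w
  set D := averagingError R J c N μ k v ℓ δ a b w
  set M := timeAverage ν (decoupledHam Φ V X) (subHam Φ V I) - (e : ℂ) • 1 with hMdef
  have hM : IsSelfAdjoint M :=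
    (isSelfAdjoint_timeAverage isSelfAdjoint_decoupledHam isSelfAdjoint_subHam).sub
      (isSelfAdjoint_real_smul_one e)
  have hMX : IsLocal X M :=
    (isLocal_timeAverage ((isLocal_subHam (hI.trans hX)).mono hI hX)).sub (isLocal_smul_one hX _)
  obtain ⟨p, L, hp, h1, h2, h3⟩ := exists_local_spectral_projection hX hM hMX hθ.le
  have hav : timeAverage ν H (subHam Φ V I) = timeAverage ν (subHam Φ V V) (subHam Φ V I) :=
    timeAverage_add_smul_one _ _ _
  have hMP : ‖M * P₀‖ ≤ θ ^ 2 := by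
    have e1 : M * P₀ = (timeAverage ν H (subHam Φ V I) - (e : ℂ) • 1) * P₀ -
        (timeAverage ν (subHam Φ V V) (subHam Φ V I) -
          timeAverage ν (decoupledHam Φ V X) (subHam Φ V I)) * P₀ := by
      rw [hav, hMdef]; noncomm_ring
    rw [e1]
    refine (norm_sub_le _ _).trans (le_trans (add_le_add ?_ ?_) hθ')
    · refine (norm_timeAverage_sub_mul_le hH hn hHψ he hK).trans
        (mul_le_mul_of_nonneg_left ?_ (norm_nonneg _))
      have : com H (subHam Φ V I) = com (subHam Φ V V) (subHam Φ V I) := by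
        rw [com_add_left, com_smul_one_left, add_zero]
      rw [this]
      exact norm_com_subHam_le hΦ (hI.trans hX) hb
    · exact (norm_mul_le _ _).trans ((mul_le_of_le_one_right (norm_nonneg _) hn).trans hD)
  refine ⟨p, M, e, hp, hM, hMX, h1, ?_, ?_⟩
  -- Chebyshev: 1 - p = L M with ‖L‖ ≤ 1/θ, and M P₀ has norm at most θ².
  · rw [h2, mul_assoc]
    calc ‖L * (M * P₀)‖ ≤ ‖L‖ * θ ^ 2 :=
          (norm_mul_le _ _).trans (mul_le_mul_of_nonneg_left hMP (norm_nonneg _))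
      _ = ‖L‖ * θ * θ := by ring
      _ ≤ 1 * θ := mul_le_mul_of_nonneg_right h3 hθ.le
      _ = θ := one_mul _
  · rw [hav, hMdef, sub_add_cancel]
    exact hD

/-- The error in the localization of the interaction propagator. -/
def localizationError (R J c N μ k v ℓ δ a b : ℝ) (w : NNReal) : ℝ :=
  4 * averagingError R J c N μ k v ℓ δ a b w * (δ⁻¹ * (2 * Real.exp (w * δ ^ 2 / 2))) +
    c * b * (k * J * N * Real.exp (-μ * (2 * ℓ - R))) * (2 * Real.exp (w * (μ * v) ^ 2 / 2)) *
      (δ⁻¹ * (2 * Real.exp (w * (μ * v + δ) ^ 2 / 2)))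

/-- The construction with all parameters still free: `w` is the Gaussian variance, `θ` the spectral
cutoff, `δ` the rate spent on powers of |t|, and `b` a common bound on the edge and border sizes. -/
theorem exists_projections (hΦ : FiniteRange Φ R J c N) (hLR : LiebRobinson Φ μ k v)
    (hμ : 0 < μ) (hk : 0 < k) (hv : 0 < v) {γ : ℝ} (hγ : 0 < γ) {ψ : Config n V → ℂ}
    (hgs : IsGappedGroundState (hamiltonian Φ V) ψ γ) (hX : X ⊆ V) {ℓ : ℝ} (hℓ : 3 * R < ℓ)
    {b : ℝ} (hb₁ : ((boundary R V (interiorSet R V X ℓ)).card : ℝ) ≤ b)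
    (hb₂ : ((borderSet R V X ℓ).card : ℝ) ≤ b)
    (hb₃ : ((boundary R V (exteriorSet R V X ℓ)).card : ℝ) ≤ b) {δ : ℝ} (hδ : 0 < δ) (w : NNReal)
    {θ : ℝ} (hθ : 0 < θ)
    (hθ' : Real.exp (-w * γ ^ 2 / 2) / γ * (c * b * (c * N * (2 * J ^ 2))) +
      averagingError R J c N μ k v ℓ δ ((boundary R V X).card : ℝ) b w ≤ θ ^ 2) :
    ∃ (PX : LocalAlgebra n X) (PXc : LocalAlgebra n (V \ X))
      (Pbd : LocalAlgebra n (borderSet R V X (3 * ℓ))),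
      IsStarProjection PX ∧ IsStarProjection PXc ∧ ‖Pbd‖ ≤ 1 ∧
      ‖embed (borderSet_subset R V X (3 * ℓ)) Pbd * embed hX PX * embed Finset.sdiff_subset PXc -
        groundProjection ψ‖ ≤
        localizationError R J c N μ k v ℓ δ ((boundary R V X).card : ℝ) b w +
          2 * θ * (δ⁻¹ * (2 * Real.exp (w * δ ^ 2 / 2))) + Real.exp (-w * γ ^ 2 / 2) + 2 * θ := by
  have hR := hΦ.range_pos
  have hJ := hΦ.strength_pos
  have hN := hΦ.size_nonneg
  have hc := hΦ.count_nonneg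
  have hb0 : 0 ≤ b := (Nat.cast_nonneg _).trans hb₂
  set a : ℝ := ((boundary R V X).card : ℝ)
  have hψ := hgs.1
  obtain ⟨E, hE0, -, hE⟩ := hgs.exists_filter isSelfAdjoint_hamiltonian hγ
  obtain ⟨K, hK, hKn, hη⟩ := hE w
  set z : ℂ := (emptyTerm Φ : ℂ) - (E : ℂ) with hz
  have hHeq : hamiltonian Φ V - (E : ℂ) • 1 = subHam Φ V V + z • 1 := by
    rw [hamiltonian_eq, hz, sub_smul]; abel
  rw [hHeq] at hE0 hK hη
  set H := subHam Φ V V + z • 1 with hHdef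
  have hH : IsSelfAdjoint H := by
    rw [← hHeq]
    exact isSelfAdjoint_hamiltonian.sub (isSelfAdjoint_real_smul_one E)
  set ν := gaussianReal 0 w
  set D := averagingError R J c N μ k v ℓ δ a b w with hDdef
  have hθK : ‖K‖ * (c * b * (c * N * (2 * J ^ 2))) + D ≤ θ ^ 2 :=
    le_trans (add_le_add (mul_le_mul_of_nonneg_right hKn (by positivity)) le_rfl) hθ'
  have hcX : ((crossing Φ V X).card : ℝ) ≤ c * a := hΦ.card_crossing_le_boundary
  obtain ⟨p₁, M₁, e₁, hp₁, hM₁, hM₁X, hMp₁, hpP₁, hD₁⟩ := exists_side_projection hΦ hLR hμ hk hv hX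
    interiorSet_subset (by linarith : 2 * R < ℓ) (le_dist_of_mem_interiorSet hΦ) hb0 hcX
    (hΦ.card_crossing_le_boundary.trans (mul_le_mul_of_nonneg_left hb₁ hc)) hδ w hψ hH hE0 hK hθ hθK
  obtain ⟨p₂, M₂, e₂, hp₂, hM₂, hM₂X, hMp₂, hpP₂, hD₂⟩ := exists_side_projection hΦ hLR hμ hk hv
    (Finset.sdiff_subset : V \ X ⊆ V) exteriorSet_subset (by linarith : 2 * R < ℓ)
    (le_dist_of_mem_exteriorSet hΦ) hb0 (by rw [crossing_sdiff]; exact hcX)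
    (hΦ.card_crossing_le_boundary.trans (mul_le_mul_of_nonneg_left hb₃ hc)) hδ w hψ hH hE0 hK hθ hθK
  have hD0 : 0 ≤ D := (norm_nonneg _).trans hD₁
  set h₁ := subHam Φ V (interiorSet R V X ℓ)
  set h₂ := subHam Φ V (exteriorSet R V X ℓ)
  set hbd := borderHam Φ R ℓ V X with hbddef
  set D₁ := timeAverage ν H h₁ - (M₁ + e₁ • 1) with hD₁def
  set D₂ := timeAverage ν H h₂ - (M₂ + e₂ • 1) with hD₂def
  have hdyn : ∀ s B, dyn H s B = dyn (subHam Φ V V) s B := fun s B => dyn_add_smul_one _ _ _ _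
  -- `H` is its own time average, so averaging the decomposition costs nothing; the scalar is
  -- invisible to commutators.
  have hdecomp : H - (M₁ + M₂) = timeAverage ν H hbd + D₁ + D₂ + (z + e₁ + e₂) • 1 := by
    have h0 : H = h₁ + h₂ + hbd + z • 1 := by
      rw [hbddef, borderHam, hHdef]; abel
    have hzc : Commute H (z • 1) := (Commute.one_right H).smul_right z
    have h1 : H = timeAverage ν H h₁ + timeAverage ν H h₂ + timeAverage ν H hbd + z • 1 := by
      calc H = timeAverage ν H H := (timeAverage_of_commute (Commute.refl H)).symm
        _ = timeAverage ν H (h₁ + h₂ + hbd + z • 1) := by rw [← h0]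
        _ = _ := by
          rw [timeAverage_add hH, timeAverage_add hH, timeAverage_add hH,
            timeAverage_of_commute hzc]
    conv_lhs => rw [h1]
    rw [hD₁def, hD₂def, add_smul, add_smul]
    abel
  set F := 2 * Real.exp (w * (μ * v) ^ 2 / 2) with hF
  set G := c * b * (k * J * N * Real.exp (-μ * (2 * ℓ - R))) with hG
  -- Each remainder D₁, D₂ contributes 2D by the trivial bound; only the averaged border piece needs
  -- the Lieb-Robinson estimate.
  have hcomD : ∀ B : LocalAlgebra n (V \ borderSet R V X (3 * ℓ)), ‖B‖ ≤ 1 → ∀ s,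
      ‖com (dyn H s (H - (M₁ + M₂))) (embed Finset.sdiff_subset B)‖ ≤
        4 * D + G * Real.exp (μ * v * |s|) * F := by
    intro B hB s
    set B' := embed (Finset.sdiff_subset : V \ borderSet R V X (3 * ℓ) ⊆ V) B with hB'
    have hBn : ‖B'‖ ≤ 1 := by rwa [hB', norm_embed]
    have hsmall : ∀ T : LocalAlgebra n V, ‖T‖ ≤ D → ‖com (dyn H s T) B'‖ ≤ 2 * D := fun T hT => by
      refine (norm_com_le _ _).trans ?_
      rw [norm_dyn hH]
      calc 2 * ‖T‖ * ‖B'‖ ≤ 2 * D * 1 := by gcongr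
        _ = _ := mul_one _
    have hbdr : ‖com (dyn H s (timeAverage ν H hbd)) B'‖ ≤ G * Real.exp (μ * v * |s|) * F := by
      rw [dyn_timeAverage hH]
      refine (norm_com_integral_le (integrable_of_continuous_of_norm_le
        ((continuous_dyn H hbd).comp (continuous_const.add continuous_id))
          (r := ‖hbd‖) fun u => (norm_dyn hH _ _).le)
        (g := fun u => G * Real.exp (μ * v * |s|) * Real.exp (μ * v * |u|))
        ((integrable_exp_mul_abs _ w).const_mul _) fun u => ?_).trans ?_
      · change ‖com (dyn H (s + u) hbd) B'‖ ≤ _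
        rw [hdyn]
        refine (norm_com_dyn_borderHam_le hΦ hLR hμ hk (by linarith) (isLocal_embed _ B) hb₂
          (s + u)).trans ?_
        have h1 : Real.exp (-μ * (2 * ℓ - R - v * |s + u|)) ≤
            Real.exp (-μ * (2 * ℓ - R)) * Real.exp (μ * v * |s|) * Real.exp (μ * v * |u|) := by
          rw [← Real.exp_add, ← Real.exp_add]
          refine Real.exp_le_exp.2 ?_
          have := mul_le_mul_of_nonneg_left (abs_add_le s u) (mul_pos hμ hv).le
          linarith
        calc c * b * (k * J * ‖B'‖ * N * Real.exp (-μ * (2 * ℓ - R - v * |s + u|)))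
            ≤ c * b * (k * J * 1 * N * (Real.exp (-μ * (2 * ℓ - R)) * Real.exp (μ * v * |s|) *
              Real.exp (μ * v * |u|))) := by gcongr
          _ = _ := by rw [hG]; ring
      · rw [MeasureTheory.integral_const_mul]
        exact mul_le_mul_of_nonneg_left (integral_exp_mul_abs_le _ w) (by positivity)
    rw [hdecomp, dyn_add, dyn_add, dyn_add, com_add_left, com_add_left, com_add_left, dyn_smul,
      dyn_one, com_smul_one_left, add_zero]
    refine (norm_add_le _ _).trans ((add_le_add (norm_add_le _ _) le_rfl).trans ?_)
    linarith [hsmall D₁ hD₁, hsmall D₂ hD₂]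
  have hM : IsSelfAdjoint (M₁ + M₂) := hM₁.add hM₂
  set T := ∫ t, propagator H t * propagator (M₁ + M₂) (-t) ∂ν with hT
  have hUc : Continuous fun t => propagator H t * propagator (M₁ + M₂) (-t) :=
    (continuous_propagator H).mul ((continuous_propagator _).comp continuous_neg)
  have hUn : ∀ t, ‖propagator H t * propagator (M₁ + M₂) (-t)‖ ≤ 1 := fun t =>
    (CStarRing.norm_of_mem_unitary (mul_mem (propagator_mem_unitary hH t)
      (propagator_mem_unitary hM (-t)))).le
  have hTn : ‖T‖ ≤ 1 := by
    refine (norm_integral_le_of_norm_le (integrable_const (1 : ℝ))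
      (Filter.Eventually.of_forall hUn)).trans_eq ?_
    simp
  have hτi : Integrable (fun t : ℝ => |t|) ν :=
    ((integrable_exp_mul_abs δ w).const_mul δ⁻¹).mono' (by fun_prop)
      (Filter.Eventually.of_forall fun t => by
        rw [Real.norm_eq_abs, abs_abs]; exact abs_le_exp_mul_abs hδ t)
  have hτ : ∫ t : ℝ, |t| ∂ν ≤ δ⁻¹ * (2 * Real.exp (w * δ ^ 2 / 2)) := by
    calc ∫ t : ℝ, |t| ∂ν ≤ ∫ t : ℝ, δ⁻¹ * Real.exp (δ * |t|) ∂ν :=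
          integral_mono hτi ((integrable_exp_mul_abs δ w).const_mul _) (abs_le_exp_mul_abs hδ)
      _ ≤ _ := by
          rw [MeasureTheory.integral_const_mul]
          exact mul_le_mul_of_nonneg_left (integral_exp_mul_abs_le _ w) (by positivity)
  obtain ⟨Pbd, hPbd, hPT⟩ := exists_local_approximation (borderSet_subset R V X (3 * ℓ))
    (Finset.sdiff_subset : V \ borderSet R V X (3 * ℓ) ⊆ V) subset_rfl T
    (δ := localizationError R J c N μ k v ℓ δ a b w) (fun B hB => by
      have hgi : Integrable (fun t : ℝ => 4 * D * |t| +
          G * F * (δ⁻¹ * Real.exp ((μ * v + δ) * |t|))) ν :=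
        (hτi.const_mul _).add (((integrable_exp_mul_abs _ w).const_mul _).const_mul _)
      refine (norm_com_integral_le (integrable_of_continuous_of_norm_le hUc hUn) hgi
        fun t => ?_).trans ?_
      · refine (norm_com_propagator_mul_propagator_le hH hM _
          (δ := 4 * D + G * Real.exp (μ * v * |t|) * F) fun s hs => ?_).trans ?_
        · refine (hcomD B hB s).trans ?_
          gcongr
        · have h1 := abs_le_exp_mul_abs hδ t
          have e2 : Real.exp ((μ * v + δ) * |t|) =
              Real.exp (μ * v * |t|) * Real.exp (δ * |t|) := by
            rw [← Real.exp_add]; congr 1; ring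
          rw [e2]
          calc |t| * (4 * D + G * Real.exp (μ * v * |t|) * F)
              = 4 * D * |t| + G * F * Real.exp (μ * v * |t|) * |t| := by ring
            _ ≤ 4 * D * |t| + G * F * Real.exp (μ * v * |t|) * (δ⁻¹ * Real.exp (δ * |t|)) := by
                gcongr
            _ = _ := by ring
      · rw [integral_add (hτi.const_mul _)
          (((integrable_exp_mul_abs _ w).const_mul _).const_mul _),
          MeasureTheory.integral_const_mul, MeasureTheory.integral_const_mul,
          MeasureTheory.integral_const_mul]
        have := integral_exp_mul_abs_le (μ * v + δ) w
        unfold localizationError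
        gcongr)
  refine ⟨p₁, p₂, Pbd, hp₁, hp₂, hPbd.trans hTn, ?_⟩
  have hl₁ : IsLocal X (embed hX p₁) := isLocal_embed hX p₁
  have hl₂ : IsLocal (V \ X) (embed Finset.sdiff_subset p₂) := isLocal_embed _ p₂
  exact norm_mul_mul_sub_le hH hM₁ hM₂ (hp₁.map (embedHom hX)) (hp₂.map (embedHom _))
    (isStarProjection_groundProjection hψ) (hM₂X.commute hl₁ Finset.sdiff_disjoint)
    (hl₁.commute hl₂ Finset.disjoint_sdiff) hMp₁ hMp₂ hpP₁ hpP₂ hη hPT hτi hτ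

end Main

end SpinSystem

namespace SpinSystem

/-! ### Decoupled subsystems -/

section Decoupled

variable {S : Type*} {n : S → ℕ} [DecidableEq S] [∀ x, NeZero (n x)] {Φ : Interaction n}
  {V X : Finset S}

theorem norm_one_localAlgebra_le (W : Finset S) : ‖(1 : LocalAlgebra n W)‖ ≤ 1 :=
  (CStarRing.norm_of_mem_unitary (one_mem _)).le

/-- Without interactions across the boundary the ground state is a product state. -/
theorem exists_projections_of_crossing_eq_empty {γ : ℝ} (hγ : 0 < γ) {ψ : Config n V → ℂ}
    (hgs : IsGappedGroundState (hamiltonian Φ V) ψ γ) (hX : X ⊆ V) (h : crossing Φ V X = ∅) :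
    ∃ (PX : LocalAlgebra n X) (PXc : LocalAlgebra n (V \ X)),
      IsStarProjection PX ∧ IsStarProjection PXc ∧
      embed hX PX * embed Finset.sdiff_subset PXc = groundProjection ψ := by
  obtain ⟨E, hE0, hQ, -⟩ := hgs.exists_filter isSelfAdjoint_hamiltonian hγ
  set z : ℂ := (emptyTerm Φ : ℂ) - (E : ℂ) with hz
  have hHeq : hamiltonian Φ V - (E : ℂ) • 1 = subHam Φ V V + z • 1 := by
    rw [hamiltonian_eq, hz, sub_smul]; abel
  rw [hHeq] at hE0 hQ
  have hψ := hgs.1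
  have hP := isStarProjection_groundProjection hψ
  have hdec : subHam Φ V V = subHam Φ V X + subHam Φ V (V \ X) := by
    rw [← decoupledHam, ← sub_eq_zero, subHam_sub_decoupledHam, h, Finset.sum_empty]
  obtain ⟨e₁, he₁⟩ := exists_real_expectation (ψ := ψ) (isSelfAdjoint_subHam (Φ := Φ) (V := V) (W := X))
  obtain ⟨e₂, he₂⟩ := exists_real_expectation (ψ := ψ)
    (isSelfAdjoint_subHam (Φ := Φ) (V := V) (W := V \ X))
  have hl₁ := isLocal_subHam (Φ := Φ) hX
  have hl₂ := isLocal_subHam (Φ := Φ) (Finset.sdiff_subset : V \ X ⊆ V)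
  set h₁ := subHam Φ V X
  set h₂ := subHam Φ V (V \ X)
  set P₀ := groundProjection ψ
  have hPP : P₀ * P₀ = P₀ := hP.isIdempotentElem
  set M₁ := h₁ - (e₁ : ℂ) • 1 with hM₁def
  set M₂ := h₂ - (e₂ : ℂ) • 1 with hM₂def
  have hM₁ : IsSelfAdjoint M₁ := isSelfAdjoint_subHam.sub (isSelfAdjoint_real_smul_one e₁)
  have hM₂ : IsSelfAdjoint M₂ := isSelfAdjoint_subHam.sub (isSelfAdjoint_real_smul_one e₂)
  have hM₁X : IsLocal X M₁ := hl₁.sub (isLocal_smul_one hX _)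
  have hM₂X : IsLocal (V \ X) M₂ := hl₂.sub (isLocal_smul_one Finset.sdiff_subset _)
  have hMM : Commute M₁ M₂ := hM₁X.commute hM₂X Finset.disjoint_sdiff
  have hPM₁ : P₀ * M₁ * P₀ = 0 := by
    rw [hM₁def, mul_sub, sub_mul, he₁]; simp [hPP]
  have hPM₂ : P₀ * M₂ * P₀ = 0 := by
    rw [hM₂def, mul_sub, sub_mul, he₂]; simp [hPP]
  have hsum : subHam Φ V V + z • 1 = M₁ + M₂ + (z + e₁ + e₂) • 1 := by
    rw [hdec, hM₁def, hM₂def, add_smul, add_smul]; abel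
  have hP0 : P₀ ≠ 0 := by
    intro h0
    have h1 : P₀.trace = 1 := by
      change (groundProjection ψ).trace = 1
      rw [groundProjection, Matrix.trace_vecMulVec, dotProduct_comm, hψ]
    rw [h0, Matrix.trace_zero] at h1
    exact zero_ne_one h1
  -- Sandwiching the eigenvalue equation between P₀ shows that the energies of the two halves add up
  -- to the ground state energy.
  have hz0 : z + e₁ + e₂ = 0 := by
    have h1 : (z + e₁ + e₂) • P₀ = 0 := by
      calc (z + e₁ + e₂) • P₀ = P₀ * M₁ * P₀ + P₀ * M₂ * P₀ + (z + e₁ + e₂) • (P₀ * P₀) := by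
            rw [hPM₁, hPM₂, hPP]; simp
        _ = P₀ * ((M₁ + M₂ + (z + e₁ + e₂) • 1) * P₀) := by
            simp only [add_mul, mul_add, smul_mul_assoc, one_mul, mul_smul_comm, mul_assoc]
        _ = 0 := by rw [← hsum, hE0, mul_zero]
    exact (smul_eq_zero.1 h1).resolve_right hP0
  rw [hsum, hz0, zero_smul, add_zero] at hE0 hQ
  -- M₁ commutes with M₁ + M₂, so M₁ P₀ lies in its kernel, the range of P₀; its compression there
  -- vanishes.
  have hMP₁ : M₁ * P₀ = 0 := by
    rw [← hQ (M₁ * P₀), ← mul_assoc, hPM₁]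
    rw [← mul_assoc, ((Commute.refl M₁).add_left hMM.symm).eq, mul_assoc, hE0, mul_zero]
  have hMP₂ : M₂ * P₀ = 0 := by
    rw [← hQ (M₂ * P₀), ← mul_assoc, hPM₂]
    rw [← mul_assoc, (hMM.add_left (Commute.refl M₂)).eq, mul_assoc, hE0, mul_zero]
  obtain ⟨p₁, L₁, hp₁, a1, a2, -⟩ := exists_local_spectral_projection hX hM₁ hM₁X le_rfl
  obtain ⟨p₂, L₂, hp₂, b1, b2, -⟩ :=
    exists_local_spectral_projection Finset.sdiff_subset hM₂ hM₂X le_rfl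
  refine ⟨p₁, p₂, hp₁, hp₂, ?_⟩
  have hlp₁ : IsLocal X (embed hX p₁) := isLocal_embed hX p₁
  have hlp₂ : IsLocal (V \ X) (embed Finset.sdiff_subset p₂) := isLocal_embed _ p₂
  have hs₁ := ((hp₁.map (embedHom hX)).isSelfAdjoint).star_eq
  have hs₂ := ((hp₂.map (embedHom (Finset.sdiff_subset : V \ X ⊆ V))).isSelfAdjoint).star_eq
  rw [embedHom_apply] at hs₁ hs₂
  set P₁ := embed hX p₁
  set P₂ := embed (Finset.sdiff_subset : V \ X ⊆ V) p₂
  have hcomm : Commute P₁ P₂ := hlp₁.commute hlp₂ Finset.disjoint_sdiff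
  have a3 : P₁ * P₀ = P₀ := by
    have : (1 - P₁) * P₀ = 0 := by rw [a2, mul_assoc, hMP₁, mul_zero]
    rw [sub_mul, one_mul, sub_eq_zero] at this
    exact this.symm
  have b3 : P₂ * P₀ = P₀ := by
    have : (1 - P₂) * P₀ = 0 := by rw [b2, mul_assoc, hMP₂, mul_zero]
    rw [sub_mul, one_mul, sub_eq_zero] at this
    exact this.symm
  have hkill : (M₁ + M₂) * (P₁ * P₂) = 0 := by
    have hc : Commute M₂ P₁ := hM₂X.commute hlp₁ Finset.sdiff_disjoint
    rw [add_mul, ← mul_assoc, norm_le_zero_iff.1 a1, zero_mul, zero_add, ← mul_assoc, hc.eq,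
      mul_assoc, norm_le_zero_iff.1 b1, mul_zero]
  have h2 : P₀ * (P₁ * P₂) = P₀ := by
    have h3 : P₂ * P₁ * P₀ = P₀ := by rw [mul_assoc, a3, b3]
    have h4 := congrArg star h3
    rw [star_mul, star_mul, hs₁, hs₂, hP.isSelfAdjoint.star_eq] at h4
    exact h4
  rw [← hQ _ hkill, h2]

end Decoupled

/-! ### Verification of the hypotheses on the interaction -/

section Hypotheses

variable {S : Type*} [MetricSpace S] [DecidableEq S] {n : S → ℕ} {Φ : Interaction n} {R J : ℝ}

theorem countConst_le_sizeConst {S : Type*} {n : S → ℕ} (Φ : Interaction n) :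
    countConst Φ ≤ sizeConst Φ := by
  refine iSup_mono fun x => ENNReal.tsum_le_tsum fun Z => ?_
  split_ifs with h
  · have : 1 ≤ Z.card := Finset.card_pos.2 ⟨x, h.1⟩
    exact_mod_cast this
  · exact le_rfl

theorem finiteRange_of_sizeConst_lt_top (hR : 0 < R)
    (hdiam : ∀ Z : Finset S, R < Metric.diam (Z : Set S) → Φ.term Z = 0) (hJ : 0 < J)
    (hnorm : ∀ Z, ‖Φ.term Z‖ ≤ J) (hsize : sizeConst Φ < ⊤) :
    FiniteRange Φ R J (countConst Φ).toReal (sizeConst Φ).toReal where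
  dist_le {Z} hZ x hx y hy :=
    (Metric.dist_le_diam_of_mem Z.finite_toSet.isBounded hx hy).trans
      (not_lt.1 fun h => hZ (hdiam Z h))
  norm_le := hnorm
  count_le x F hF := by
    have h1 : (F.card : ℝ≥0∞) ≤ countConst Φ := by
      refine le_trans ?_ (le_iSup _ x)
      refine le_trans ?_ (ENNReal.sum_le_tsum F)
      calc (F.card : ℝ≥0∞) = ∑ Z ∈ F, 1 := by simp
        _ ≤ _ := Finset.sum_le_sum fun Z hZ => by rw [if_pos (hF Z hZ)]
    have := ENNReal.toReal_mono ((countConst_le_sizeConst Φ).trans_lt hsize).ne h1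
    simpa using this
  card_le {Z} hZ := by
    rcases Z.eq_empty_or_nonempty with rfl | ⟨x, hx⟩
    · simp
    have h1 : (Z.card : ℝ≥0∞) ≤ sizeConst Φ := by
      refine le_trans ?_ (le_iSup _ x)
      refine le_trans ?_ (ENNReal.le_tsum Z)
      rw [if_pos ⟨hx, hZ⟩]
    have := ENNReal.toReal_mono hsize.ne h1
    simpa using this
  range_pos := hR
  strength_pos := hJ
  count_nonneg := ENNReal.toReal_nonneg
  size_nonneg := ENNReal.toReal_nonneg

/-- A single crossing term makes the factors C_Φ, N_Φ and |∂X| at least 1, so they may be inserted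
into the error bound freely. -/
theorem FiniteRange.one_le_of_crossing {c N : ℝ} (hΦ : FiniteRange Φ R J c N) {V X Z : Finset S}
    (hZ : Z ∈ crossing Φ V X) : 1 ≤ c ∧ 1 ≤ N ∧ (1 : ℝ) ≤ (boundary R V X).card := by
  obtain ⟨-, h0, ⟨x, hx, hxX⟩, -⟩ := exists_of_mem_crossing hZ
  refine ⟨?_, ?_, ?_⟩
  · have := hΦ.count_le x {Z} (by simpa using ⟨hx, h0⟩)
    simpa using this
  · refine le_trans ?_ (hΦ.card_le h0)
    exact_mod_cast Finset.card_pos.2 ⟨x, hx⟩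
  · exact_mod_cast Finset.card_pos.2 ⟨x, hΦ.mem_boundary hZ hx hxX⟩

end Hypotheses

end SpinSystem

namespace SpinSystem

/-! ### The prefactor -/

namespace Parameters

variable (p : Parameters)

/-- The coefficient of the error made by decoupling the averaged interior Hamiltonian. -/
def averagingConst : ℝ :=
  p.cPhi * p.C * (p.cPhi * p.nPhi) * (p.cPhi * (8 * p.c * p.J ^ 3 * p.nPhi)) *
    (2 * (p.γ / 4)⁻¹ ^ 2) * Real.exp (2 * p.μ * p.R) * 2

/-- The coefficient of the squared spectral cutoff. -/
def cutoffConst : ℝ :=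
  p.averagingConst + p.cPhi * p.C * (p.cPhi * p.nPhi * (2 * p.J ^ 2)) / p.γ + 1

/-- The part of the prefactor that is linear in the length scale. -/
def linearConst : ℝ :=
  8 * p.averagingConst * (p.γ / 4)⁻¹ +
    p.cPhi * p.C * (p.c * p.J * p.nPhi) * Real.exp (p.μ * p.R) * (4 * (p.γ / 4)⁻¹) +
    p.cutoffConst * (4 * (p.γ / 4)⁻¹ + 2)

/-- The part of the prefactor that does not depend on the length scale. -/
def zerothConst : ℝ :=
  4 * (p.γ / 4)⁻¹ + 2 + 1

/-- The prefactor in the error bound. -/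
def prefactor : ℝ :=
  max 1 (max
    (p.R ^ (-(7 / 2) : ℝ) *
      Real.exp (3 * p.R / 4 * (p.μ * p.γ ^ 2 / (p.μ ^ 2 * p.v ^ 2 + p.γ ^ 2))))
    (p.linearConst * p.R ^ (-(5 / 2) : ℝ) + p.zerothConst * p.R ^ (-(7 / 2) : ℝ)))

theorem prefactor_pos : 0 < p.prefactor := lt_of_lt_of_le one_pos (le_max_left _ _)

end Parameters

/-! ### Balancing the exponents -/

section Numerics

variable {γ δ μ v ℓ A : ℝ}

/-- After substituting μℓ the exponents differ by A times the square of μv/2 - 3γ/8 plus γ²A/16. So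
at variance 3A/2 the Lieb-Robinson error is no larger than the gap error e^{-3γ²A/4}. -/
theorem exp_neg_mul_exp_le (hA : 0 ≤ A) (hAℓ : A * (μ ^ 2 * v ^ 2 + γ ^ 2) = μ * ℓ) :
    Real.exp (-μ * ℓ) * Real.exp (3 / 2 * A * (μ * v + γ / 4) ^ 2 / 2) ≤
      Real.exp (-(γ ^ 2 * A) / 8) ^ 6 := by
  rw [← Real.exp_add, ← Real.exp_nat_mul]
  refine Real.exp_le_exp.2 ?_
  have := mul_nonneg hA (sq_nonneg (μ * v / 2 - 3 * (γ / 4) / 2))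
  have := mul_nonneg hA (sq_nonneg γ)
  push_cast
  nlinarith

theorem one_le_rpow_mul_rpow {R s : ℝ} (hR : 0 < R) (hs : 0 ≤ s) (h : R ≤ ℓ) :
    1 ≤ R ^ (-s) * ℓ ^ s := by
  rw [Real.rpow_neg hR.le, inv_mul_eq_div, one_le_div (Real.rpow_pos_of_pos hR s)]
  exact Real.rpow_le_rpow hR.le h hs

theorem sqrt_le_one_add {x : ℝ} (hx : 0 ≤ x) : √x ≤ 1 + x :=
  (Real.sqrt_le_left (by positivity)).2 (by nlinarith)

variable {R J c N k C a : ℝ}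

theorem averagingError_le (hk : 0 < k) (hJ : 0 < J) (hc : 0 ≤ c) (hN : 0 ≤ N)
    (hC : 0 < C) (hℓ : 0 < ℓ) (ha : 1 ≤ a) (hγ : 0 < γ) {w : NNReal} (hA : 0 ≤ A)
    (hw : (w : ℝ) = 3 / 2 * A) (hAℓ : A * (μ ^ 2 * v ^ 2 + γ ^ 2) = μ * ℓ) (κ : ℝ) :
    averagingError R J c N μ k v ℓ (γ / 4) a (C * ℓ * a) w ≤
      (⟨R, J, κ, c, N, μ, k, v, γ, C⟩ : Parameters).averagingConst * ℓ * a ^ 2 *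
        Real.exp (-(γ ^ 2 * A) / 8) ^ 6 := by
  have h1 := exp_neg_mul_exp_le (μ := μ) (v := v) (γ := γ) (ℓ := ℓ) hA hAℓ
  have h2 : Real.exp (-μ * (ℓ - 2 * R)) = Real.exp (2 * μ * R) * Real.exp (-μ * ℓ) := by
    rw [← Real.exp_add]; ring_nf
  simp only [averagingError, Parameters.averagingConst, hw, h2]
  calc _ = c * C * (c * N) * (c * (8 * k * J ^ 3 * N)) * (2 * (γ / 4)⁻¹ ^ 2) *
      Real.exp (2 * μ * R) * 2 * ℓ * a ^ 2 *
        (Real.exp (-μ * ℓ) * Real.exp (3 / 2 * A * (μ * v + γ / 4) ^ 2 / 2)) := by ring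
    _ ≤ _ := mul_le_mul_of_nonneg_left h1 (by positivity)

end Numerics

/-! ### Choice of parameters and assembly of the bound -/

section Assembly

variable {S : Type*} [MetricSpace S] [DecidableEq S] {n : S → ℕ} [∀ x, NeZero (n x)]
  {Φ : Interaction n} {R J c N μ k v γ C ℓ : ℝ} {V X : Finset S}

/-- With q = e^{-γ²A/8} the target is q². The gap and averaging errors are of order q⁶, so θ is of
order q³, and the Gaussian first moment costs at most a factor 1/q. The dominant term θ times this
moment thus has order q². -/
theorem exists_projections_of_boundaryVolume (hΦ : FiniteRange Φ R J c N)
    (hLR : LiebRobinson Φ μ k v) (hμ : 0 < μ) (hk : 0 < k) (hv : 0 < v) (hγ : 0 < γ) (hC : 0 < C)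
    {ψ : Config n V → ℂ} (hgs : IsGappedGroundState (hamiltonian Φ V) ψ γ) (hX : X ⊆ V)
    (hbv : BoundaryVolume R C V X) (hℓ : 3 * R < ℓ)
    (ha : (1 : ℝ) ≤ (boundary R V X).card) (κ : ℝ) :
    ∃ (PX : LocalAlgebra n X) (PXc : LocalAlgebra n (V \ X))
      (Pbd : LocalAlgebra n (borderSet R V X (3 * ℓ))),
      IsStarProjection PX ∧ IsStarProjection PXc ∧ ‖Pbd‖ ≤ 1 ∧
      ‖embed (borderSet_subset R V X (3 * ℓ)) Pbd * embed hX PX * embed Finset.sdiff_subset PXc -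
        groundProjection ψ‖ ≤
        ((⟨R, J, κ, c, N, μ, k, v, γ, C⟩ : Parameters).linearConst * ℓ +
          (⟨R, J, κ, c, N, μ, k, v, γ, C⟩ : Parameters).zerothConst) *
          ((boundary R V X).card : ℝ) ^ 2 *
          Real.exp (-(ℓ / 4 * (μ * γ ^ 2 / (μ ^ 2 * v ^ 2 + γ ^ 2)))) := by
  have hR := hΦ.range_pos
  have hJ := hΦ.strength_pos
  have hN := hΦ.size_nonneg
  have hc := hΦ.count_nonneg
  have hℓ0 : 0 < ℓ := by linarith
  set a : ℝ := ((boundary R V X).card : ℝ)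
  set p : Parameters := ⟨R, J, κ, c, N, μ, k, v, γ, C⟩ with hp
  have hden : 0 < μ ^ 2 * v ^ 2 + γ ^ 2 := by positivity
  set A : ℝ := μ * ℓ / (μ ^ 2 * v ^ 2 + γ ^ 2) with hAdef
  have hA : 0 ≤ A := by positivity
  have hAℓ : A * (μ ^ 2 * v ^ 2 + γ ^ 2) = μ * ℓ := div_mul_cancel₀ _ hden.ne'
  set w : NNReal := ⟨3 / 2 * A, by positivity⟩ with hwdef
  have hw : (w : ℝ) = 3 / 2 * A := rfl
  set q := Real.exp (-(γ ^ 2 * A) / 8) with hq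
  have hq0 : 0 < q := Real.exp_pos _
  have hq1 : q ≤ 1 := Real.exp_le_one_iff.2 (by
    have : 0 ≤ γ ^ 2 * A := by positivity
    linarith)
  have hgap : Real.exp (-w * γ ^ 2 / 2) = q ^ 6 := by
    rw [hq, ← Real.exp_nat_mul, hw]; push_cast; ring_nf
  have hweight : Real.exp (w * (γ / 4) ^ 2 / 2) * q ≤ 1 := by
    rw [hq, ← Real.exp_add]
    refine Real.exp_le_one_iff.2 ?_
    have : 0 ≤ γ ^ 2 * A := by positivity
    rw [hw]
    nlinarith
  have htarget : Real.exp (-(ℓ / 4 * (μ * γ ^ 2 / (μ ^ 2 * v ^ 2 + γ ^ 2)))) = q ^ 2 := by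
    rw [hq, ← Real.exp_nat_mul, hAdef]; push_cast; ring_nf
  have hD := averagingError_le (R := R) (v := v) hk hJ hc hN hC hℓ0 ha hγ hA hw hAℓ κ
  rw [← hp, ← hq] at hD
  have hK1 : 0 ≤ p.averagingConst := by
    simp only [hp, Parameters.averagingConst]; positivity
  have hK3 : 0 < p.cutoffConst := by
    simp only [hp, Parameters.cutoffConst]; rw [← hp]; positivity
  -- θ² must dominate the bound on M_i P₀, of order q⁶; the summand 1 in `cutoffConst` keeps θ
  -- positive.
  set θ : ℝ := √(p.cutoffConst * ℓ) * a * q ^ 3 with hθdef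
  have hθ : 0 < θ := by positivity
  have hθ2 : θ ^ 2 = p.cutoffConst * ℓ * a ^ 2 * q ^ 6 := by
    rw [hθdef, mul_pow, mul_pow, Real.sq_sqrt (by positivity)]; ring
  have haa : a ≤ a ^ 2 := by nlinarith
  have hθ' : Real.exp (-w * γ ^ 2 / 2) / γ * (c * (C * ℓ * a) * (c * N * (2 * J ^ 2))) +
      averagingError R J c N μ k v ℓ (γ / 4) a (C * ℓ * a) w ≤ θ ^ 2 := by
    have h1 : q ^ 6 / γ * (c * (C * ℓ * a) * (c * N * (2 * J ^ 2))) ≤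
        c * C * (c * N * (2 * J ^ 2)) / γ * ℓ * a ^ 2 * q ^ 6 := by
      calc _ = c * C * (c * N * (2 * J ^ 2)) / γ * ℓ * a * q ^ 6 := by ring
        _ ≤ _ := by gcongr
    have h2 : 0 ≤ ℓ * a ^ 2 * q ^ 6 := by positivity
    rw [hθ2, hgap]
    have h3 : p.cutoffConst * ℓ * a ^ 2 * q ^ 6 = p.averagingConst * ℓ * a ^ 2 * q ^ 6 +
        c * C * (c * N * (2 * J ^ 2)) / γ * ℓ * a ^ 2 * q ^ 6 + ℓ * a ^ 2 * q ^ 6 := by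
      simp only [Parameters.cutoffConst, hp]; ring
    linarith
  have hb := hbv ℓ (by linarith)
  obtain ⟨PX, PXc, Pbd, h1, h2, h3, h4⟩ := exists_projections hΦ hLR hμ hk hv hγ hgs hX hℓ
    ((le_max_left _ _).trans hb) (((le_max_left _ _).trans (le_max_right _ _)).trans hb)
    (((le_max_right _ _).trans (le_max_right _ _)).trans hb) (by positivity : 0 < γ / 4) w hθ hθ'
  refine ⟨PX, PXc, Pbd, h1, h2, h3, h4.trans ?_⟩
  rw [htarget, hgap]
  have hpow : ∀ m : ℕ, 2 ≤ m → q ^ m ≤ q ^ 2 := fun m hm => pow_le_pow_of_le_one hq0.le hq1 hm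
  have ha2 : 1 ≤ a ^ 2 := ha.trans haa
  set u := Real.exp (w * (γ / 4) ^ 2 / 2)
  have hu0 : 0 < u := Real.exp_pos _
  have hθq : θ ≤ (1 + p.cutoffConst * ℓ) * a ^ 2 * q ^ 3 := by
    rw [hθdef]
    gcongr
    exact sqrt_le_one_add (by positivity)
  have e1 : 4 * averagingError R J c N μ k v ℓ (γ / 4) a (C * ℓ * a) w * ((γ / 4)⁻¹ * (2 * u)) ≤
      8 * p.averagingConst * (γ / 4)⁻¹ * ℓ * a ^ 2 * q ^ 2 := by
    calc _ ≤ 4 * (p.averagingConst * ℓ * a ^ 2 * q ^ 6) * ((γ / 4)⁻¹ * (2 * u)) := by gcongr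
      _ = 8 * p.averagingConst * (γ / 4)⁻¹ * ℓ * a ^ 2 * (q ^ 5 * (u * q)) := by ring
      _ ≤ 8 * p.averagingConst * (γ / 4)⁻¹ * ℓ * a ^ 2 * (q ^ 2 * 1) := by
        gcongr 8 * p.averagingConst * (γ / 4)⁻¹ * ℓ * a ^ 2 * (?_ * ?_)
        exact hpow 5 (by norm_num)
      _ = _ := by ring
  have e2 : c * (C * ℓ * a) * (k * J * N * Real.exp (-μ * (2 * ℓ - R))) *
        (2 * Real.exp (w * (μ * v) ^ 2 / 2)) *
        ((γ / 4)⁻¹ * (2 * Real.exp (w * (μ * v + γ / 4) ^ 2 / 2))) ≤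
      c * C * (k * J * N) * Real.exp (μ * R) * (4 * (γ / 4)⁻¹) * ℓ * a ^ 2 * q ^ 2 := by
    have f1 := exp_neg_mul_exp_le (μ := μ) (v := v) (γ := γ) (ℓ := ℓ) hA hAℓ
    have f2 : Real.exp (w * (μ * v) ^ 2 / 2) ≤ Real.exp (w * (μ * v + γ / 4) ^ 2 / 2) := by
      gcongr
      linarith
    rw [← hw, ← hq] at f1
    have f3 : Real.exp (-μ * (2 * ℓ - R)) =
        Real.exp (μ * R) * (Real.exp (-μ * ℓ) * Real.exp (-μ * ℓ)) := by
      rw [← Real.exp_add, ← Real.exp_add]; ring_nf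
    set s := Real.exp (w * (μ * v + γ / 4) ^ 2 / 2)
    calc _ ≤ c * (C * ℓ * a ^ 2) * (k * J * N * Real.exp (-μ * (2 * ℓ - R))) *
          (2 * s) * ((γ / 4)⁻¹ * (2 * s)) := by gcongr
      _ = c * C * (k * J * N) * Real.exp (μ * R) * (4 * (γ / 4)⁻¹) * ℓ * a ^ 2 *
          ((Real.exp (-μ * ℓ) * s) * (Real.exp (-μ * ℓ) * s)) := by rw [f3]; ring
      _ ≤ c * C * (k * J * N) * Real.exp (μ * R) * (4 * (γ / 4)⁻¹) * ℓ * a ^ 2 *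
          (q ^ 6 * q ^ 6) := by gcongr
      _ ≤ _ := by
        rw [← pow_add]
        exact mul_le_mul_of_nonneg_left (hpow 12 (by norm_num)) (by positivity)
  have e3 : 2 * θ * ((γ / 4)⁻¹ * (2 * u)) ≤
      4 * (γ / 4)⁻¹ * (1 + p.cutoffConst * ℓ) * a ^ 2 * q ^ 2 := by
    calc _ ≤ 2 * ((1 + p.cutoffConst * ℓ) * a ^ 2 * q ^ 3) * ((γ / 4)⁻¹ * (2 * u)) := by gcongr
      _ = 4 * (γ / 4)⁻¹ * (1 + p.cutoffConst * ℓ) * a ^ 2 * q ^ 2 * (u * q) := by ring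
      _ ≤ _ := mul_le_of_le_one_right (by positivity) hweight
  have e4 : q ^ 6 ≤ a ^ 2 * q ^ 2 :=
    (hpow 6 (by norm_num)).trans (le_mul_of_one_le_left (by positivity) ha2)
  have e5 : 2 * θ ≤ 2 * (1 + p.cutoffConst * ℓ) * a ^ 2 * q ^ 2 := by
    calc _ ≤ 2 * ((1 + p.cutoffConst * ℓ) * a ^ 2 * q ^ 3) := by gcongr
      _ ≤ 2 * ((1 + p.cutoffConst * ℓ) * a ^ 2 * q ^ 2) := by
        gcongr 2 * ((1 + p.cutoffConst * ℓ) * a ^ 2 * ?_)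
        exact hpow 3 (by norm_num)
      _ = _ := by ring
  have hfin : (p.linearConst * ℓ + p.zerothConst) * a ^ 2 * q ^ 2 =
      8 * p.averagingConst * (γ / 4)⁻¹ * ℓ * a ^ 2 * q ^ 2 +
      c * C * (k * J * N) * Real.exp (μ * R) * (4 * (γ / 4)⁻¹) * ℓ * a ^ 2 * q ^ 2 +
      4 * (γ / 4)⁻¹ * (1 + p.cutoffConst * ℓ) * a ^ 2 * q ^ 2 + a ^ 2 * q ^ 2 +
      2 * (1 + p.cutoffConst * ℓ) * a ^ 2 * q ^ 2 := by
    simp only [Parameters.linearConst, Parameters.zerothConst, hp]; ring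
  rw [hfin, localizationError]
  linarith

/-- Three regimes: no crossing term, where the ground state factorizes exactly and the right side
may vanish; ℓ ≤ 3R, where identities suffice; and ℓ > 3R, where the main estimate is linear in ℓ and
is weakened to ℓ^{7/2} by means of ℓ > R. -/
theorem exists_projections_of_liebRobinson (hΦ : FiniteRange Φ R J c N)
    (hLR : LiebRobinson Φ μ k v) (hμ : 0 < μ) (hk : 0 < k) (hv : 0 < v) (hγ : 0 < γ) (hC : 0 < C)
    {ψ : Config n V → ℂ} (hgs : IsGappedGroundState (hamiltonian Φ V) ψ γ) (hX : X ⊆ V)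
    (hbv : BoundaryVolume R C V X) (hℓ : R < ℓ) (κ : ℝ) :
    ∃ (PX : LocalAlgebra n X) (PXc : LocalAlgebra n (V \ X))
      (Pbd : LocalAlgebra n (borderSet R V X (3 * ℓ))),
      IsStarProjection PX ∧ IsStarProjection PXc ∧ ‖Pbd‖ ≤ 1 ∧
      ‖embed (borderSet_subset R V X (3 * ℓ)) Pbd * embed hX PX * embed Finset.sdiff_subset PXc -
        groundProjection ψ‖ ≤
        (⟨R, J, κ, c, N, μ, k, v, γ, C⟩ : Parameters).prefactor * c * N *
          ((boundary R V X).card : ℝ) ^ 2 * ℓ ^ (7 / 2 : ℝ) *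
          Real.exp (-(ℓ / 4 * (μ * γ ^ 2 / (μ ^ 2 * v ^ 2 + γ ^ 2)))) := by
  have hR := hΦ.range_pos
  have hJ := hΦ.strength_pos
  have hN := hΦ.size_nonneg
  have hc := hΦ.count_nonneg
  have hℓ0 : 0 < ℓ := by linarith
  set p : Parameters := ⟨R, J, κ, c, N, μ, k, v, γ, C⟩ with hp
  have hK := p.prefactor_pos
  set rate := μ * γ ^ 2 / (μ ^ 2 * v ^ 2 + γ ^ 2) with hrate
  have hrate0 : 0 < rate := by positivity
  rcases (crossing Φ V X).eq_empty_or_nonempty with h | ⟨Z, hZ⟩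
  · obtain ⟨PX, PXc, h1, h2, h3⟩ := exists_projections_of_crossing_eq_empty hγ hgs hX h
    refine ⟨PX, PXc, 1, h1, h2, norm_one_localAlgebra_le _, ?_⟩
    have h4 : embed (borderSet_subset R V X (3 * ℓ)) (1 : LocalAlgebra n _) = 1 :=
      map_one (embedHom _)
    rw [h4, one_mul, h3, sub_self, norm_zero]
    positivity
  obtain ⟨hc1, hN1, ha⟩ := hΦ.one_le_of_crossing hZ
  set a : ℝ := ((boundary R V X).card : ℝ)
  have hreduce : ∀ {M : ℝ}, 0 ≤ M → M ≤ p.prefactor * ℓ ^ (7 / 2 : ℝ) →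
      M * a ^ 2 * Real.exp (-(ℓ / 4 * rate)) ≤ p.prefactor * c * N * a ^ 2 * ℓ ^ (7 / 2 : ℝ) *
        Real.exp (-(ℓ / 4 * rate)) := fun {M} hM0 hM => by
    have h1 : 1 ≤ c * N := one_le_mul_of_one_le_of_one_le hc1 hN1
    calc _ ≤ p.prefactor * ℓ ^ (7 / 2 : ℝ) * a ^ 2 * Real.exp (-(ℓ / 4 * rate)) := by gcongr
      _ ≤ p.prefactor * ℓ ^ (7 / 2 : ℝ) * a ^ 2 * Real.exp (-(ℓ / 4 * rate)) * (c * N) :=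
        le_mul_of_one_le_right (by positivity) h1
      _ = _ := by ring
  rcases le_or_gt ℓ (3 * R) with hsmall | hlarge
  -- The error ‖1 - P₀‖ ≤ 1 is absorbed by the prefactor, since the exponential is bounded below for
  -- ℓ ≤ 3R.
  · refine ⟨1, 1, 1, .one _, .one _, norm_one_localAlgebra_le _, ?_⟩
    have h4 : ∀ {W : Finset S} (hW : W ⊆ V), embed hW (1 : LocalAlgebra n W) = 1 :=
      fun hW => map_one (embedHom hW)
    rw [h4, h4, h4, one_mul, one_mul]
    refine (norm_isStarProjection_le
      (isStarProjection_groundProjection hgs.1).one_sub).trans ?_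
    refine le_trans ?_ (hreduce (M := Real.exp (3 * R / 4 * rate)) (Real.exp_pos _).le ?_)
    · have ha2 : 1 ≤ a ^ 2 := one_le_pow₀ ha
      have h5 : 1 ≤ Real.exp (3 * R / 4 * rate) * Real.exp (-(ℓ / 4 * rate)) := by
        rw [← Real.exp_add]
        refine Real.one_le_exp ?_
        have := mul_le_mul_of_nonneg_right hsmall hrate0.le
        linarith
      calc (1 : ℝ) ≤ Real.exp (3 * R / 4 * rate) * Real.exp (-(ℓ / 4 * rate)) * a ^ 2 :=
            one_le_mul_of_one_le_of_one_le h5 ha2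
        _ = _ := by ring
    · calc Real.exp (3 * R / 4 * rate) ≤
            Real.exp (3 * R / 4 * rate) * (R ^ (-(7 / 2) : ℝ) * ℓ ^ (7 / 2 : ℝ)) :=
            le_mul_of_one_le_right (Real.exp_pos _).le
              (one_le_rpow_mul_rpow hR (by norm_num) hℓ.le)
        _ = R ^ (-(7 / 2) : ℝ) * Real.exp (3 * R / 4 * rate) * ℓ ^ (7 / 2 : ℝ) := by ring
        _ ≤ _ := by
          gcongr
          exact (le_max_left _ _).trans (le_max_right _ _)
  · obtain ⟨PX, PXc, Pbd, h1, h2, h3, h4⟩ := exists_projections_of_boundaryVolume hΦ hLR hμ hk hv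
      hγ hC hgs hX hbv hlarge ha κ
    rw [← hp] at h4
    have hK1 : 0 ≤ p.averagingConst := by
      simp only [hp, Parameters.averagingConst]; positivity
    have hK3 : 0 ≤ p.cutoffConst := by
      simp only [hp, Parameters.cutoffConst]; rw [← hp]; positivity
    have hK5 : 0 ≤ p.linearConst := by
      simp only [hp, Parameters.linearConst]; rw [← hp]; positivity
    have hK6 : 0 ≤ p.zerothConst := by
      simp only [hp, Parameters.zerothConst]; positivity
    refine ⟨PX, PXc, Pbd, h1, h2, h3, h4.trans (hreduce (by positivity) ?_)⟩
    have f1 : ℓ ≤ R ^ (-(5 / 2) : ℝ) * ℓ ^ (7 / 2 : ℝ) := by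
      have : ℓ ^ (7 / 2 : ℝ) = ℓ ^ (5 / 2 : ℝ) * ℓ := by
        rw [← Real.rpow_add_one hℓ0.ne']; norm_num
      rw [this, ← mul_assoc]
      exact le_mul_of_one_le_left hℓ0.le (one_le_rpow_mul_rpow hR (by norm_num) hℓ.le)
    have f2 : 1 ≤ R ^ (-(7 / 2) : ℝ) * ℓ ^ (7 / 2 : ℝ) :=
      one_le_rpow_mul_rpow hR (by norm_num) hℓ.le
    calc p.linearConst * ℓ + p.zerothConst ≤
          p.linearConst * (R ^ (-(5 / 2) : ℝ) * ℓ ^ (7 / 2 : ℝ)) +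
            p.zerothConst * (R ^ (-(7 / 2) : ℝ) * ℓ ^ (7 / 2 : ℝ)) :=
          add_le_add (mul_le_mul_of_nonneg_left f1 hK5) (le_mul_of_one_le_right hK6 f2)
      _ = (p.linearConst * R ^ (-(5 / 2) : ℝ) + p.zerothConst * R ^ (-(7 / 2) : ℝ)) *
            ℓ ^ (7 / 2 : ℝ) := by ring
      _ ≤ _ := by
        gcongr
        exact (le_max_right _ _).trans (le_max_right _ _)

end Assembly

end SpinSystem

end

theorem theorem2p2 :
    ∃ K : SpinSystem.Parameters → ℝ, (∀ p, 0 < K p) ∧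
      ∀ (S : Type*) [MetricSpace S] [Countable S] [DecidableEq S]
        (n : S → ℕ) (Φ : SpinSystem.Interaction n) (μ₀ R J μ : ℝ),
        (∀ (x : S) (r : ℝ), (Metric.closedBall x r).Finite) →
        (∀ x, 0 < n x) →
        0 < μ₀ → SpinSystem.kappa S μ₀ < ⊤ →
        0 < R → (∀ X : Finset S, R < Metric.diam (X : Set S) → Φ.term X = 0) →
        0 < J → (∀ X : Finset S, ‖Φ.term X‖ ≤ J) →
        SpinSystem.sizeConst Φ < ⊤ →
        2 * μ₀ ≤ μ →
        (∃ c v : ℝ, 0 < c ∧ 0 < v ∧ SpinSystem.LiebRobinson Φ μ c v) ∧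
        ∀ c v γ C : ℝ, 0 < c → 0 < v → SpinSystem.LiebRobinson Φ μ c v → 0 < γ → 0 < C →
        ∀ (V : Finset S) (ψ₀ : SpinSystem.Config n V → ℂ),
          SpinSystem.IsGappedGroundState (SpinSystem.hamiltonian Φ V) ψ₀ γ →
        ∀ (X : Finset S) (hX : X ⊆ V), SpinSystem.BoundaryVolume R C V X →
        ∀ ξ : ℝ, 2 / ξ = μ * γ ^ 2 / (μ ^ 2 * v ^ 2 + γ ^ 2) →
        ∀ ℓ : ℝ, R < ℓ →
        ∃ (PX : SpinSystem.LocalAlgebra n X) (PXc : SpinSystem.LocalAlgebra n (V \ X))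
          (Pbd : SpinSystem.LocalAlgebra n (SpinSystem.borderSet R V X (3 * ℓ))),
          IsStarProjection PX ∧ IsStarProjection PXc ∧ ‖Pbd‖ ≤ 1 ∧
          ‖SpinSystem.embed (SpinSystem.borderSet_subset R V X (3 * ℓ)) Pbd *
              SpinSystem.embed hX PX *
              SpinSystem.embed Finset.sdiff_subset PXc -
              SpinSystem.groundProjection ψ₀‖ ≤
            K { R := R, J := J, kappaHalf := (SpinSystem.kappa S (μ / 2)).toReal,
                cPhi := (SpinSystem.countConst Φ).toReal,
                nPhi := (SpinSystem.sizeConst Φ).toReal,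
                μ := μ, c := c, v := v, γ := γ, C := C } *
              (SpinSystem.countConst Φ).toReal * (SpinSystem.sizeConst Φ).toReal *
              ((SpinSystem.boundary R V X).card : ℝ) ^ 2 * ℓ ^ (7 / 2 : ℝ) *
              Real.exp (-ℓ / (2 * ξ)) := by
  refine ⟨SpinSystem.Parameters.prefactor, fun p => p.prefactor_pos, ?_⟩
  intro S _ _ _ n Φ μ₀ R J μ _ hn hμ₀ _ hR hdiam hJ hnorm hsize hμ
  have : ∀ x, NeZero (n x) := fun x => ⟨(hn x).ne'⟩
  have hμ' : 0 < μ := by linarith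
  have hΦ := SpinSystem.finiteRange_of_sizeConst_lt_top hR hdiam hJ hnorm hsize
  refine ⟨hΦ.exists_liebRobinson hμ', ?_⟩
  intro c v γ C hc hv hLR hγ hC V ψ₀ hgs X hX hbv ξ hξ ℓ hℓ
  -- ℓ/(2ξ) is ℓ/4 times 2/ξ, so ξ enters only through its defining relation.
  have hrate : -ℓ / (2 * ξ) = -(ℓ / 4 * (μ * γ ^ 2 / (μ ^ 2 * v ^ 2 + γ ^ 2))) := by
    rw [← hξ, div_eq_mul_inv, mul_inv]; ring
  rw [hrate]
  exact SpinSystem.exists_projections_of_liebRobinson hΦ hLR hμ' hc hv hγ hC hgs hX hbv hℓ _
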